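/- **Setting.** For every $N\in\mathbb N$ let $\Gamma_N$ be a finite set and $P_N$ the transition matrix of an irreducible discrete-time Markov chain $(X_t)$ on $\Gamma_N$, reversible with respect to a probability measure $\mathbb Q_N$, and suppose that the spectrum of $1-P_N$ is contained in $[0,1]$. For $I\subset\Gamma_N$ let $\tau^x_I=\inf\{t>0: X_t\in I\}$ for the chain with $X_0=x$ (we write $\tau^x_y$ for $\tau^x_{\{y\}}$). Let $\mathcal M_N\subset\Gamma_N$ be a set of metastable points: there are $a_N,b_N>0$ and $\varepsilon_N\to0$ with $a_N^{-1}\le\varepsilon_N b_N$ such that $\mathbb P[\tau^z_{\mathcal M_N}\le\tau^z_z]\ge b_N$ for all $z\in\Gamma_N$ and $\mathbb P[\tau^x_y<\tau^x_x]\le a_N^{-1}$ for all $x\ne y$ in $\mathcal M_N$. For $x\in\mathcal M_N$ put $A(x)=\{z\in\Gamma_N:\mathbb P[\tau^z_x=\tau^z_{\mathcal M_N}]=\max_{y\in\mathcal M_N}\mathbb P[\tau^z_y=\tau^z_{\mathcal M_N}]\}$, $R_x=\mathbb Q_N(x)/\mathbb Q_N(A(x))$, $r_N=\max_{x\in\mathcal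 M_N}R_x$, $c_N^{-1}=\min_{x\in\mathcal M_N}R_x$. For $\emptyset\ne I\subset\mathcal M_N$ and $x\in\mathcal M_N\setminus I$ put $T_{x,I}=\mathbb P[\tau^x_I\le\tau^x_x]^{-1}$ and $T_I=\max_{x\in\mathcal M_N\setminus I}T_{x,I}$. Suppose the chains are generic: there is $\epsilon_N\to0$ such that for all $x\neq y$ in $\mathcal M_N$ and all nonempty $I\subset\mathcal M_N\setminus\{x,y\}$ either $T_{x,I}\le\epsilon_NT_{y,I}$ or $T_{y,I}\le\epsilon_NT_{x,I}$, and some $m\in\mathcal M_N$ satisfies $\mathbb Q_N(x)\le\epsilon_N\mathbb Q_N(m)$ for all $x\in\mathcal M_N\setminus\{m\}$. Finally suppose that $r_N\varepsilon_N|\Gamma_N||\mathcal M_N|\to0$ and $r_Nc_N\epsilon_N\to0$. For $I\subset\mathcal M_N$ with $I\neq\emptyset$, $I\ne\mathcal M_N$, let $j_0=|\mathcal M_N\setminus I|$ and $\Sigma_0=I$, and for $j=1,\dots,j_0$ let $T_j=T_{\Sigma_{j-1}}$, let $m_j\in\mathcal M_N\setminus\Sigma_{j-1}$ be the point with $T_{m_j,\Sigma_{j-1}}=T_j$,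 and let $\Sigma_j=\Sigma_{j-1}\cup\{m_j\}$; put $T_{j_0+1}=b_N^{-1}|\Gamma_N|$. Let $\lambda_1\le\lambda_2\le\cdots$ be the eigenvalues, counted with multiplicity, of the Dirichlet operator $(1-P_N)^I$, that is, $1-P_N$ compressed to the functions on $\Gamma_N$ that vanish on $I$, and let $u_j=-\ln(1-\lambda_j)$. **Theorem.** There are constants $c>0$ and $K>0$, independent of $N$, $I$ and $t$, such that for all sufficiently large $N$ and all $I$ as above the following holds. The Laplace transform $\mathcal L_N(u)=\sum_{t=0}^\infty e^{ut}\,\mathbb P[\tau^{m_1}_I>t]$, which converges for $\operatorname{Re}u<u_1$, extends to a meromorphic function on $\mathbb C$, integrable on the segment $[\alpha_N-i\pi,\alpha_N+i\pi]$ with $\alpha_N=c\,b_N|\Gamma_N|^{-1}$, and for all $t\in\{0,1,2,\dots\}$ $$\mathbb P[\tau_I^{m_1}>t]=-\sum_{j=1}^{j_0}e^{-tu_j}\operatorname{res}_{u_j}\mathcal L_N+e^{-t\alpha_N}\,\frac1{2\pi i}\int_{-i\pi}^{i\pi}e^{-tu}\mathcal L_N(u+\alpha_N)\,du .$$ Moreover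 $$\bigl|\operatorname{res}_{u_1}\mathcal L_N+1\bigr|\le K\,R_{m_1}c_N\frac{T_2}{T_1},\qquad \bigl|\operatorname{res}_{u_j}\mathcal L_N\bigr|\le K\,R_{m_1}c_N\frac{T_j}{T_1}\quad(j=2,\dots,j_0),$$ and, for all $t\in\{0,1,2,\dots\}$, $$\Bigl|\frac1{2\pi i}\int_{-i\pi}^{i\pi}e^{-tu}\mathcal L_N(u+\alpha_N)\,du\Bigr|\le K\,\frac{c_N^{-1}b_N^{-2}|\Gamma_N|^2}{T_1}.$$ -/

import Mathlib

open MeasureTheory ProbabilityTheory Filter Topology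

noncomputable section

namespace Metastability

/-- An irreducible Markov chain in discrete time on the finite set `Γ`, with transition matrix `P`,
reversible with respect to the probability measure `Q`. -/
structure ReversibleChain (Γ : Type*) [Fintype Γ] [DecidableEq Γ] where
  P : Matrix Γ Γ ℝ
  Q : Γ → ℝ
  row_sum : ∀ x, ∑ y, P x y = 1
  irreducible : P.IsIrreducible
  Q_nonneg : ∀ x, 0 ≤ Q x
  Q_sum : ∑ x, Q x = 1
  reversible : ∀ x y, Q x * P x y = Q y * P y x

section Chain

variable {Γ : Type*} [Fintype Γ] [DecidableEq Γ] [MeasurableSpace Γ] [DiscreteMeasurableSpace Γ]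

namespace ReversibleChain

/-- The one-step transition kernel. -/
def kernel (C : ReversibleChain Γ) : Kernel Γ Γ :=
  Kernel.ofFunOfCountable fun x => ∑ y, ENNReal.ofReal (C.P x y) • Measure.dirac y

instance (C : ReversibleChain Γ) : IsMarkovKernel C.kernel where
  isProbabilityMeasure x := by
    constructor
    change (∑ y, ENNReal.ofReal (C.P x y) • Measure.dirac y) Set.univ = 1
    simp only [Measure.coe_finsetSum, Finset.sum_apply, Measure.smul_apply, measure_univ,
      smul_eq_mul, mul_one]
    rw [← ENNReal.ofReal_sum_of_nonneg (fun y _ => C.irreducible.nonneg x y), C.row_sum,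
      ENNReal.ofReal_one]

/-- The law, on the space of trajectories, of the chain `(X_t)` started in `X_0 = x`. -/
def law (C : ReversibleChain Γ) (x : Γ) : Measure (ℕ → Γ) :=
  Kernel.trajMeasure (X := fun _ => Γ) (Measure.dirac x) fun n =>
    C.kernel.comap (fun h : (i : Finset.Iic n) → Γ => h ⟨n, Finset.mem_Iic.2 le_rfl⟩)
      (measurable_pi_apply _)

/-- `prob C x E` is the probability of the event `E` for the chain started in `x`. -/
def prob (C : ReversibleChain Γ) (x : Γ) (E : Set (ℕ → Γ)) : ℝ := (C.law x).real E

end ReversibleChain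

/-- `hit I ω` is the first time `t > 0` at which the trajectory `ω` is in `I` (`⊤` if there is
none). -/
def hit (I : Finset Γ) : (ℕ → Γ) → WithTop ℕ :=
  hittingAfter (fun t ω => ω t) (I : Set Γ) 1

/-- `M` is a set of metastable points with constants `a` and `b`. -/
structure IsMetastableSet (C : ReversibleChain Γ) (M : Finset Γ) (a b : ℝ) : Prop where
  a_pos : 0 < a
  b_pos : 0 < b
  reach : ∀ z, b ≤ C.prob z {ω | hit M ω ≤ hit {z} ω}
  escape : ∀ x ∈ M, ∀ y ∈ M, x ≠ y → C.prob x {ω | hit {y} ω < hit {x} ω} ≤ a⁻¹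

open Classical in
/-- The local valley `A(x)` of the metastable point `x`. -/
def valley (C : ReversibleChain Γ) (M : Finset Γ) (x : Γ) : Finset Γ :=
  {z | ∀ y ∈ M, C.prob z {ω | hit {y} ω = hit M ω} ≤ C.prob z {ω | hit {x} ω = hit M ω}}

/-- `R_x = Q(x) / Q(A(x))`. -/
def R (C : ReversibleChain Γ) (M : Finset Γ) (x : Γ) : ℝ :=
  C.Q x / ∑ z ∈ valley C M x, C.Q z

/-- `r = max_{x ∈ M} R_x`. -/
def rMax (C : ReversibleChain Γ) (M : Finset Γ) : ℝ := sSup (R C M '' M)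

/-- `c⁻¹ = min_{x ∈ M} R_x`; this is `c`. -/
def cMax (C : ReversibleChain Γ) (M : Finset Γ) : ℝ := (sInf (R C M '' M))⁻¹

/-- `T_{x,I} = (P[τ^x_I ≤ τ^x_x])⁻¹`. It is only used for nonempty `I`. -/
def T (C : ReversibleChain Γ) (x : Γ) (I : Finset Γ) : ℝ :=
  (C.prob x {ω | hit I ω ≤ hit {x} ω})⁻¹

/-- `T_I = max_{x ∈ M \ I} T_{x,I}`. -/
def TSup (C : ReversibleChain Γ) (M I : Finset Γ) : ℝ :=
  sSup ((fun x => T C x I) '' ((M \ I : Finset Γ) : Set Γ))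

/-- Non-degeneracy of the chain on the level of `M`, with parameter `ε`. -/
structure IsGeneric (C : ReversibleChain Γ) (M : Finset Γ) (ε : ℝ) : Prop where
  times : ∀ x ∈ M, ∀ y ∈ M, x ≠ y → ∀ I : Finset Γ, I.Nonempty → I ⊆ M \ {x, y} →
    T C x I ≤ ε * T C y I ∨ T C y I ≤ ε * T C x I
  mass : ∃ m ∈ M, ∀ x ∈ M, x ≠ m → C.Q x ≤ ε * C.Q m

/-- The exclusion sets `Σ_j = I ∪ {m_1, …, m_j}`. -/
def excl (I : Finset Γ) (m : ℕ → Γ) (j : ℕ) : Finset Γ := I ∪ (Finset.Icc 1 j).image m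

/-- `m_1, …, m_{j₀}`, with `j₀ = |M \ I|`, is the sequence obtained by choosing successively
`m_j ∈ M \ Σ_{j-1}` with `T_{m_j, Σ_{j-1}} = T_{Σ_{j-1}}`. -/
def IsExitOrder (C : ReversibleChain Γ) (M I : Finset Γ) (m : ℕ → Γ) : Prop :=
  ∀ j ∈ Finset.Icc 1 (M \ I).card,
    m j ∈ M \ excl I m (j - 1) ∧ T C (m j) (excl I m (j - 1)) = TSup C M (excl I m (j - 1))

/-- The effective depths: `T_j = T_{Σ_{j-1}}` for `1 ≤ j ≤ j₀`, and `T_{j₀+1} = b⁻¹ |Γ|`. -/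
def depth (C : ReversibleChain Γ) (M I : Finset Γ) (m : ℕ → Γ) (b : ℝ) (j : ℕ) : ℝ :=
  if j ≤ (M \ I).card then TSup C M (excl I m (j - 1)) else b⁻¹ * Fintype.card Γ

/-- The matrix of the Dirichlet operator `(1 - P)^I`, acting on the functions that vanish on `I`. -/
def dirichlet (C : ReversibleChain Γ) (I : Finset Γ) : Matrix {x // x ∉ I} {x // x ∉ I} ℝ :=
  (1 - C.P).submatrix Subtype.val Subtype.val

/-- `λ_j`, for `1 ≤ j ≤ |Γ \ I|`: the `j`-th eigenvalue of `(1 - P)^I`, in increasing order and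
counted with multiplicity. -/
def eigenvalue (C : ReversibleChain Γ) (I : Finset Γ) (j : ℕ) : ℝ :=
  ((dirichlet C I).charpoly.roots.sort (· ≤ ·)).getD (j - 1) 0

/-- `u_j = -ln (1 - λ_j)`. -/
def rate (C : ReversibleChain Γ) (I : Finset Γ) (j : ℕ) : ℝ := -Real.log (1 - eigenvalue C I j)

/-- `L` is the meromorphic continuation to the plane of the Laplace transform
`u ↦ ∑_{t ≥ 0} e^{ut} P[τ^x_I > t]`, `Re u < u_1`. -/
def IsLaplaceContinuation (C : ReversibleChain Γ) (I : Finset Γ) (x : Γ) (L : ℂ → ℂ) : Prop :=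
  Meromorphic L ∧ ∀ u : ℂ, u.re < rate C I 1 →
    HasSum (fun t : ℕ => Complex.exp (u * t) * (C.prob x {ω | (t : WithTop ℕ) < hit I ω} : ℂ)) (L u)

end Chain

/-- `r` is the residue of `f` at `z`: `∮ f = 2πi r` over all small circles around `z`. -/
def HasResidueAt (f : ℂ → ℂ) (z r : ℂ) : Prop :=
  ∀ᶠ ρ in 𝓝[>] (0 : ℝ), CircleIntegrable f z ρ ∧ (∮ w in C(z, ρ), f w) = 2 * Real.pi * Complex.I * r

/-- `(2πi)⁻¹ ∫_{-iπ}^{iπ} e^{-tu} L(u + α) du`, with `u = i v`. -/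
def remainder (L : ℂ → ℂ) (α : ℝ) (t : ℕ) : ℂ :=
  (2 * Real.pi : ℂ)⁻¹ *
    ∫ v in (-Real.pi)..Real.pi, Complex.exp (-(t * (v * Complex.I))) * L (v * Complex.I + α)

end Metastability

end

set_option linter.unusedSectionVars false

noncomputable section

namespace Metastability

open Finset

/-! ### The law of the chain on trajectories, the Markov property and first-step analysis. -/

section Trajectories

variable {Γ : Type*} [Fintype Γ] [DecidableEq Γ] [MeasurableSpace Γ] [DiscreteMeasurableSpace Γ]

namespace ReversibleChain

/-! Expand the survival probability in eigenfunctions of the Dirichlet operator: it equals ∑ c_k (1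
- λ_k)^t with ∑ c_k = 1 (`SpectralResolution.prob_lt_hit`). Hence L(u) = ∑ c_k / (1 - e^u (1 -
λ_k)), a simple λ_k < 1 produces a pole at u_k with residue -c_k, and the Fourier integral over Re u
= α keeps exactly the modes with u_k > α (`remainder_sum`). It remains to show that the j₀ lowest
eigenvalues are simple and are the only ones below the line, that the weights satisfy c_1 ≈ 1 and
c_j ≈ 0, and that the integral is small.

All three follow from one notion, `IsLevel C I S β`: the Green function of the chain killed in S has
trace at most 1/(8β), so that S is reached well before time 1/β, while every point of S \ I escapes
to the rest of S at a rate well below β. The sets S = Σ_j are levels with β_j = 1/(48 c T_{j+1}) for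
j < j₀ (`isLevel_excl`), and M itself is one with β of order b/|Γ| (`isLevel_self`). The inputs are
T_{j+1} ≤ ε T_j (`pot_succ_le`), the fact that none of m_1, …, m_j escapes Σ_j faster than m_j does
(`pot_le_pot_erase`), and the comparison of the mass attracted by a metastable point with the mass
of its valley (`sum_Q_mul_pot_le`, `valleyMass_le_sum`).

Spectrum. Functions vanishing on S have Rayleigh quotient at least 8β, and the equilibrium
potentials of the points of S \ I span a space of dimension |S \ I| on which it is below β/2. So
exactly |S \ I| eigenvalues are at most β/2 and none lies between β/2 and 8β (`card_eq`,
`lam_le_or`). Two successive levels differ by one point and therefore isolate one eigenvalue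
(`exists_low`).

Resolvent. Put ζ = 1 - e^{-u}. In the region |ζ| ≥ β, |1 - ζ| ≥ 1 - β the spectral gap bounds the
resolvent with S \ {x} killed, and a renewal inequality shows that the resolvent kernel for I with
pole m_1 is dominated by the equilibrium potential of m_1 (`norm_green_le_pot`). This bounds F(ζ) =
∑ c_k λ_k / (λ_k - ζ) by a multiple of 1/T_1 (`norm_genFun_le`).

The integral of F(ζ)/ζ over |ζ| = β_j is 2πi (1 - ∑_{i ≤ j} c_i) (`norm_one_sub_sum_le`), so the
partial sums of weights are close to 1, and their differences give the residues. The line Re u = α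
becomes the circle |1 - ζ| = 1 - β_{j₀}; on it a term with no Fourier coefficients of order t ≥ 0 is
subtracted from L, which leaves F(ζ) (1 - ζ)/ζ with |F| ≤ 4/(|ζ| T_1) (`norm_remainder_le`). -/

instance isProbabilityMeasure_law (C : ReversibleChain Γ) (x : Γ) :
    IsProbabilityMeasure (C.law x) := by
  unfold law; infer_instance

lemma kernel_singleton (C : ReversibleChain Γ) (x y : Γ) :
    C.kernel x {y} = ENNReal.ofReal (C.P x y) := by
  change (∑ z, ENNReal.ofReal (C.P x z) • Measure.dirac z) {y} = _
  simp only [Measure.coe_finsetSum, Finset.sum_apply, Measure.smul_apply, smul_eq_mul]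
  rw [Finset.sum_eq_single y]
  · simp
  · intro z _ hz
    simp [hz]
  · simp

/-- Probabilities of cylinder events. -/
lemma law_cylinder (C : ReversibleChain Γ) (x : Γ) (s : ℕ → Γ) (n : ℕ) :
    C.law x {ω | ∀ i ≤ n, ω i = s i} =
      (if s 0 = x then 1 else 0) * ∏ i ∈ range n, ENNReal.ofReal (C.P (s i) (s (i + 1))) := by
  induction n with
  | zero =>
    let a : (i : Finset.Iic 0) → Γ := fun i => s i
    have e1 : (Preorder.frestrictLe (π := fun _ => Γ) 0) ⁻¹' {a} = {ω | ∀ i ≤ 0, ω i = s i} := by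
      ext ω
      simp [funext_iff, a]
    rw [← e1, ← Measure.map_apply (by fun_prop) (measurableSet_singleton _), law,
      Kernel.trajMeasure, Measure.map_comp _ _ (by fun_prop), Kernel.traj_map_frestrictLe,
      Kernel.partialTraj_self, Measure.id_comp,
      Measure.map_apply (by fun_prop) (measurableSet_singleton _), Measure.dirac_apply]
    simp [Set.indicator, funext_iff, a, eq_comm]
  | succ n ih =>
    have key := Kernel.map_frestrictLe_trajMeasure_compProd_eq_map_trajMeasure
      (X := fun _ => Γ) (μ₀ := Measure.dirac x)
      (κ := fun n => C.kernel.comap (fun h : (i : Finset.Iic n) → Γ => h ⟨n, Finset.mem_Iic.2 le_rfl⟩)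
      (measurable_pi_apply _)) (a := n)
    let a : (i : Finset.Iic n) → Γ := fun i => s i
    have h1 := congrArg (fun μ => μ ({a} ×ˢ {s (n + 1)})) key
    beta_reduce at h1
    rw [Measure.compProd_apply_prod (measurableSet_singleton _) (measurableSet_singleton _),
      lintegral_singleton, Measure.map_apply (by fun_prop) (measurableSet_singleton _),
      Measure.map_apply (by fun_prop)
        ((measurableSet_singleton _).prod (measurableSet_singleton _))] at h1
    have e1 : (Preorder.frestrictLe (π := fun _ => Γ) n) ⁻¹' {a} = {ω | ∀ i ≤ n, ω i = s i} := by
      ext ω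
      simp [funext_iff, a]
    have e2 : (fun ω : ℕ → Γ => (Preorder.frestrictLe (π := fun _ => Γ) n ω, ω (n + 1))) ⁻¹'
        ({a} ×ˢ {s (n + 1)}) = {ω | ∀ i ≤ n + 1, ω i = s i} := by
      ext ω
      simp only [Set.mem_preimage, Set.mem_prod, Set.mem_singleton_iff, Set.mem_ofPred_eq,
        Nat.le_succ_iff, funext_iff, a]
      constructor
      · rintro ⟨h, h'⟩ i (hi | rfl)
        · exact h ⟨i, mem_Iic.2 hi⟩
        · exact h'
      · intro h
        exact ⟨fun i => h i (Or.inl (mem_Iic.1 i.2)), h _ (Or.inr rfl)⟩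
    rw [e1, e2] at h1
    change _ = C.law x _ at h1
    rw [← h1]
    change _ * C.law x _ = _
    rw [ih, Kernel.comap_apply, kernel_singleton, prod_range_succ]
    ring

lemma ae_start (C : ReversibleChain Γ) (x : Γ) : ∀ᵐ ω ∂C.law x, ω 0 = x := by
  have hS : MeasurableSet {ω : ℕ → Γ | ω 0 = x} :=
    measurableSet_eq_fun (by fun_prop) (by fun_prop)
  refine (mem_ae_iff_prob_eq_one hS).2 ?_
  have h0 : C.law x {ω | ∀ i ≤ 0, ω i = (fun _ => x) i} = 1 := by
    rw [C.law_cylinder x (fun _ => x) 0]; simp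
  rw [← h0]
  congr 1
  ext ω
  simp

/-- The Markov property at time one. -/
lemma map_shift_law (C : ReversibleChain Γ) (x : Γ) :
    (C.law x).map (fun ω t => ω (t + 1)) =
      ∑ y, ENNReal.ofReal (C.P x y) • C.law y := by
  have fin : IsFiniteMeasure (∑ y, ENNReal.ofReal (C.P x y) • C.law y) := by
    constructor
    simp only [Measure.coe_finsetSum, Finset.sum_apply, Measure.smul_apply, measure_univ,
      smul_eq_mul, mul_one]
    exact ENNReal.sum_lt_top.2 fun y _ => ENNReal.ofReal_lt_top
  have hm : Measurable (fun (ω : ℕ → Γ) (t : ℕ) => ω (t + 1)) := by fun_prop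
  set μ := (C.law x).map (fun ω t => ω (t + 1)) with hμ
  set ν := ∑ y, ENNReal.ofReal (C.P x y) • C.law y with hν
  have hproj : IsProjectiveLimit ν (fun J : Finset ℕ => ν.map J.restrict) := fun J => rfl
  -- Both measures are determined by their marginals on initial segments, where singletons are
  -- cylinder events.
  refine IsProjectiveLimit.unique (P := fun J : Finset ℕ => ν.map J.restrict) ?_ hproj
  refine (isProjectiveLimit_nat_iff
    (isProjectiveMeasureFamily_map_restrict (X := fun t (ω : ℕ → Γ) => ω t)
      (fun t => (measurable_pi_apply t).aemeasurable)) _).2 fun n => ?_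
  change μ.map _ = ν.map (Preorder.frestrictLe n)
  refine Measure.ext_of_singleton fun a => ?_
  obtain ⟨s, hs⟩ : ∃ s : ℕ → Γ, ∀ i : Finset.Iic n, a i = s i :=
    ⟨fun i => if h : i ≤ n then a ⟨i, mem_Iic.2 h⟩ else a ⟨0, mem_Iic.2 (Nat.zero_le n)⟩,
      fun i => by simp [mem_Iic.1 i.2]⟩
  have e1 : (Preorder.frestrictLe (π := fun _ => Γ) n) ⁻¹' {a} = {ω | ∀ i ≤ n, ω i = s i} := by
    ext ω
    simp [funext_iff, hs]
  rw [Measure.map_apply (by fun_prop) (measurableSet_singleton _),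
    Measure.map_apply (by fun_prop) (measurableSet_singleton _), e1, hμ,
    Measure.map_apply hm (e1 ▸ measurableSet_preimage (by fun_prop) (measurableSet_singleton _))]
  -- The path s with x put in front; prescribing X_0 = x changes the event only on a null set.
  let s' : ℕ → Γ := fun i => if i = 0 then x else s (i - 1)
  have e2 : C.law x ((fun ω t => ω (t + 1)) ⁻¹' {ω | ∀ i ≤ n, ω i = s i}) =
      C.law x {ω | ∀ i ≤ n + 1, ω i = s' i} := by
    refine measure_congr ?_
    filter_upwards [C.ae_start x] with ω hω
    apply propext
    change (∀ i ≤ n, ω (i + 1) = s i) ↔ ∀ i ≤ n + 1, ω i = s' i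
    constructor
    · rintro h (_ | i) hi
      · simpa [s'] using hω
      · simpa [s'] using h i (by omega)
    · intro h i hi
      simpa [s'] using h (i + 1) (by omega)
  rw [e2, law_cylinder, hν]
  simp only [Measure.coe_finsetSum, Finset.sum_apply, Measure.smul_apply, smul_eq_mul,
    law_cylinder]
  rw [Finset.sum_eq_single (s 0)]
  · rw [prod_range_succ']
    simp [s', mul_comm]
  · intro y _ hy
    simp [hy.symm]
  · simp

/-- The Markov property at time one, for probabilities of events that depend on `X_1, X_2, …`. -/
lemma prob_shift (C : ReversibleChain Γ) (x : Γ) {E : Set (ℕ → Γ)} (hE : MeasurableSet E) :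
    C.prob x {ω | (fun t => ω (t + 1)) ∈ E} = ∑ y, C.P x y * C.prob y E := by
  have hm : Measurable (fun (ω : ℕ → Γ) (t : ℕ) => ω (t + 1)) := by fun_prop
  have h := congrArg (fun μ => μ E) (C.map_shift_law x)
  beta_reduce at h
  rw [Measure.map_apply hm hE] at h
  change (C.law x ((fun ω t => ω (t + 1)) ⁻¹' E)).toReal = _
  rw [h]
  simp only [Measure.coe_finsetSum, Finset.sum_apply, Measure.smul_apply, smul_eq_mul]
  rw [ENNReal.toReal_sum fun y _ => ENNReal.mul_ne_top ENNReal.ofReal_ne_top (measure_ne_top _ _)]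
  refine Finset.sum_congr rfl fun y _ => ?_
  rw [ENNReal.toReal_mul, ENNReal.toReal_ofReal (C.irreducible.nonneg x y)]
  rfl

lemma prob_congr_start (C : ReversibleChain Γ) (x : Γ) {E F : Set (ℕ → Γ)}
    (h : ∀ ω, ω 0 = x → (ω ∈ E ↔ ω ∈ F)) : C.prob x E = C.prob x F := by
  unfold prob
  refine measureReal_congr ?_
  filter_upwards [C.ae_start x] with ω hω
  exact propext (h ω hω)

lemma prob_univ (C : ReversibleChain Γ) (x : Γ) : C.prob x Set.univ = 1 := by
  simp [prob]

lemma prob_empty (C : ReversibleChain Γ) (x : Γ) : C.prob x ∅ = 0 := by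
  simp [prob]

lemma prob_compl (C : ReversibleChain Γ) (x : Γ) {E : Set (ℕ → Γ)} (hE : MeasurableSet E) :
    C.prob x Eᶜ = 1 - C.prob x E := by
  simp [prob, measureReal_compl hE]

end ReversibleChain

lemma coe_lt_hit_iff (I : Finset Γ) (ω : ℕ → Γ) (t : ℕ) :
    (t : WithTop ℕ) < hit I ω ↔ ∀ s, 1 ≤ s → s ≤ t → ω s ∉ I := by
  constructor
  · intro h s hs hst hsI
    have := hittingAfter_le_of_mem (u := fun t (ω : ℕ → Γ) => ω t) (s := (I : Set Γ)) hs hsI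
    exact absurd (lt_of_lt_of_le h this) (not_lt.2 (WithTop.coe_le_coe.2 hst))
  · intro h
    by_contra hlt
    rw [not_lt] at hlt
    obtain ⟨s, hs, hsI⟩ := (hittingAfter_le_iff (u := fun t (ω : ℕ → Γ) => ω t)).1 hlt
    exact h s hs.1 hs.2 hsI

lemma hit_le_hit_iff (A B : Finset Γ) (ω : ℕ → Γ) :
    hit A ω ≤ hit B ω ↔ ∀ t, ω (t + 1) ∈ B → ∃ s ≤ t, ω (s + 1) ∈ A := by
  constructor
  · intro h t ht
    by_contra! hA
    have h1 : ((t + 1 : ℕ) : WithTop ℕ) < hit A ω := (coe_lt_hit_iff A ω (t + 1)).2 (by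
      rintro (_ | s) hs hst
      · omega
      · exact hA s (by omega))
    have h2 := (coe_lt_hit_iff B ω (t + 1)).1 (h1.trans_le h) (t + 1) (by omega) le_rfl
    exact h2 ht
  · intro h
    by_contra hlt
    rw [not_le] at hlt
    obtain ⟨t, ht⟩ := WithTop.ne_top_iff_exists.1 hlt.ne_top
    have h1 : ∀ s, 1 ≤ s → s ≤ t → ω s ∉ A := (coe_lt_hit_iff A ω t).1 (ht.trans_lt hlt)
    have h2 : ¬ (t : WithTop ℕ) < hit B ω := by rw [← ht]; exact lt_irrefl _
    rw [coe_lt_hit_iff] at h2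
    push Not at h2
    obtain ⟨s, hs, hst, hsB⟩ := h2
    obtain ⟨r, hr, hrA⟩ := h (s - 1) (by rwa [Nat.sub_add_cancel hs])
    exact h1 (r + 1) (by omega) (by omega) hrA

/-- The event that `A` is entered, at a time `≥ 0`, no later than `B`. -/
def entersFirst (A B : Finset Γ) : Set (ℕ → Γ) := {ω | ∀ t, ω t ∈ B → ∃ s ≤ t, ω s ∈ A}

lemma measurableSet_entersFirst (A B : Finset Γ) : MeasurableSet (entersFirst A B) := by
  have h : ∀ (t : ℕ) (D : Finset Γ), MeasurableSet {ω : ℕ → Γ | ω t ∈ D} := fun t D =>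
    measurableSet_preimage (measurable_pi_apply t) (MeasurableSet.of_discrete (s := (D : Set Γ)))
  have : entersFirst A B = ⋂ t, ({ω : ℕ → Γ | ω t ∈ B}ᶜ ∪ ⋃ s ≤ t, {ω : ℕ → Γ | ω s ∈ A}) := by
    ext ω
    simp [entersFirst, imp_iff_not_or]
  rw [this]
  exact MeasurableSet.iInter fun t => (h t B).compl.union
    (MeasurableSet.iUnion fun s => MeasurableSet.iUnion fun _ => h s A)

lemma setOf_hit_le (A B : Finset Γ) :
    {ω : ℕ → Γ | hit A ω ≤ hit B ω} = {ω | (fun t => ω (t + 1)) ∈ entersFirst A B} := by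
  ext ω
  exact hit_le_hit_iff A B ω

lemma measurableSet_hit_le (A B : Finset Γ) : MeasurableSet {ω : ℕ → Γ | hit A ω ≤ hit B ω} := by
  rw [setOf_hit_le]
  exact measurableSet_preimage (by fun_prop) (measurableSet_entersFirst A B)

namespace ReversibleChain

/-- Times start at 0 here but at 1 in `hit`, which only matters for the boundary values. On A ∩ B
the set A has precedence, in accordance with ≤. -/
lemma prob_entersFirst (C : ReversibleChain Γ) (A B : Finset Γ) (y : Γ) :
    C.prob y (entersFirst A B) =
      if y ∈ A then 1 else if y ∈ B then 0 else C.prob y {ω | hit A ω ≤ hit B ω} := by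
  split_ifs with hA hB
  · rw [← C.prob_univ y]
    refine C.prob_congr_start y fun ω hω => ⟨fun _ => trivial, fun _ t _ => ⟨0, t.zero_le, ?_⟩⟩
    rwa [hω]
  · rw [← C.prob_empty y]
    refine C.prob_congr_start y fun ω hω => ⟨fun h => ?_, fun h => h.elim⟩
    obtain ⟨s, hs, hsA⟩ := h 0 (by rwa [hω])
    rw [Nat.le_zero.1 hs, hω] at hsA
    exact hA hsA
  · refine C.prob_congr_start y fun ω hω => ?_
    change _ ↔ hit A ω ≤ hit B ω
    rw [hit_le_hit_iff]
    constructor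
    · intro h t ht
      obtain ⟨s, hs, hsA⟩ := h (t + 1) ht
      rcases s with _ | s
      · rw [hω] at hsA; exact absurd hsA hA
      · exact ⟨s, by omega, hsA⟩
    · rintro h (_ | t) ht
      · rw [hω] at ht; exact absurd ht hB
      · obtain ⟨s, hs, hsA⟩ := h t ht
        exact ⟨s + 1, by omega, hsA⟩

/-- First-step analysis of the event `τ_A ≤ τ_B`. -/
lemma prob_hit_le (C : ReversibleChain Γ) (A B : Finset Γ) (x : Γ) :
    C.prob x {ω | hit A ω ≤ hit B ω} = ∑ y, C.P x y *
      if y ∈ A then 1 else if y ∈ B then 0 else C.prob y {ω | hit A ω ≤ hit B ω} := by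
  rw [setOf_hit_le, C.prob_shift x (measurableSet_entersFirst A B), ← setOf_hit_le]
  simp only [prob_entersFirst]

lemma prob_hit_lt (C : ReversibleChain Γ) (A B : Finset Γ) (x : Γ) :
    C.prob x {ω | hit A ω < hit B ω} = 1 - C.prob x {ω | hit B ω ≤ hit A ω} := by
  rw [← C.prob_compl x (measurableSet_hit_le B A)]
  congr 1
  ext ω
  simp

lemma prob_hit_eq (C : ReversibleChain Γ) {M : Finset Γ} {y : Γ} (hy : y ∈ M) (x : Γ) :
    C.prob x {ω | hit {y} ω = hit M ω} = C.prob x {ω | hit {y} ω ≤ hit M ω} := by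
  congr 1
  ext ω
  have : hit M ω ≤ hit {y} ω :=
    (hit_le_hit_iff _ _ _).2 fun t ht => ⟨t, le_rfl, by rwa [Finset.mem_singleton.1 ht]⟩
  exact ⟨fun h => le_of_eq h, fun h => le_antisymm h this⟩

lemma prob_hit_le_of_subset (C : ReversibleChain Γ) {A B : Finset Γ} (h : B ⊆ A) (x : Γ) :
    C.prob x {ω | hit A ω ≤ hit B ω} = 1 := by
  rw [← C.prob_univ x]
  congr 1
  ext ω
  exact ⟨fun _ => trivial, fun _ => (hit_le_hit_iff _ _ _).2 fun t ht => ⟨t, le_rfl, h ht⟩⟩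

lemma prob_zero_lt_hit (C : ReversibleChain Γ) (I : Finset Γ) (x : Γ) :
    C.prob x {ω | ((0 : ℕ) : WithTop ℕ) < hit I ω} = 1 := by
  rw [← C.prob_univ x]
  congr 1
  ext ω
  exact ⟨fun _ => trivial, fun _ => (coe_lt_hit_iff _ _ _).2 fun s hs h => by omega⟩

lemma prob_succ_lt_hit (C : ReversibleChain Γ) (I : Finset Γ) (x : Γ) (t : ℕ) :
    C.prob x {ω | ((t + 1 : ℕ) : WithTop ℕ) < hit I ω} =
      ∑ y, C.P x y * if y ∈ I then 0 else C.prob y {ω | (t : WithTop ℕ) < hit I ω} := by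
  have e : {ω : ℕ → Γ | ((t + 1 : ℕ) : WithTop ℕ) < hit I ω} =
      {ω | (fun t => ω (t + 1)) ∈ {ω : ℕ → Γ | ∀ s ≤ t, ω s ∉ I}} := by
    ext ω
    change _ < hit I ω ↔ ∀ s ≤ t, ω (s + 1) ∉ I
    rw [coe_lt_hit_iff]
    constructor
    · intro h s hs
      exact h (s + 1) (by omega) (by omega)
    · rintro h (_ | s) hs hst
      · omega
      · exact h s (by omega)
  have hm : MeasurableSet {ω : ℕ → Γ | ∀ s ≤ t, ω s ∉ I} := by
    have : {ω : ℕ → Γ | ∀ s ≤ t, ω s ∉ I} = ⋂ s ≤ t, {ω : ℕ → Γ | ω s ∈ I}ᶜ := by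
      ext ω; simp
    rw [this]
    exact MeasurableSet.iInter fun s => MeasurableSet.iInter fun _ => (measurableSet_preimage
      (measurable_pi_apply s) (MeasurableSet.of_discrete (s := (I : Set Γ)))).compl
  rw [e, C.prob_shift x hm]
  refine Finset.sum_congr rfl fun y _ => ?_
  congr 1
  split_ifs with hy
  · rw [← C.prob_empty y]
    refine C.prob_congr_start y fun ω hω => ⟨fun h => ?_, fun h => h.elim⟩
    exact h 0 t.zero_le (by rwa [hω])
  · refine C.prob_congr_start y fun ω hω => ?_
    change (∀ s ≤ t, ω s ∉ I) ↔ _ < hit I ω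
    rw [coe_lt_hit_iff]
    constructor
    · exact fun h s _ hs => h s hs
    · rintro h (_ | s) hs
      · rwa [hω]
      · exact h (s + 1) (by omega) hs

end ReversibleChain
end Trajectories

/-! ### Discrete potential theory of a reversible chain: Green functions, harmonic measure, escape
probabilities. -/

section PotentialTheory

variable {Γ : Type*} [Fintype Γ] [DecidableEq Γ]

namespace ReversibleChain

variable (C : ReversibleChain Γ)

lemma P_nonneg (x y : Γ) : 0 ≤ C.P x y := C.irreducible.nonneg x y

/-- A property that is inherited along transitions and holds somewhere holds everywhere. -/
lemma forall_of_closed {W : Γ → Prop} {x : Γ} (hx : W x)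
    (h : ∀ y z, W y → 0 < C.P y z → W z) (y : Γ) : W y := by
  let : Quiver Γ := C.P.toQuiver
  obtain ⟨p, -⟩ := C.irreducible.connected x y
  induction p with
  | nil => exact hx
  | cons q e ih => exact h _ _ ih e.down

/-- Reversibility carries positive mass along transitions, and irreducibility then carries it
everywhere. -/
lemma Q_pos (x : Γ) : 0 < C.Q x := by
  obtain ⟨y, hy⟩ : ∃ y, 0 < C.Q y := by
    by_contra! h
    have := C.Q_sum
    rw [Finset.sum_eq_zero fun y _ => le_antisymm (h y) (C.Q_nonneg y)] at this
    exact zero_ne_one this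
  refine C.forall_of_closed (W := fun x => 0 < C.Q x) hy (fun u v hu huv => ?_) x
  refine (C.Q_nonneg v).lt_of_ne fun h0 => ?_
  have := C.reversible u v
  rw [← h0, zero_mul] at this
  exact (mul_pos hu huv).ne' this

/-- The transition operator acting on functions. -/
def step (f : Γ → ℝ) (x : Γ) : ℝ := ∑ y, C.P x y * f y

lemma step_sub (f g : Γ → ℝ) (x : Γ) : C.step (fun y => f y - g y) x = C.step f x - C.step g x := by
  simp [step, mul_sub, sum_sub_distrib]

lemma step_mul_left (a : ℝ) (f : Γ → ℝ) (x : Γ) : C.step (fun y => a * f y) x = a * C.step f x := by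
  simp only [step, mul_sum]
  exact sum_congr rfl fun y _ => by ring

lemma step_const (a : ℝ) (x : Γ) : C.step (fun _ => a) x = a := by
  simp [step, ← sum_mul, C.row_sum]

lemma step_mono {f g : Γ → ℝ} (h : ∀ y, f y ≤ g y) (x : Γ) : C.step f x ≤ C.step g x :=
  sum_le_sum fun y _ => mul_le_mul_of_nonneg_left (h y) (C.P_nonneg x y)

lemma step_nonneg {f : Γ → ℝ} (h : ∀ y, 0 ≤ f y) (x : Γ) : 0 ≤ C.step f x :=
  sum_nonneg fun y _ => mul_nonneg (C.P_nonneg x y) (h y)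

lemma step_sum {ι : Type*} (s : Finset ι) (f : ι → Γ → ℝ) (x : Γ) :
    C.step (fun y => ∑ i ∈ s, f i y) x = ∑ i ∈ s, C.step (f i) x := by
  simp only [step, mul_sum]
  exact sum_comm

/-- Self-adjointness of the transition operator. -/
lemma sum_mul_step (f g : Γ → ℝ) :
    ∑ x, C.Q x * f x * C.step g x = ∑ x, C.Q x * g x * C.step f x := by
  simp only [step, mul_sum]
  rw [sum_comm]
  refine sum_congr rfl fun y _ => sum_congr rfl fun x _ => ?_
  linear_combination (f x * g y) * C.reversible x y

lemma sum_mul_sub_step (f g : Γ → ℝ) :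
    ∑ x, C.Q x * f x * (g x - C.step g x) = ∑ x, C.Q x * g x * (f x - C.step f x) := by
  simp only [mul_sub, sum_sub_distrib, C.sum_mul_step f g]
  congr 1
  exact sum_congr rfl fun x _ => by ring

/-- The maximum principle. -/
lemma nonpos_of_subharmonic {S : Finset Γ} (hS : S.Nonempty) {f : Γ → ℝ}
    (h0 : ∀ x ∈ S, f x ≤ 0) (h1 : ∀ x ∉ S, f x ≤ C.step f x) (x : Γ) : f x ≤ 0 := by
  obtain ⟨s, hs⟩ := hS
  obtain ⟨m, -, hm⟩ := exists_max_image univ f ⟨s, mem_univ s⟩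
  refine (hm x (mem_univ x)).trans ?_
  by_contra! hpos
  -- A positive maximum is attained off S, where subharmonicity passes it on to all successors; by
  -- irreducibility it reaches S, where f ≤ 0.
  have key : ∀ y, f y = f m := by
    refine C.forall_of_closed (W := fun y => f y = f m) (x := m) rfl fun y z hy hyz => ?_
    have hyS : y ∉ S := fun h => absurd (h0 y h) (by rw [hy]; exact not_le.2 hpos)
    have h2 : ∑ w, C.P y w * (f m - f w) ≤ 0 := by
      simp only [mul_sub, sum_sub_distrib, ← sum_mul, C.row_sum, one_mul]
      have := h1 y hyS
      rw [hy] at this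
      simpa [step] using this
    have h3 : ∀ w ∈ univ, 0 ≤ C.P y w * (f m - f w) := fun w _ =>
      mul_nonneg (C.P_nonneg y w) (sub_nonneg.2 (hm w (mem_univ w)))
    have h4 := (sum_eq_zero_iff_of_nonneg h3).1 (le_antisymm h2 (sum_nonneg h3)) z (mem_univ z)
    rcases mul_eq_zero.1 h4 with h | h
    · exact absurd h hyz.ne'
    · linarith
  have := h0 s hs
  rw [key s] at this
  linarith

/-- The comparison principle. -/
lemma le_of_sub_step_le {S : Finset Γ} (hS : S.Nonempty) {f g : Γ → ℝ}
    (h0 : ∀ x ∈ S, f x ≤ g x) (h1 : ∀ x ∉ S, f x - C.step f x ≤ g x - C.step g x) (x : Γ) :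
    f x ≤ g x := by
  have := C.nonpos_of_subharmonic hS (f := fun y => f y - g y) (fun y hy => by
    simpa using h0 y hy) (fun y hy => by rw [step_sub]; linarith [h1 y hy]) x
  linarith

lemma eq_of_sub_step_eq {S : Finset Γ} (hS : S.Nonempty) {f g : Γ → ℝ}
    (h0 : ∀ x ∈ S, f x = g x) (h1 : ∀ x ∉ S, f x - C.step f x = g x - C.step g x) (x : Γ) :
    f x = g x :=
  le_antisymm (C.le_of_sub_step_le hS (fun y hy => (h0 y hy).le) (fun y hy => (h1 y hy).le) x)
    (C.le_of_sub_step_le hS (fun y hy => (h0 y hy).ge) (fun y hy => (h1 y hy).ge) x)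

/-- The matrix of the Dirichlet problem `f = g` on `S`, `f - P f = g` off `S`. -/
def dirichletProblem (S : Finset Γ) : Matrix Γ Γ ℝ :=
  Matrix.of fun x y => if x ∈ S then (1 : Matrix Γ Γ ℝ) x y else (1 - C.P) x y

/-- The solution operator of the Dirichlet problem for `S`. The column of `y ∉ S` is the Green
function of the chain killed in `S`, that of `y ∈ S` is the probability of entering `S` in `y`. -/
def pot (S : Finset Γ) : Matrix Γ Γ ℝ := (C.dirichletProblem S)⁻¹

lemma dirichletProblem_mulVec (S : Finset Γ) (f : Γ → ℝ) (x : Γ) :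
    (C.dirichletProblem S).mulVec f x = if x ∈ S then f x else f x - C.step f x := by
  simp only [Matrix.mulVec, dotProduct, dirichletProblem, Matrix.of_apply]
  split_ifs with h
  · simp [Matrix.one_apply]
  · simp [Matrix.one_apply, sub_mul, sum_sub_distrib, step]

variable {S : Finset Γ}

/-- The comparison principle gives uniqueness, and for a square matrix injectivity is invertibility.
-/
lemma isUnit_dirichletProblem (hS : S.Nonempty) : IsUnit (C.dirichletProblem S) := by
  rw [← Matrix.mulVec_injective_iff_isUnit]
  intro f g hfg
  funext x
  have h := fun y => congrFun hfg y
  simp only [dirichletProblem_mulVec] at h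
  refine C.eq_of_sub_step_eq hS (fun y hy => ?_) (fun y hy => ?_) x
  · simpa [hy] using h y
  · simpa [hy] using h y

lemma dirichletProblem_mul_pot (hS : S.Nonempty) : C.dirichletProblem S * C.pot S = 1 :=
  Matrix.mul_nonsing_inv _ ((Matrix.isUnit_iff_isUnit_det _).1 (C.isUnit_dirichletProblem hS))

lemma pot_of_mem (hS : S.Nonempty) {x : Γ} (hx : x ∈ S) (y : Γ) :
    C.pot S x y = if x = y then 1 else 0 := by
  have h := congrFun (congrFun (C.dirichletProblem_mul_pot hS) x) y
  change (C.dirichletProblem S).mulVec (fun z => C.pot S z y) x = _ at h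
  rw [dirichletProblem_mulVec, if_pos hx] at h
  rw [h, Matrix.one_apply]

lemma pot_sub_step (hS : S.Nonempty) {x : Γ} (hx : x ∉ S) (y : Γ) :
    C.pot S x y - C.step (fun z => C.pot S z y) x = if x = y then 1 else 0 := by
  have h := congrFun (congrFun (C.dirichletProblem_mul_pot hS) x) y
  change (C.dirichletProblem S).mulVec (fun z => C.pot S z y) x = _ at h
  rw [dirichletProblem_mulVec, if_neg hx] at h
  rw [h, Matrix.one_apply]

lemma pot_mem_self (hS : S.Nonempty) {x : Γ} (hx : x ∈ S) : C.pot S x x = 1 := by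
  rw [C.pot_of_mem hS hx, if_pos rfl]

lemma pot_mem_ne (hS : S.Nonempty) {x y : Γ} (hx : x ∈ S) (hxy : x ≠ y) : C.pot S x y = 0 := by
  rw [C.pot_of_mem hS hx, if_neg hxy]

lemma pot_mem_notMem (hS : S.Nonempty) {x y : Γ} (hx : x ∈ S) (hy : y ∉ S) : C.pot S x y = 0 :=
  C.pot_mem_ne hS hx (by rintro rfl; exact hy hx)

lemma pot_harmonic (hS : S.Nonempty) {x y : Γ} (hx : x ∉ S) (hxy : x ≠ y) :
    C.pot S x y - C.step (fun z => C.pot S z y) x = 0 := by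
  rw [C.pot_sub_step hS hx, if_neg hxy]

lemma pot_self_sub_step (hS : S.Nonempty) {x : Γ} (hx : x ∉ S) :
    C.pot S x x - C.step (fun z => C.pot S z x) x = 1 := by
  rw [C.pot_sub_step hS hx, if_pos rfl]

lemma pot_nonneg (hS : S.Nonempty) (x y : Γ) : 0 ≤ C.pot S x y := by
  refine C.le_of_sub_step_le hS (f := fun _ => 0) (g := fun x => C.pot S x y)
    (fun z hz => ?_) (fun z hz => ?_) x
  · rw [C.pot_of_mem hS hz]; positivity
  · rw [C.pot_sub_step hS hz, C.step_const]; split_ifs <;> norm_num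

/-- Solution of the Dirichlet problem. -/
lemma eq_sum_pot (hS : S.Nonempty) (f : Γ → ℝ) (x : Γ) :
    f x = ∑ y, C.pot S x y * if y ∈ S then f y else f y - C.step f y := by
  have h : C.pot S * C.dirichletProblem S = 1 :=
    Matrix.nonsing_inv_mul _ ((Matrix.isUnit_iff_isUnit_det _).1 (C.isUnit_dirichletProblem hS))
  have h2 : (C.pot S).mulVec ((C.dirichletProblem S).mulVec f) x = f x := by
    rw [Matrix.mulVec_mulVec, h, Matrix.one_mulVec]
  rw [← h2]
  simp only [Matrix.mulVec, dotProduct]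
  refine sum_congr rfl fun y _ => ?_
  rw [← dirichletProblem_mulVec]
  rfl

lemma sum_split (S : Finset Γ) (f : Γ → ℝ) : ∑ x, f x = ∑ x ∈ S, f x + ∑ x ∈ Sᶜ, f x :=
  (sum_add_sum_compl S f).symm

lemma sum_pot_mem (hS : S.Nonempty) (x : Γ) : ∑ y ∈ S, C.pot S x y = 1 := by
  have h := C.eq_sum_pot hS (fun _ => 1) x
  rw [sum_split S] at h
  have h1 : ∑ y ∈ S, (C.pot S x y * if y ∈ S then (1 : ℝ) else 1 - C.step (fun _ => 1) y) =
      ∑ y ∈ S, C.pot S x y := sum_congr rfl fun y hy => by rw [if_pos hy, mul_one]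
  have h2 : ∑ y ∈ Sᶜ, (C.pot S x y * if y ∈ S then (1 : ℝ) else 1 - C.step (fun _ => 1) y) = 0 :=
    sum_eq_zero fun y hy => by rw [if_neg (mem_compl.1 hy), step_const, sub_self, mul_zero]
  linarith

lemma pot_mem_le_one (hS : S.Nonempty) (x : Γ) {y : Γ} (hy : y ∈ S) : C.pot S x y ≤ 1 := by
  rw [← C.sum_pot_mem hS x]
  exact single_le_sum (f := fun y => C.pot S x y) (fun z _ => C.pot_nonneg hS x z) hy

lemma one_le_pot_self (hS : S.Nonempty) (x : Γ) : 1 ≤ C.pot S x x := by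
  by_cases hx : x ∈ S
  · rw [C.pot_mem_self hS hx]
  · have := C.pot_self_sub_step hS hx
    have := C.step_nonneg (fun z => C.pot_nonneg hS z x) x
    linarith

lemma pot_self_pos (hS : S.Nonempty) (x : Γ) : 0 < C.pot S x x :=
  zero_lt_one.trans_le (C.one_le_pot_self hS x)

/-- Symmetry of the Green function. -/
lemma Q_mul_pot (hS : S.Nonempty) {x y : Γ} (hx : x ∉ S) (hy : y ∉ S) :
    C.Q x * C.pot S x y = C.Q y * C.pot S y x := by
  have key : ∀ u v, v ∉ S → u ∉ S →
      ∑ z, C.Q z * C.pot S z u * (C.pot S z v - C.step (fun w => C.pot S w v) z) =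
        C.Q v * C.pot S v u := by
    intro u v hv hu
    rw [Finset.sum_eq_single v]
    · rw [C.pot_self_sub_step hS hv, mul_one]
    · intro z _ hz
      by_cases hzS : z ∈ S
      · rw [C.pot_mem_notMem hS hzS hu]; ring
      · rw [C.pot_harmonic hS hzS hz]; ring
    · simp
  rw [← key y x hx hy, ← key x y hy hx]
  exact C.sum_mul_sub_step _ _

/-- Duality between harmonic measure and the Green function. -/
lemma Q_mul_pot_mem (hS : S.Nonempty) {x z : Γ} (hx : x ∈ S) (hz : z ∉ S) :
    C.Q z * C.pot S z x = C.Q x * C.step (fun w => C.pot S w z) x := by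
  have h1 : ∑ w, C.Q w * C.pot S w x * (C.pot S w z - C.step (fun v => C.pot S v z) w) =
      C.Q z * C.pot S z x - C.Q x * C.step (fun w => C.pot S w z) x := by
    have hzx : z ≠ x := by rintro rfl; exact hz hx
    rw [Finset.sum_eq_add z x hzx]
    · rw [C.pot_self_sub_step hS hz, C.pot_mem_self hS hx, C.pot_mem_notMem hS hx hz]
      ring
    · intro w _ hw
      by_cases hwS : w ∈ S
      · rw [C.pot_mem_ne hS hwS hw.2]; ring
      · rw [C.pot_harmonic hS hwS hw.1]; ring
    · simp
    · simp
  have h2 : ∑ w, C.Q w * C.pot S w z * (C.pot S w x - C.step (fun v => C.pot S v x) w) = 0 := by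
    refine sum_eq_zero fun w _ => ?_
    by_cases hwS : w ∈ S
    · rw [C.pot_mem_notMem hS hwS hz]; ring
    · rw [C.pot_harmonic hS hwS (by rintro rfl; exact hwS hx)]; ring
  rw [C.sum_mul_sub_step, h2] at h1
  linarith

/-- Divided by `C.pot S z z`, the left side describes reaching x by way of z: `C.pot S y z / C.pot S
z z` is the probability of visiting z before S. The proof compares both sides as functions of y off
S ∪ {z}. -/
lemma pot_mul_le (hS : S.Nonempty) {z : Γ} (hz : z ∉ S) (y x : Γ) :
    C.pot S y z * C.pot S z x ≤ C.pot S z z * C.pot S y x := by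
  refine C.le_of_sub_step_le (insert_nonempty z S) (f := fun y => C.pot S y z * C.pot S z x)
    (g := fun y => C.pot S z z * C.pot S y x) (fun w hw => ?_) (fun w hw => ?_) y
  · rcases mem_insert.1 hw with rfl | hw
    · exact le_rfl
    · rw [C.pot_mem_notMem hS hw hz, zero_mul]
      exact mul_nonneg (C.pot_nonneg hS _ _) (C.pot_nonneg hS _ _)
  · rw [mem_insert, not_or] at hw
    have h1 := C.pot_harmonic hS hw.2 hw.1
    have h2 : 0 ≤ C.pot S w x - C.step (fun v => C.pot S v x) w := by
      rw [C.pot_sub_step hS hw.2]; positivity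
    have e : ∀ v, C.pot S v z * C.pot S z x = C.pot S z x * C.pot S v z := fun v => mul_comm _ _
    simp only [e, step_mul_left]
    rw [← mul_sub, ← mul_sub, h1, mul_zero]
    exact mul_nonneg (C.pot_nonneg hS _ _) h2

/-- Sum `pot_mul_le` over x ∈ S, where harmonic measure has total mass one. -/
lemma pot_le_self (hS : S.Nonempty) {z : Γ} (hz : z ∉ S) (y : Γ) :
    C.pot S y z ≤ C.pot S z z := by
  have h := sum_le_sum fun x (_ : x ∈ S) => C.pot_mul_le hS hz y x
  rwa [← mul_sum, ← mul_sum, C.sum_pot_mem hS, C.sum_pot_mem hS, mul_one, mul_one] at h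

variable {S' : Finset Γ}

lemma pot_anti (hS : S.Nonempty) (h : S ⊆ S') {z : Γ} (hz : z ∉ S' \ S) (y : Γ) :
    C.pot S' y z ≤ C.pot S y z := by
  have hS' := hS.mono h
  refine C.le_of_sub_step_le hS' (f := fun y => C.pot S' y z) (g := fun y => C.pot S y z)
    (fun w hw => ?_) (fun w hw => ?_) y
  · rw [C.pot_of_mem hS' hw]
    split_ifs with hwz
    · subst hwz
      exact C.one_le_pot_self hS w
    · exact C.pot_nonneg hS w z
  · rw [C.pot_sub_step hS' hw, C.pot_sub_step hS fun h' => hw (h h')]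

/-- The quotient `C.pot S y z / C.pot S z z` is the probability of reaching z before S, which
decreases when S grows. -/
lemma pot_ratio_anti (hS : S.Nonempty) (h : S ⊆ S') {z : Γ} (hz : z ∉ S') (y : Γ) :
    C.pot S' y z * C.pot S z z ≤ C.pot S y z * C.pot S' z z := by
  have hS' := hS.mono h
  have hzS : z ∉ S := fun h' => hz (h h')
  refine C.le_of_sub_step_le (insert_nonempty z S') (f := fun y => C.pot S' y z * C.pot S z z)
    (g := fun y => C.pot S y z * C.pot S' z z) (fun w hw => ?_) (fun w hw => ?_) y
  · rcases mem_insert.1 hw with rfl | hw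
    · exact (mul_comm _ _).le
    · rw [C.pot_mem_notMem hS' hw hz, zero_mul]
      exact mul_nonneg (C.pot_nonneg hS _ _) (C.pot_nonneg hS' _ _)
  · rw [mem_insert, not_or] at hw
    have h1 := C.pot_harmonic hS' hw.2 hw.1
    have h2 := C.pot_harmonic hS (fun h' => hw.2 (h h')) hw.1
    simp only [mul_comm _ (C.pot S z z), mul_comm _ (C.pot S' z z), step_mul_left]
    rw [← mul_sub, ← mul_sub, h1, h2, mul_zero, mul_zero]

/-- The probability of `X_{τ_S} = x`, where `τ_S` is the first time `t > 0` at which the chain is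
in `S`. -/
def hitProb (S : Finset Γ) (y x : Γ) : ℝ := C.step (fun z => C.pot S z x) y

lemma hitProb_nonneg (hS : S.Nonempty) (y x : Γ) : 0 ≤ C.hitProb S y x :=
  C.step_nonneg (fun z => C.pot_nonneg hS z x) y

lemma sum_hitProb (hS : S.Nonempty) (y : Γ) : ∑ x ∈ S, C.hitProb S y x = 1 := by
  simp only [hitProb]
  rw [← C.step_sum S (fun x z => C.pot S z x)]
  simp only [C.sum_pot_mem hS, step_const]

lemma hitProb_of_notMem (hS : S.Nonempty) {y x : Γ} (hy : y ∉ S) (hx : x ∈ S) :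
    C.hitProb S y x = C.pot S y x := by
  have := C.pot_harmonic hS hy (by rintro rfl; exact hy hx : y ≠ x)
  unfold hitProb
  linarith

/-- The trace of the chain on S is again reversible: this is Green's second identity for the
harmonic measures of x and y. -/
lemma Q_mul_hitProb (hS : S.Nonempty) {x y : Γ} (hx : x ∈ S) (hy : y ∈ S) :
    C.Q x * C.hitProb S x y = C.Q y * C.hitProb S y x := by
  have key : ∀ u ∈ S, ∀ v ∈ S,
      ∑ z, C.Q z * C.pot S z u * (C.pot S z v - C.step (fun w => C.pot S w v) z) =
        C.Q u * (C.pot S u v - C.hitProb S u v) := by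
    intro u hu v hv
    rw [Finset.sum_eq_single u]
    · rw [C.pot_mem_self hS hu, mul_one]; rfl
    · intro z _ hz
      by_cases hzS : z ∈ S
      · rw [C.pot_mem_ne hS hzS hz]; ring
      · rw [C.pot_harmonic hS hzS (by rintro rfl; exact hzS hv)]; ring
    · simp
  have h := (key x hx y hy).symm.trans ((C.sum_mul_sub_step _ _).trans (key y hy x hx))
  rw [C.pot_of_mem hS hx, C.pot_of_mem hS hy] at h
  by_cases hxy : x = y
  · rw [hxy]
  · rw [if_neg hxy, if_neg (Ne.symm hxy)] at h
    linarith

/-- Strong Markov property at the first entrance into S: visits to x before S \ {x} occur only if S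
is entered at x. -/
lemma pot_erase (x : Γ) (hS : (S.erase x).Nonempty) (hx : x ∈ S) (y : Γ) :
    C.pot (S.erase x) y x = C.pot (S.erase x) x x * C.pot S y x := by
  have hS' : S.Nonempty := ⟨x, hx⟩
  refine C.eq_of_sub_step_eq hS' (f := fun y => C.pot (S.erase x) y x)
    (g := fun y => C.pot (S.erase x) x x * C.pot S y x) (fun z hz => ?_) (fun z hz => ?_) y
  · by_cases hzx : z = x
    · subst hzx; rw [C.pot_mem_self hS' hx, mul_one]
    · rw [C.pot_mem_ne hS (mem_erase.2 ⟨hzx, hz⟩) hzx, C.pot_mem_ne hS' hz hzx, mul_zero]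
  · have hzx : z ≠ x := by rintro rfl; exact hz hx
    simp only [step_mul_left]
    rw [C.pot_harmonic hS (fun h => hz (mem_of_mem_erase h)) hzx, ← mul_sub,
      C.pot_harmonic hS' hz hzx, mul_zero]

lemma pot_erase_mul (x : Γ) (hS : (S.erase x).Nonempty) (hx : x ∈ S) :
    C.pot (S.erase x) x x * (1 - C.hitProb S x x) = 1 := by
  have h := C.pot_self_sub_step hS (notMem_erase x S)
  rw [funext fun z => C.pot_erase x hS hx z, step_mul_left] at h
  rw [mul_sub, mul_one]
  exact h

lemma one_sub_hitProb (x : Γ) (hS : (S.erase x).Nonempty) (hx : x ∈ S) :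
    1 - C.hitProb S x x = (C.pot (S.erase x) x x)⁻¹ :=
  eq_inv_of_mul_eq_one_right (C.pot_erase_mul x hS hx)

/-- Killing in one further point is a Schur complement of the Green matrix. The right side is
symmetric in x and y, which later allows the roles of two metastable points to be exchanged. -/
lemma pot_insert_mul (hS : S.Nonempty) {x y : Γ} (hx : x ∉ S) (hy : y ∉ S) (hxy : x ≠ y) :
    C.pot (insert y S) x x * C.pot S y y =
      C.pot S x x * C.pot S y y - C.pot S x y * C.pot S y x := by
  suffices h : C.pot S y y * C.pot (insert y S) x x =
      C.pot S y y * C.pot S x x - C.pot S y x * C.pot S x y by linarith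
  refine C.eq_of_sub_step_eq (insert_nonempty y S)
    (f := fun w => C.pot S y y * C.pot (insert y S) w x)
    (g := fun w => C.pot S y y * C.pot S w x - C.pot S y x * C.pot S w y)
    (fun w hw => ?_) (fun w hw => ?_) x
  · have hxi : x ∉ insert y S := by simp [hx, hxy]
    rw [C.pot_mem_notMem (insert_nonempty y S) hw hxi]
    rcases mem_insert.1 hw with rfl | hw
    · ring
    · rw [C.pot_mem_notMem hS hw hx, C.pot_mem_notMem hS hw hy]; ring
  · have h1 := C.pot_sub_step (insert_nonempty y S) hw x
    rw [mem_insert, not_or] at hw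
    have h2 := C.pot_sub_step hS hw.2 x
    have h3 := C.pot_harmonic hS hw.2 hw.1
    rw [step_mul_left, step_sub, step_mul_left, step_mul_left]
    linear_combination C.pot S y y * (h1 - h2) + C.pot S y x * h3

/-- The trace of the Green operator of the chain killed in `S`. -/
def greenTrace (S : Finset Γ) : ℝ := ∑ z ∈ Sᶜ, C.pot S z z

lemma greenTrace_nonneg (hS : S.Nonempty) : 0 ≤ C.greenTrace S :=
  sum_nonneg fun z _ => C.pot_nonneg hS z z

/-- The trace bounds the expected time spent off S uniformly, even when weighted by a positive
harmonic measure. This makes the trace the natural time scale for reaching S. -/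
lemma sum_pot_mul_pot_le (hS : S.Nonempty) (y x : Γ) :
    ∑ z ∈ Sᶜ, C.pot S y z * C.pot S z x ≤ C.greenTrace S * C.pot S y x := by
  rw [greenTrace, sum_mul]
  exact sum_le_sum fun z hz => C.pot_mul_le hS (mem_compl.1 hz) y x

variable [MeasurableSpace Γ] [DiscreteMeasurableSpace Γ]

/-- The probability of `τ_A ≤ τ_B` through the solution of a Dirichlet problem. -/
lemma prob_hit_le_eq_step {A B : Finset Γ} (hAB : (A ∪ B).Nonempty) {w : Γ → ℝ}
    (hA : ∀ x ∈ A, w x = 1) (hB : ∀ x ∈ B, x ∉ A → w x = 0)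
    (hw : ∀ x ∉ A ∪ B, w x - C.step w x = 0) (x : Γ) :
    C.prob x {ω | hit A ω ≤ hit B ω} = C.step w x := by
  set e := fun y => C.prob y {ω | hit A ω ≤ hit B ω} with he
  set v : Γ → ℝ := fun y => if y ∈ A then 1 else if y ∈ B then 0 else e y with hv
  have h1 : ∀ y, e y = C.step v y := fun y => C.prob_hit_le A B y
  have h2 : ∀ y, v y = w y := by
    refine C.eq_of_sub_step_eq hAB (fun y hy => ?_) (fun y hy => ?_)
    · by_cases hyA : y ∈ A
      · simp [hv, hyA, hA]
      · have hyB : y ∈ B := (mem_union.1 hy).resolve_left hyA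
        simp [hv, hyA, hyB, hB y hyB hyA]
    · rw [hw y hy, ← h1]
      rw [mem_union, not_or] at hy
      simp [hv, hy.1, hy.2]
  change e x = _
  rw [h1, funext h2]

/-- The number of visits to x before S is geometric with success probability `P[τ_S ≤ τ_x]`, so its
mean is the inverse. From here on every time T is a diagonal Green function. -/
lemma T_eq_pot (hS : S.Nonempty) {x : Γ} (hx : x ∉ S) : T C x S = C.pot S x x := by
  have hp := C.pot_self_pos hS x
  rw [T, C.prob_hit_le_eq_step (w := fun y => 1 - (C.pot S x x)⁻¹ * C.pot S y x)
    (hS.mono subset_union_left)]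
  · have := C.pot_self_sub_step hS hx
    rw [step_sub, step_const, step_mul_left]
    have h2 : 1 - (C.pot S x x)⁻¹ * C.step (fun y => C.pot S y x) x = (C.pot S x x)⁻¹ := by
      field_simp
      linarith
    rw [h2, inv_inv]
  · intro y hy
    rw [C.pot_mem_notMem hS hy hx]; ring
  · intro y hy _
    rw [mem_singleton.1 hy, inv_mul_cancel₀ hp.ne', sub_self]
  · intro y hy
    rw [mem_union, mem_singleton, not_or] at hy
    rw [step_sub, step_const, step_mul_left]
    linear_combination -(C.pot S x x)⁻¹ * C.pot_harmonic hS hy.1 hy.2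

lemma prob_hit_lt_singleton {x y : Γ} (hxy : x ≠ y) :
    C.prob x {ω | hit {y} ω < hit {x} ω} = (C.pot {y} x x)⁻¹ := by
  have hS : ({y} : Finset Γ).Nonempty := singleton_nonempty y
  have hx : x ∉ ({y} : Finset Γ) := by simpa using hxy
  have hp := C.pot_self_pos hS x
  rw [prob_hit_lt, C.prob_hit_le_eq_step (w := fun z => (C.pot {y} x x)⁻¹ * C.pot {y} z x)
    (hS.mono subset_union_right)]
  · have := C.pot_self_sub_step hS hx
    rw [step_mul_left]
    field_simp
    linarith
  · intro z hz
    rw [mem_singleton.1 hz, inv_mul_cancel₀ hp.ne']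
  · intro z hz _
    rw [C.pot_mem_notMem hS hz hx, mul_zero]
  · intro z hz
    rw [mem_union, mem_singleton, not_or] at hz
    rw [step_mul_left]
    linear_combination (C.pot {y} x x)⁻¹ * C.pot_harmonic hS hz.2 hz.1

lemma prob_hit_eq_hitProb {M : Finset Γ} {y : Γ} (hy : y ∈ M) (z : Γ) :
    C.prob z {ω | hit {y} ω = hit M ω} = C.hitProb M z y := by
  have hM : M.Nonempty := ⟨y, hy⟩
  rw [C.prob_hit_eq hy, hitProb]
  refine C.prob_hit_le_eq_step (hM.mono subset_union_right) ?_ ?_ ?_ z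
  · intro x hx
    rw [mem_singleton.1 hx, C.pot_mem_self hM hy]
  · intro x hx hxy
    rw [mem_singleton] at hxy
    exact C.pot_mem_ne hM hx hxy
  · intro x hx
    rw [mem_union, mem_singleton, not_or] at hx
    exact C.pot_harmonic hM hx.2 hx.1

end ReversibleChain
end PotentialTheory

/-! ### Consequences of metastability for a single set M: masses of valleys and of attracted points.
-/

section Valleys

variable {Γ : Type*} [Fintype Γ] [DecidableEq Γ] [MeasurableSpace Γ] [DiscreteMeasurableSpace Γ]

namespace ReversibleChain

variable (C : ReversibleChain Γ) {S M : Finset Γ}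

lemma hitProb_anti (hS : S.Nonempty) (h : S ⊆ M) {x : Γ} (hx : x ∈ S) (y : Γ) :
    C.hitProb M y x ≤ C.hitProb S y x :=
  C.step_mono (fun z => C.pot_anti hS h (by simp [hx]) z) y

lemma sum_erase_hitProb (hS : S.Nonempty) {x : Γ} (hx : x ∈ S) (y : Γ) :
    ∑ z ∈ S.erase x, C.hitProb S y z = 1 - C.hitProb S y x := by
  rw [← C.sum_hitProb hS y, ← sum_erase_add S _ hx]; ring

lemma sum_erase_pot (hS : S.Nonempty) {x : Γ} (hx : x ∈ S) (y : Γ) :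
    ∑ z ∈ S.erase x, C.pot S y z = 1 - C.pot S y x := by
  rw [← C.sum_pot_mem hS y, ← sum_erase_add S _ hx]; ring

lemma hitProb_self_le_one (hS : S.Nonempty) {x : Γ} (hx : x ∈ S) (y : Γ) :
    C.hitProb S y x ≤ 1 := by
  have := C.sum_erase_hitProb hS hx y
  have := sum_nonneg fun z (_ : z ∈ S.erase x) => C.hitProb_nonneg hS y z
  linarith

/-- A chain that commutes between `x` and `y` through `z` makes `y` accessible from `x`. -/
lemma Q_mul_pot_mul_pot_le (hS : S.Nonempty) {x y z : Γ} (hz : z ∉ S) (hx : x ∈ S) :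
    C.Q z * C.pot S z x * C.pot S z y ≤ C.pot S z z * C.Q x * C.hitProb S x y := by
  rw [C.Q_mul_pot_mem hS hx hz]
  have h : C.step (fun w => C.pot S z y * C.pot S w z) x ≤
      C.step (fun w => C.pot S z z * C.pot S w y) x :=
    C.step_mono (fun w => by rw [mul_comm]; exact C.pot_mul_le hS hz w y) x
  rw [step_mul_left, step_mul_left] at h
  have := mul_le_mul_of_nonneg_left h (C.Q_nonneg x)
  unfold hitProb
  linarith

/-- The quotient `C.pot S z x / C.pot S z z` is the probability that z reaches S before returning to
z, and does so at x; it decreases in S. Duality (`Q_mul_pot_mem`) reduces this to `pot_ratio_anti`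
after one step from x. -/
lemma pot_mul_pot_self_le (hS : S.Nonempty) (h : S ⊆ M) {x z : Γ} (hz : z ∉ M) (hx : x ∈ S) :
    C.pot M z x * C.pot S z z ≤ C.pot S z x * C.pot M z z := by
  have h1 : C.step (fun w => C.pot S z z * C.pot M w z) x ≤
      C.step (fun w => C.pot M z z * C.pot S w z) x :=
    C.step_mono (fun w => by
      rw [mul_comm, mul_comm (C.pot M z z)]; exact C.pot_ratio_anti hS h hz w) x
  rw [step_mul_left, step_mul_left] at h1
  have h2 := C.Q_mul_pot_mem (hS.mono h) (h hx) hz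
  have h3 := C.Q_mul_pot_mem hS hx (fun h' => hz (h h') : z ∉ S)
  have h4 := mul_le_mul_of_nonneg_left h1 (C.Q_nonneg x)
  refine le_of_mul_le_mul_left ?_ (C.Q_pos z)
  linear_combination h4 + C.pot S z z * h2 - C.pot M z z * h3

/-- The trace of the Green operator of a smaller set `S ⊆ M`. -/
lemma greenTrace_le (hS : S.Nonempty) (h : S ⊆ M) {κ : ℝ} (hκ0 : 0 ≤ κ)
    (hκ : ∀ z ∉ M, C.pot M z z ≤ κ) :
    C.greenTrace S ≤ Fintype.card Γ * κ +
      ∑ x ∈ M \ S, C.pot S x x * ((∑ z, C.Q z * C.pot M z x) / C.Q x) := by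
  have hM := hS.mono h
  have key : ∀ z ∉ S, C.pot S z z ≤
      κ + ∑ x ∈ M \ S, C.pot S x x * (C.Q z * C.pot M z x / C.Q x) := by
    intro z hz
    -- Decompose at the first entrance into M: before it the Green function of M acts, after it that
    -- of S starting from some x ∈ M \ S. Symmetry bounds the latter by its diagonal value at x.
    rw [C.eq_sum_pot hM (fun y => C.pot S y z) z, sum_split M, add_comm]
    refine add_le_add ?_ ?_
    · by_cases hzM : z ∈ M
      · rw [sum_eq_zero]
        · exact hκ0
        · intro y hy
          rw [C.pot_mem_notMem hM hzM (mem_compl.1 hy), zero_mul]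
      · rw [Finset.sum_eq_single z]
        · rw [if_neg hzM, C.pot_self_sub_step hS hz, mul_one]
          exact hκ z hzM
        · intro y hy hyz
          rw [if_neg (mem_compl.1 hy), C.pot_harmonic hS (fun h' => mem_compl.1 hy (h h')) hyz,
            mul_zero]
        · intro h'; exact absurd (mem_compl.2 hzM) h'
    · rw [← sum_sdiff h, sum_eq_zero (s := S), add_zero]
      · refine sum_le_sum fun x hx => ?_
        rw [Finset.mem_sdiff] at hx
        rw [if_pos hx.1]
        have h1 := C.Q_mul_pot hS hx.2 hz
        have h2 := mul_le_mul_of_nonneg_left (C.pot_le_self hS hx.2 z) (C.Q_nonneg z)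
        have h3 : C.pot S x z ≤ C.pot S x x * C.Q z / C.Q x := by
          rw [le_div_iff₀ (C.Q_pos x)]; linarith
        calc C.pot M z x * C.pot S x z ≤ C.pot M z x * (C.pot S x x * C.Q z / C.Q x) :=
              mul_le_mul_of_nonneg_left h3 (C.pot_nonneg hM _ _)
          _ = _ := by ring
      · intro y hy
        rw [if_pos (h hy), C.pot_mem_notMem hS hy hz, mul_zero]
  calc C.greenTrace S ≤ ∑ z ∈ Sᶜ, (κ + ∑ x ∈ M \ S, C.pot S x x * (C.Q z * C.pot M z x / C.Q x)) :=
        sum_le_sum fun z hz => key z (mem_compl.1 hz)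
    _ ≤ ∑ z, (κ + ∑ x ∈ M \ S, C.pot S x x * (C.Q z * C.pot M z x / C.Q x)) :=
        sum_le_sum_of_subset_of_nonneg (subset_univ _) fun z _ _ => add_nonneg hκ0
          (sum_nonneg fun x _ => mul_nonneg (C.pot_nonneg hS _ _)
            (div_nonneg (mul_nonneg (C.Q_nonneg z) (C.pot_nonneg hM _ _)) (C.Q_nonneg x)))
    _ = _ := by
        rw [sum_add_distrib, sum_comm]
        simp only [← mul_sum, sum_div, sum_const, card_univ, nsmul_eq_mul]

end ReversibleChain

open ReversibleChain

lemma mem_valley {C : ReversibleChain Γ} {M : Finset Γ} {x : Γ} (hx : x ∈ M) (z : Γ) :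
    z ∈ valley C M x ↔ ∀ y ∈ M, C.hitProb M z y ≤ C.hitProb M z x := by
  simp only [valley, mem_filter, mem_univ, true_and]
  refine forall₂_congr fun y hy => ?_
  rw [C.prob_hit_eq_hitProb hy, C.prob_hit_eq_hitProb hx]

/-- The mass `Q(A(x))` of the local valley. -/
def valleyMass (C : ReversibleChain Γ) (M : Finset Γ) (x : Γ) : ℝ := ∑ z ∈ valley C M x, C.Q z

/-- The quantitative form of the assumptions on a metastable set. -/
structure IsWellSeparated (C : ReversibleChain Γ) (M : Finset Γ) (a b ε δ : ℝ) : Prop where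
  isMetastableSet : IsMetastableSet C M a b
  nonempty : M.Nonempty
  inv_le : a⁻¹ ≤ ε * b
  le_delta : rMax C M * ε * Fintype.card Γ * M.card ≤ δ
  delta_le : δ ≤ 1 / 8

namespace IsWellSeparated

variable {C : ReversibleChain Γ} {M : Finset Γ} {a b ε δ : ℝ}

section

variable (h : IsWellSeparated C M a b ε δ)
include h

lemma b_pos : 0 < b := h.isMetastableSet.b_pos

lemma a_pos : 0 < a := h.isMetastableSet.a_pos

lemma eps_pos : 0 < ε :=
  pos_of_mul_pos_left ((inv_pos.2 h.a_pos).trans_le h.inv_le) h.b_pos.le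

lemma card_pos : (0 : ℝ) < M.card := by exact_mod_cast h.nonempty.card_pos

lemma card_univ_pos : (0 : ℝ) < Fintype.card Γ := by
  have : Nonempty Γ := ⟨h.nonempty.choose⟩
  exact_mod_cast Fintype.card_pos

lemma b_le_one : b ≤ 1 := by
  obtain ⟨x, hx⟩ := h.nonempty
  have := h.isMetastableSet.reach x
  rwa [C.prob_hit_le_of_subset (by simpa using hx)] at this

lemma pot_self_le {z : Γ} (hz : z ∉ M) : C.pot M z z ≤ b⁻¹ := by
  have h1 := h.isMetastableSet.reach z
  have h2 := C.T_eq_pot h.nonempty hz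
  rw [T] at h2
  rw [← h2]
  exact inv_anti₀ h.b_pos h1

lemma hitProb_le {x y : Γ} (hx : x ∈ M) (hy : y ∈ M) (hxy : x ≠ y) :
    C.hitProb {x, y} x y ≤ a⁻¹ := by
  have h1 := h.isMetastableSet.escape x hx y hy hxy
  rw [C.prob_hit_lt_singleton hxy] at h1
  have he : ({x, y} : Finset Γ).erase x = {y} := by
    rw [erase_insert]; simpa using hxy
  have h2 := C.one_sub_hitProb x (S := {x, y}) (by rw [he]; exact singleton_nonempty y) (by simp)
  have h3 := C.sum_erase_hitProb (S := {x, y}) (x := x) ⟨x, by simp⟩ (by simp) x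
  rw [he, sum_singleton] at h3
  rw [he] at h2
  linarith

lemma hitProb_le' {x y : Γ} (hx : x ∈ M) (hy : y ∈ M) (hxy : x ≠ y) :
    C.hitProb M x y ≤ a⁻¹ :=
  (C.hitProb_anti ⟨x, by simp⟩ (by simp [insert_subset_iff, hx, hy]) (by simp) x).trans
    (h.hitProb_le hx hy hxy)

lemma one_sub_hitProb_le {x : Γ} (hx : x ∈ M) : 1 - C.hitProb M x x ≤ M.card * a⁻¹ := by
  rw [← C.sum_erase_hitProb h.nonempty hx x]
  calc ∑ z ∈ M.erase x, C.hitProb M x z ≤ ∑ z ∈ M.erase x, a⁻¹ :=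
        sum_le_sum fun z hz => h.hitProb_le' hx (mem_of_mem_erase hz) (ne_of_mem_erase hz).symm
    _ = (M.erase x).card * a⁻¹ := by simp
    _ ≤ _ := by
        refine mul_le_mul_of_nonneg_right ?_ (inv_pos.2 h.a_pos).le
        exact_mod_cast card_le_card (erase_subset x M)

lemma card_mul_inv_le : M.card * a⁻¹ ≤ M.card * ε * b := by
  rw [mul_assoc]
  exact mul_le_mul_of_nonneg_left h.inv_le h.card_pos.le

/-- Pass to the pair S = {x, y}. With u, v the probabilities of ending in x and y, the quantity to
bound is at most min(u, v) up to Green functions, and min(u, v) ≤ 2uv because u + v = 1. The product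
uv lets x communicate with y through z, which has probability at most 1/a. -/
lemma Q_mul_pot_le {x y z : Γ} (hz : z ∉ M) (hx : x ∈ M) (hy : y ∈ M) (hxy : x ≠ y)
    (hle : C.pot M z y ≤ C.pot M z x) : C.Q z * C.pot M z y ≤ 2 * b⁻¹ * C.Q x * a⁻¹ := by
  set S : Finset Γ := {x, y} with hS
  have hSn : S.Nonempty := ⟨x, by simp [hS]⟩
  have hSM : S ⊆ M := by simp [hS, insert_subset_iff, hx, hy]
  have hxS : x ∈ S := by simp [hS]
  have hyS : y ∈ S := by simp [hS]
  have hzS : z ∉ S := fun h' => hz (hSM h')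
  have hsum : C.pot S z x + C.pot S z y = 1 := by
    rw [← C.sum_pot_mem hSn z, hS, sum_pair hxy]
  have h1 := C.Q_mul_pot_mul_pot_le hSn (x := x) (y := y) hzS hxS
  have h2 := C.pot_mul_pot_self_le hSn hSM hz hxS
  have h3 := C.pot_mul_pot_self_le hSn hSM hz hyS
  have h4 := h.hitProb_le hx hy hxy
  have g0 := C.pot_self_pos hSn z
  have G0 := C.pot_self_pos h.nonempty z
  have hG := h.pot_self_le hz
  have u0 := C.pot_nonneg hSn z x
  have v0 := C.pot_nonneg hSn z y
  set u := C.pot S z x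
  set v := C.pot S z y
  set g := C.pot S z z
  set G := C.pot M z z
  set k := C.pot M z y
  have hk : k * g ≤ 2 * (u * v) * G := by
    rcases le_total u v with huv | huv
    · have : k * g ≤ u * G := (mul_le_mul_of_nonneg_right hle g0.le).trans h2
      have e : 2 * (u * v) * G - u * G = u * G * (v - u) := by linear_combination (u * G) * hsum
      have := mul_nonneg (mul_nonneg u0 G0.le) (sub_nonneg.2 huv)
      linarith
    · have e : 2 * (u * v) * G - v * G = v * G * (u - v) := by linear_combination (v * G) * hsum
      have := mul_nonneg (mul_nonneg v0 G0.le) (sub_nonneg.2 huv)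
      linarith
  have hQx := C.Q_pos x
  have hQz := C.Q_pos z
  have h5 : C.Q z * (k * g) ≤ 2 * G * (g * C.Q x * a⁻¹) := by
    calc C.Q z * (k * g) ≤ C.Q z * (2 * (u * v) * G) := mul_le_mul_of_nonneg_left hk hQz.le
      _ = 2 * G * (C.Q z * u * v) := by ring
      _ ≤ 2 * G * (g * C.Q x * C.hitProb S x y) := mul_le_mul_of_nonneg_left h1 (by positivity)
      _ ≤ _ := by gcongr
  have h6 : C.Q z * k ≤ 2 * G * C.Q x * a⁻¹ := by
    refine le_of_mul_le_mul_right ?_ g0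
    linarith
  refine h6.trans ?_
  have := h.a_pos
  gcongr

/-- A point of M in the valley reaches x with probability at least 1/|M|, and reversibility of the
trace on M makes its mass negligible. A point off M with probability of x below 1/2 leaves half of
its mass to the competitors, each of which receives little by `Q_mul_pot_le`. -/
lemma Q_le_of_mem_valley {x z : Γ} (hx : x ∈ M) (hz : z ∈ valley C M x) :
    z = x ∨ C.Q z ≤ 4 * (M.card * ε) * C.Q x ∨ (z ∉ M ∧ 1 / 2 ≤ C.pot M z x) := by
  rw [mem_valley hx] at hz
  have hM := h.nonempty
  have hm := h.card_pos
  have hb := h.b_pos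
  have hε := h.eps_pos
  have hQ := C.Q_pos x
  by_cases hzx : z = x
  · exact Or.inl hzx
  refine Or.inr ?_
  by_cases hzM : z ∈ M
  · left
    have h1 : 1 ≤ M.card * C.hitProb M z x := by
      rw [← C.sum_hitProb hM z, ← nsmul_eq_mul]
      exact sum_le_card_nsmul _ _ _ hz
    have h2 := C.Q_mul_hitProb hM hzM hx
    have h3 := h.hitProb_le' hx hzM (Ne.symm hzx)
    have h4 := h.card_mul_inv_le
    calc C.Q z ≤ C.Q z * (M.card * C.hitProb M z x) := le_mul_of_one_le_right (C.Q_nonneg z) h1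
      _ = C.Q x * (M.card * C.hitProb M x z) := by linear_combination (M.card : ℝ) * h2
      _ ≤ C.Q x * (M.card * a⁻¹) := by gcongr
      _ ≤ C.Q x * (M.card * ε * b) := by gcongr
      _ ≤ C.Q x * (4 * (M.card * ε)) := by
          have := h.b_le_one
          have : M.card * ε * b ≤ M.card * ε := mul_le_of_le_one_right (by positivity) this
          have : 0 ≤ M.card * ε := by positivity
          exact mul_le_mul_of_nonneg_left (by linarith) hQ.le
      _ = _ := by ring
  · by_cases hK : 1 / 2 ≤ C.pot M z x
    · exact Or.inr ⟨hzM, hK⟩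
    left
    have h1 : ∑ y ∈ M.erase x, C.Q z * C.pot M z y ≤ ∑ y ∈ M.erase x, 2 * b⁻¹ * C.Q x * a⁻¹ := by
      refine sum_le_sum fun y hy => ?_
      have hyM := mem_of_mem_erase hy
      refine h.Q_mul_pot_le hzM hx hyM (ne_of_mem_erase hy).symm ?_
      have := hz y hyM
      rwa [C.hitProb_of_notMem hM hzM hyM, C.hitProb_of_notMem hM hzM hx] at this
    rw [← mul_sum, C.sum_erase_pot hM hx, sum_const, nsmul_eq_mul] at h1
    have h2 : ((M.erase x).card : ℝ) ≤ M.card := by exact_mod_cast card_le_card (erase_subset x M)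
    have h3 : C.Q z * (1 / 2) ≤ C.Q z * (1 - C.pot M z x) :=
      mul_le_mul_of_nonneg_left (by linarith) (C.Q_nonneg z)
    have h4 : ((M.erase x).card : ℝ) * (2 * b⁻¹ * C.Q x * a⁻¹) ≤
        M.card * (2 * b⁻¹ * C.Q x * a⁻¹) :=
      mul_le_mul_of_nonneg_right h2 (by have := h.a_pos; positivity)
    have h5 : M.card * (2 * b⁻¹ * C.Q x * a⁻¹) ≤ 2 * (M.card * ε) * C.Q x := by
      calc M.card * (2 * b⁻¹ * C.Q x * a⁻¹) = 2 * b⁻¹ * C.Q x * (M.card * a⁻¹) := by ring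
        _ ≤ 2 * b⁻¹ * C.Q x * (M.card * ε * b) :=
          mul_le_mul_of_nonneg_left h.card_mul_inv_le (by positivity)
        _ = _ := by field_simp
    linarith

lemma Q_le {x z : Γ} (hx : x ∈ M) (hz : z ∈ valley C M x) :
    C.Q z ≤ (2 * b⁻¹ + 4 * (M.card * ε)) * C.Q x := by
  have hm := h.card_pos
  have hb := h.b_pos
  have hε := h.eps_pos
  have hQ := C.Q_pos x
  have hb1 : 1 ≤ b⁻¹ := (one_le_inv₀ hb).2 h.b_le_one
  have : 0 ≤ M.card * ε * C.Q x := by positivity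
  rcases h.Q_le_of_mem_valley hx hz with rfl | h1 | ⟨hzM, h1⟩
  · nlinarith
  · nlinarith
  · have h2 := C.Q_mul_pot_mem h.nonempty hx hzM
    have h3 : C.step (fun w => C.pot M w z) x ≤ b⁻¹ := by
      rw [← C.step_const b⁻¹ x]
      exact C.step_mono (fun w => (C.pot_le_self h.nonempty hzM w).trans (h.pot_self_le hzM)) x
    have h4 := mul_le_mul_of_nonneg_left h3 hQ.le
    have h5 := mul_le_mul_of_nonneg_left h1 (C.Q_nonneg z)
    nlinarith

lemma valleyMass_le {x : Γ} (hx : x ∈ M) :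
    valleyMass C M x ≤ Fintype.card Γ * (2 * b⁻¹ + 4 * (M.card * ε)) * C.Q x := by
  have hm := h.card_pos
  have hb := h.b_pos
  have hε := h.eps_pos
  have hQ := C.Q_pos x
  calc valleyMass C M x ≤ ∑ z ∈ valley C M x, (2 * b⁻¹ + 4 * (M.card * ε)) * C.Q x :=
        sum_le_sum fun z hz => h.Q_le hx hz
    _ = (valley C M x).card * ((2 * b⁻¹ + 4 * (M.card * ε)) * C.Q x) := by
        rw [sum_const, nsmul_eq_mul]
    _ ≤ Fintype.card Γ * ((2 * b⁻¹ + 4 * (M.card * ε)) * C.Q x) := by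
        gcongr; exact_mod_cast card_le_univ _
    _ = _ := by ring

lemma R_le_rMax {x : Γ} (hx : x ∈ M) : R C M x ≤ rMax C M :=
  le_csSup ((M.finite_toSet.image _).bddAbove) (Set.mem_image_of_mem _ hx)

/-- Some valley is nonempty, and `valleyMass_le` bounds its R from below; inserted into r ε |Γ| |M|
≤ δ this closes on |M| ε b. The argument cannot yet use that x belongs to its own valley, which is
deduced from this lemma. -/
lemma card_mul_eps_mul_b_le : M.card * ε * b ≤ 4 * δ := by
  have hm := h.card_pos
  have hb := h.b_pos
  have hε := h.eps_pos
  have hn := h.card_univ_pos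
  obtain ⟨x₀, -⟩ := id h.nonempty
  obtain ⟨x, hx, hmax⟩ := exists_max_image M (C.hitProb M x₀) h.nonempty
  have hxv : x₀ ∈ valley C M x := (mem_valley hx x₀).2 hmax
  have hV : 0 < valleyMass C M x :=
    sum_pos' (fun z _ => C.Q_nonneg z) ⟨x₀, hxv, C.Q_pos x₀⟩
  have hQ := C.Q_pos x
  have hX : 0 < M.card * ε := by positivity
  set X := M.card * ε with hXdef
  have h1 := h.valleyMass_le hx
  have h2 : 1 ≤ Fintype.card Γ * (2 * b⁻¹ + 4 * X) * R C M x := by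
    have : R C M x = C.Q x / valleyMass C M x := rfl
    rw [this, ← mul_div_assoc, le_div_iff₀ hV, one_mul]
    exact h1
  have h3 := h.R_le_rMax hx
  have h4 : X ≤ δ * (2 * b⁻¹ + 4 * X) := by
    calc X ≤ X * (Fintype.card Γ * (2 * b⁻¹ + 4 * X) * R C M x) :=
          le_mul_of_one_le_right hX.le h2
      _ ≤ X * (Fintype.card Γ * (2 * b⁻¹ + 4 * X) * rMax C M) := by gcongr
      _ = (rMax C M * ε * Fintype.card Γ * M.card) * (2 * b⁻¹ + 4 * X) := by rw [hXdef]; ring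
      _ ≤ δ * (2 * b⁻¹ + 4 * X) := by gcongr; exact h.le_delta
  have h5 : X * b ≤ δ * (2 + 4 * (X * b)) := by
    calc X * b ≤ δ * (2 * b⁻¹ + 4 * X) * b := by gcongr
      _ = δ * (2 + 4 * (X * b)) := by field_simp
  have h6 : 0 < X * b := by positivity
  nlinarith [h.delta_le]

/-- The chain started in x returns to M in x with probability at least 1/2, so no other point can
win. -/
lemma self_mem_valley {x : Γ} (hx : x ∈ M) : x ∈ valley C M x := by
  rw [mem_valley hx]
  intro y hy
  by_cases hxy : y = x
  · rw [hxy]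
  have h1 := h.one_sub_hitProb_le hx
  have h2 := h.card_mul_inv_le
  have h3 := h.card_mul_eps_mul_b_le
  have h4 : C.hitProb M x y ≤ 1 - C.hitProb M x x := by
    rw [← C.sum_erase_hitProb h.nonempty hx x]
    exact single_le_sum (f := fun y => C.hitProb M x y)
      (fun z _ => C.hitProb_nonneg h.nonempty x z) (mem_erase.2 ⟨hxy, hy⟩)
  linarith [h.delta_le]

lemma Q_le_valleyMass {x : Γ} (hx : x ∈ M) : C.Q x ≤ valleyMass C M x :=
  single_le_sum (f := fun z => C.Q z) (fun z _ => C.Q_nonneg z) (h.self_mem_valley hx)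

lemma valleyMass_pos {x : Γ} (hx : x ∈ M) : 0 < valleyMass C M x :=
  (C.Q_pos x).trans_le (h.Q_le_valleyMass hx)

lemma R_mul_valleyMass {x : Γ} (hx : x ∈ M) : R C M x * valleyMass C M x = C.Q x :=
  div_mul_cancel₀ _ (h.valleyMass_pos hx).ne'

lemma R_pos {x : Γ} (hx : x ∈ M) : 0 < R C M x := div_pos (C.Q_pos x) (h.valleyMass_pos hx)

lemma R_le_one {x : Γ} (hx : x ∈ M) : R C M x ≤ 1 :=
  (div_le_one (h.valleyMass_pos hx)).2 (h.Q_le_valleyMass hx)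

lemma le_R {x : Γ} (hx : x ∈ M) : b / (4 * Fintype.card Γ) ≤ R C M x := by
  have hm := h.card_pos
  have hb := h.b_pos
  have hε := h.eps_pos
  have hn := h.card_univ_pos
  have hQ := C.Q_pos x
  have h1 := h.valleyMass_le hx
  have h2 := h.card_mul_eps_mul_b_le
  change _ ≤ C.Q x / valleyMass C M x
  rw [div_le_div_iff₀ (by positivity) (h.valleyMass_pos hx)]
  calc b * valleyMass C M x ≤ b * (Fintype.card Γ * (2 * b⁻¹ + 4 * (M.card * ε)) * C.Q x) := by
        gcongr
    _ = Fintype.card Γ * C.Q x * (2 + 4 * (M.card * ε * b)) := by field_simp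
    _ ≤ Fintype.card Γ * C.Q x * 4 := by
        gcongr; linarith [h.delta_le]
    _ = _ := by ring

lemma exists_sInf_R : ∃ x ∈ M, sInf (R C M '' M) = R C M x := by
  have : sInf (R C M '' M) ∈ R C M '' (M : Set Γ) :=
    (h.nonempty.to_set.image _).csInf_mem (M.finite_toSet.image _)
  obtain ⟨x, hx, hx'⟩ := this
  exact ⟨x, hx, hx'.symm⟩

lemma inv_cMax_le {x : Γ} (hx : x ∈ M) : (cMax C M)⁻¹ ≤ R C M x := by
  rw [cMax, inv_inv]
  exact csInf_le ((M.finite_toSet.image _).bddBelow) (Set.mem_image_of_mem _ hx)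

lemma cMax_pos : 0 < cMax C M := by
  obtain ⟨x, hx, h1⟩ := h.exists_sInf_R
  rw [cMax, h1]
  exact inv_pos.2 (h.R_pos hx)

lemma one_le_R_mul_cMax {x : Γ} (hx : x ∈ M) : 1 ≤ R C M x * cMax C M := by
  have := h.inv_cMax_le hx
  rwa [inv_le_iff_one_le_mul₀ h.cMax_pos] at this

lemma le_inv_cMax : b / (4 * Fintype.card Γ) ≤ (cMax C M)⁻¹ := by
  obtain ⟨x, hx, h1⟩ := h.exists_sInf_R
  rw [cMax, inv_inv, h1]
  exact h.le_R hx

lemma rMax_pos : 0 < rMax C M := by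
  obtain ⟨x, hx⟩ := id h.nonempty
  exact (h.R_pos hx).trans_le (h.R_le_rMax hx)

lemma one_le_rMax_mul_cMax : 1 ≤ rMax C M * cMax C M := by
  obtain ⟨x, hx⟩ := id h.nonempty
  exact (h.one_le_R_mul_cMax hx).trans
    (mul_le_mul_of_nonneg_right (h.R_le_rMax hx) h.cMax_pos.le)

/-- The points of negligible mass, |Γ| of them at most, contribute together only a fraction of order
δ of the valley's mass; this is where the condition on r enters. -/
lemma card_mul_eps_mul_Q_le {x : Γ} (hx : x ∈ M) :
    Fintype.card Γ * (M.card * ε) * C.Q x ≤ δ * valleyMass C M x := by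
  have hm := h.card_pos
  have hε := h.eps_pos
  have hn := h.card_univ_pos
  have hV := h.valleyMass_pos hx
  rw [← h.R_mul_valleyMass hx]
  calc Fintype.card Γ * (M.card * ε) * (R C M x * valleyMass C M x)
      ≤ Fintype.card Γ * (M.card * ε) * (rMax C M * valleyMass C M x) := by
        gcongr; exact h.R_le_rMax hx
    _ = (rMax C M * ε * Fintype.card Γ * M.card) * valleyMass C M x := by ring
    _ ≤ _ := by gcongr; exact h.le_delta

/-- The mass attracted by `x` is at most of the order of the mass of its valley. -/
lemma sum_Q_mul_pot_le {x : Γ} (hx : x ∈ M) :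
    ∑ z, C.Q z * C.pot M z x ≤ 2 * valleyMass C M x := by
  have hM := h.nonempty
  have hm := h.card_pos
  have hb := h.b_pos
  have ha := h.a_pos
  have hε := h.eps_pos
  have hQ := C.Q_pos x
  have h1 : ∑ z ∈ valley C M x, C.Q z * C.pot M z x ≤ valleyMass C M x :=
    sum_le_sum fun z _ => mul_le_of_le_one_right (C.Q_nonneg z) (C.pot_mem_le_one hM z hx)
  -- Off the valley some y beats x, so x is reached with probability below 1/2 and the factor 1 -
  -- K(z, x), with K the harmonic measure of M, costs at most 2. Then Q(z) K(z, x) (1 - K(z, x)) is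
  -- bounded through the escape probability of x.
  have h2 : ∀ z ∈ (valley C M x)ᶜ, C.Q z * C.pot M z x ≤ 2 * (M.card * ε) * C.Q x := by
    intro z hz
    rw [mem_compl, mem_valley hx] at hz
    push Not at hz
    obtain ⟨y, hy, hxy⟩ := hz
    by_cases hzM : z ∈ M
    · have hzx : z ≠ x := by
        rintro rfl
        exact absurd ((mem_valley hx z).1 (h.self_mem_valley hx) y hy) (not_le.2 hxy)
      rw [C.pot_mem_ne hM hzM hzx, mul_zero]
      positivity
    · rw [C.hitProb_of_notMem hM hzM hx, C.hitProb_of_notMem hM hzM hy] at hxy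
      have hne : y ≠ x := by rintro rfl; exact lt_irrefl _ hxy
      have h3 : C.pot M z y ≤ 1 - C.pot M z x := by
        rw [← C.sum_erase_pot hM hx z]
        exact single_le_sum (f := fun y => C.pot M z y)
          (fun w _ => C.pot_nonneg hM z w) (mem_erase.2 ⟨hne, hy⟩)
      have h4 : ∑ y ∈ M.erase x, C.Q z * C.pot M z x * C.pot M z y ≤
          ∑ y ∈ M.erase x, C.pot M z z * C.Q x * C.hitProb M x y :=
        sum_le_sum fun y _ => C.Q_mul_pot_mul_pot_le hM hzM hx
      rw [← mul_sum, ← mul_sum, C.sum_erase_pot hM hx, C.sum_erase_hitProb hM hx] at h4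
      have h5 : C.pot M z z * C.Q x * (1 - C.hitProb M x x) ≤ M.card * ε * C.Q x := by
        calc C.pot M z z * C.Q x * (1 - C.hitProb M x x)
            ≤ b⁻¹ * C.Q x * (M.card * ε * b) := by
              have := C.hitProb_self_le_one hM hx x
              refine mul_le_mul (mul_le_mul_of_nonneg_right (h.pot_self_le hzM) hQ.le)
                ((h.one_sub_hitProb_le hx).trans h.card_mul_inv_le) (by linarith) (by positivity)
          _ = _ := by field_simp
      have h6 : 0 ≤ C.Q z * C.pot M z x := mul_nonneg (C.Q_nonneg z) (C.pot_nonneg hM z x)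
      nlinarith
  have h3 : ∑ z ∈ (valley C M x)ᶜ, C.Q z * C.pot M z x ≤
      Fintype.card Γ * (2 * (M.card * ε) * C.Q x) := by
    refine (sum_le_card_nsmul _ _ _ h2).trans ?_
    rw [nsmul_eq_mul]
    gcongr
    exact_mod_cast card_le_univ _
  have h4 := h.card_mul_eps_mul_Q_le hx
  have h5 := h.valleyMass_pos hx
  rw [sum_split (valley C M x)]
  nlinarith [h.delta_le]

/-- The mass strongly attracted by `x` is at least of the order of the mass of its valley. -/
lemma valleyMass_le_sum {x : Γ} (hx : x ∈ M) :
    valleyMass C M x ≤ 8 * ∑ z, C.Q z * C.pot M z x ^ 2 := by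
  have hm := h.card_pos
  have hε := h.eps_pos
  have hQ := C.Q_pos x
  have h1 : ∀ z ∈ valley C M x,
      C.Q z ≤ 4 * (C.Q z * C.pot M z x ^ 2) + 4 * (M.card * ε) * C.Q x := by
    intro z hz
    have h0 : 0 ≤ 4 * (M.card * ε) * C.Q x := by positivity
    have hQz := C.Q_pos z
    rcases h.Q_le_of_mem_valley hx hz with rfl | h1 | ⟨-, h1⟩
    · rw [C.pot_mem_self h.nonempty hx]; linarith
    · have : 0 ≤ C.Q z * C.pot M z x ^ 2 := by positivity
      linarith
    · have : (1 / 2) ^ 2 ≤ C.pot M z x ^ 2 := by gcongr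
      nlinarith
  have h2 : valleyMass C M x ≤ 4 * ∑ z, C.Q z * C.pot M z x ^ 2 +
      Fintype.card Γ * (4 * (M.card * ε) * C.Q x) := by
    calc valleyMass C M x ≤ ∑ z ∈ valley C M x,
          (4 * (C.Q z * C.pot M z x ^ 2) + 4 * (M.card * ε) * C.Q x) := sum_le_sum h1
      _ ≤ ∑ z, (4 * (C.Q z * C.pot M z x ^ 2) + 4 * (M.card * ε) * C.Q x) :=
          sum_le_sum_of_subset_of_nonneg (subset_univ _) fun z _ _ => by
            have := C.Q_pos z
            positivity
      _ = _ := by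
          rw [sum_add_distrib, ← mul_sum]; simp
  have h4 := h.card_mul_eps_mul_Q_le hx
  have h5 := h.valleyMass_pos hx
  nlinarith [h.delta_le]

end

end IsWellSeparated
end Valleys

/-- A finite family of numbers, any two of which are of different order, has a sum of the order of
its maximum. -/
lemma sum_le_two_mul_of_generic {α : Type*} [DecidableEq α] (s : Finset α) (f : α → ℝ) (ε : ℝ)
    (hε : ε ≤ 1 / 2) (hf : ∀ x ∈ s, 0 ≤ f x)
    (h : ∀ x ∈ s, ∀ y ∈ s, x ≠ y → f x ≤ ε * f y ∨ f y ≤ ε * f x) (B : ℝ) (hB0 : 0 ≤ B)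
    (hB : ∀ x ∈ s, f x ≤ B) : ∑ x ∈ s, f x ≤ 2 * B := by
  induction s using Finset.strongInduction generalizing B with
  | H s ih =>
    rcases s.eq_empty_or_nonempty with rfl | hs
    · simpa using hB0
    obtain ⟨x, hx, hmax⟩ := exists_max_image s f hs
    have hB2 : ∀ y ∈ s.erase x, f y ≤ B / 2 := by
      intro y hy
      have hy' := mem_of_mem_erase hy
      have h1 := hmax y hy'
      have h2 := hf y hy'
      have h3 := hf x hx
      have h4 := hB x hx
      rcases h y hy' x hx (ne_of_mem_erase hy) with h5 | h5
      · nlinarith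
      · nlinarith
    have := ih (s.erase x) (erase_ssubset hx) (fun y hy => hf y (mem_of_mem_erase hy))
      (fun y hy z hz => h y (mem_of_mem_erase hy) z (mem_of_mem_erase hz)) (B / 2)
      (by positivity) hB2
    rw [← add_sum_erase s f hx]
    linarith [hB x hx]

/-! ### The exclusion sets Σ_j and the proof that they are levels. -/

section ExitOrder

variable {Γ : Type*} [Fintype Γ] [DecidableEq Γ] [MeasurableSpace Γ] [DiscreteMeasurableSpace Γ]

open ReversibleChain

/-- `S ⊇ I` is a set for which the points of `S \ I` are metastable at the rate `β`, and which is
reached from anywhere much before the time `1 / β`. -/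
structure IsLevel (C : ReversibleChain Γ) (I S : Finset Γ) (β : ℝ) : Prop where
  nonempty : I.Nonempty
  subset : I ⊆ S
  beta_pos : 0 < β
  trace_le : β * C.greenTrace S ≤ 1 / 8
  escape_le : ∀ x ∈ S \ I,
    32 * C.Q x * (1 - C.hitProb S x x) ≤ β * ∑ z, C.Q z * C.pot S z x ^ 2

lemma excl_zero (I : Finset Γ) (m : ℕ → Γ) : excl I m 0 = I := by simp [excl]

lemma excl_succ (I : Finset Γ) (m : ℕ → Γ) (j : ℕ) :
    excl I m (j + 1) = insert (m (j + 1)) (excl I m j) := by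
  ext x
  simp only [excl, mem_union, mem_image, mem_Icc, mem_insert]
  constructor
  · rintro (hx | ⟨i, hi, rfl⟩)
    · exact Or.inr (Or.inl hx)
    · rcases Nat.lt_or_ge i (j + 1) with h | h
      · exact Or.inr (Or.inr ⟨i, ⟨hi.1, by omega⟩, rfl⟩)
      · left; congr 1; omega
  · rintro (rfl | hx | ⟨i, hi, rfl⟩)
    · exact Or.inr ⟨j + 1, ⟨by omega, le_rfl⟩, rfl⟩
    · exact Or.inl hx
    · exact Or.inr ⟨i, ⟨hi.1, by omega⟩, rfl⟩

lemma subset_excl (I : Finset Γ) (m : ℕ → Γ) (j : ℕ) : I ⊆ excl I m j := subset_union_left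

lemma excl_mono (I : Finset Γ) (m : ℕ → Γ) : Monotone (excl I m) := fun _ _ h =>
  union_subset_union_right (image_subset_image (Icc_subset_Icc le_rfl h))

lemma mem_excl (I : Finset Γ) (m : ℕ → Γ) {i j : ℕ} (hi : 1 ≤ i) (hij : i ≤ j) :
    m i ∈ excl I m j :=
  mem_union_right _ (mem_image_of_mem m (mem_Icc.2 ⟨hi, hij⟩))

variable {C : ReversibleChain Γ} {M I : Finset Γ} {m : ℕ → Γ}

namespace IsExitOrder

variable (he : IsExitOrder C M I m)
include he

lemma mem_sdiff {j : ℕ} (h1 : 1 ≤ j) (hj : j ≤ (M \ I).card) : m j ∈ M \ excl I m (j - 1) :=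
  (he j (mem_Icc.2 ⟨h1, hj⟩)).1

lemma mem {j : ℕ} (h1 : 1 ≤ j) (hj : j ≤ (M \ I).card) : m j ∈ M :=
  (Finset.mem_sdiff.1 (he.mem_sdiff h1 hj)).1

lemma notMem_of_lt {i j : ℕ} (hij : i < j) (hj : j ≤ (M \ I).card) : m j ∉ excl I m i := fun h =>
  (Finset.mem_sdiff.1 (he.mem_sdiff (by omega) hj)).2 (excl_mono I m (by omega) h)

lemma notMem {j : ℕ} (h1 : 1 ≤ j) (hj : j ≤ (M \ I).card) : m j ∉ I := fun h =>
  he.notMem_of_lt (i := 0) h1 hj (subset_excl I m 0 h)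

lemma ne_of_lt {i j : ℕ} (hi : 1 ≤ i) (hij : i < j) (hj : j ≤ (M \ I).card) : m i ≠ m j := fun h =>
  he.notMem_of_lt hij hj (h ▸ mem_excl I m hi le_rfl)

lemma excl_subset (hI : I ⊆ M) {j : ℕ} (hj : j ≤ (M \ I).card) : excl I m j ⊆ M := by
  refine union_subset hI fun x hx => ?_
  obtain ⟨i, hi, rfl⟩ := mem_image.1 hx
  rw [mem_Icc] at hi
  exact he.mem hi.1 (hi.2.trans hj)

lemma card_excl_sdiff {j : ℕ} (hj : j ≤ (M \ I).card) : (excl I m j \ I).card = j := by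
  induction j with
  | zero => simp [excl_zero]
  | succ j ih =>
    rw [excl_succ, insert_sdiff_of_notMem _ (he.notMem (by omega) hj), card_insert_of_notMem,
      ih (by omega)]
    intro h
    exact he.notMem_of_lt (Nat.lt_succ_self j) hj (Finset.mem_sdiff.1 h).1

lemma excl_card (hI : I ⊆ M) : excl I m (M \ I).card = M := by
  refine eq_of_subset_of_card_le (he.excl_subset hI le_rfl) ?_
  have h1 := card_sdiff_add_card_eq_card (subset_excl I m (M \ I).card)
  have h2 := card_sdiff_add_card_eq_card hI
  rw [he.card_excl_sdiff le_rfl] at h1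
  omega

lemma mem_excl_sdiff_iff {j : ℕ} (hj : j ≤ (M \ I).card) {x : Γ} :
    x ∈ excl I m j \ I ↔ ∃ i, 1 ≤ i ∧ i ≤ j ∧ m i = x := by
  rw [Finset.mem_sdiff, excl, mem_union, mem_image]
  constructor
  · rintro ⟨hx | ⟨i, hi, rfl⟩, hxI⟩
    · exact absurd hx hxI
    · rw [mem_Icc] at hi
      exact ⟨i, hi.1, hi.2, rfl⟩
  · rintro ⟨i, h1, h2, rfl⟩
    exact ⟨Or.inr ⟨i, mem_Icc.2 ⟨h1, h2⟩, rfl⟩, he.notMem h1 (h2.trans hj)⟩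

lemma TSup_eq (hI : I.Nonempty) {j : ℕ} (h1 : 1 ≤ j) (hj : j ≤ (M \ I).card) :
    TSup C M (excl I m (j - 1)) = C.pot (excl I m (j - 1)) (m j) (m j) := by
  rw [← (he j (mem_Icc.2 ⟨h1, hj⟩)).2]
  exact C.T_eq_pot (hI.mono (subset_excl I m _)) (Finset.mem_sdiff.1 (he.mem_sdiff h1 hj)).2

lemma pot_le (hI : I.Nonempty) {j : ℕ} (h1 : 1 ≤ j) (hj : j ≤ (M \ I).card) {x : Γ}
    (hx : x ∈ M \ excl I m (j - 1)) :
    C.pot (excl I m (j - 1)) x x ≤ C.pot (excl I m (j - 1)) (m j) (m j) := by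
  rw [← he.TSup_eq hI h1 hj, TSup,
    ← C.T_eq_pot (hI.mono (subset_excl I m _)) (Finset.mem_sdiff.1 hx).2]
  exact le_csSup (((M \ excl I m (j - 1)).finite_toSet.image _).bddAbove)
    (Set.mem_image_of_mem _ hx)

/-- Relative to Σ_{j-1} the point m_j has the largest time, and genericity separates it from m_{j+1}
by the factor ε; adding m_j to the set only shortens the time of m_{j+1}. -/
lemma pot_succ_le (hI : I.Nonempty) (hIM : I ⊆ M) {ε : ℝ} (hg : IsGeneric C M ε) {j : ℕ}
    (h1 : 1 ≤ j) (hj : j < (M \ I).card) :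
    C.pot (excl I m j) (m (j + 1)) (m (j + 1)) ≤ ε * C.pot (excl I m (j - 1)) (m j) (m j) := by
  have hS : (excl I m (j - 1)).Nonempty := hI.mono (subset_excl I m _)
  have hx := he.notMem_of_lt (show j - 1 < j + 1 by omega) hj
  have hy := he.notMem_of_lt (show j - 1 < j by omega) hj.le
  have hxM := he.mem (show 1 ≤ j + 1 by omega) hj
  have hyM := he.mem h1 hj.le
  have hne := (he.ne_of_lt h1 (Nat.lt_succ_self j) hj).symm
  have h2 : C.pot (excl I m j) (m (j + 1)) (m (j + 1)) ≤
      C.pot (excl I m (j - 1)) (m (j + 1)) (m (j + 1)) :=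
    C.pot_anti hS (excl_mono I m (Nat.sub_le _ _))
      (fun h => he.notMem_of_lt (Nat.lt_succ_self j) hj (Finset.mem_sdiff.1 h).1) _
  have h3 := he.pot_le hI h1 hj.le (Finset.mem_sdiff.2 ⟨hxM, hx⟩)
  have h4 := hg.times _ hxM _ hyM hne _ hS (by
    intro z hz
    rw [Finset.mem_sdiff, mem_insert, mem_singleton, not_or]
    refine ⟨he.excl_subset hIM (by omega) hz, ?_, ?_⟩
    · rintro rfl; exact hx hz
    · rintro rfl; exact hy hz)
  rw [C.T_eq_pot hS hx, C.T_eq_pot hS hy] at h4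
  have hp := C.pot_self_pos hS (m (j + 1))
  have hp' := C.pot_self_pos hS (m j)
  refine h2.trans ?_
  rcases h4 with h4 | h4
  · exact h4
  · have hε : 0 < ε := pos_of_mul_pos_left (hp'.trans_le h4) hp.le
    exact h3.trans (h4.trans (mul_le_mul_of_nonneg_left h3 hε.le))

/-- The points `m_1, …, m_j` leave their valleys, in the presence of each other, no faster than
`m_j` does. -/
lemma pot_le_pot_erase (hI : I.Nonempty) (hIM : I ⊆ M) {ε : ℝ} (hε : ε ≤ 1 / 8)
    (hg : IsGeneric C M ε) {j : ℕ} (hj : j ≤ (M \ I).card) {i : ℕ} (hi : 1 ≤ i) (hij : i ≤ j) :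
    C.pot (excl I m (j - 1)) (m j) (m j) ≤ C.pot ((excl I m j).erase (m i)) (m i) (m i) := by
  induction j with
  | zero => omega
  | succ j ih =>
    rcases Nat.lt_or_ge i (j + 1) with hlt | hge
    · have ih := ih (by omega) (by omega)
      set x := m i with hx
      set y := m (j + 1) with hy
      set J := (excl I m j).erase x with hJ
      have hxy : x ≠ y := he.ne_of_lt hi hlt hj
      have hxe : x ∈ excl I m j := mem_excl I m hi (by omega)
      have hye : y ∉ excl I m j := he.notMem_of_lt (Nat.lt_succ_self j) hj
      have hxJ : x ∉ J := notMem_erase x _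
      have hyJ : y ∉ J := fun h => hye (mem_of_mem_erase h)
      have hxI : x ∉ I := he.notMem hi (by omega)
      have hIJ : I ⊆ J := fun z hz =>
        mem_erase.2 ⟨by rintro rfl; exact hxI hz, subset_excl I m j hz⟩
      have hJn : J.Nonempty := hI.mono hIJ
      have e1 : (excl I m (j + 1)).erase x = insert y J := by
        rw [excl_succ, erase_insert_of_ne hxy.symm]
      have e2 : excl I m j = insert x J := (insert_erase hxe).symm
      have hxM : x ∈ M := he.mem hi (by omega)
      have hyM : y ∈ M := he.mem (by omega) hj
      have hJM : J ⊆ M := (erase_subset _ _).trans (he.excl_subset hIM (by omega))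
      rw [e1, Nat.add_sub_cancel, e2]
      -- Both identities compute the same determinant, so X B = T A. Hence the claim T ≤ X is
      -- equivalent to B ≤ A.
      have d1 := C.pot_insert_mul hJn hxJ hyJ hxy
      have d2 := C.pot_insert_mul hJn hyJ hxJ hxy.symm
      have h4 := hg.times _ hxM _ hyM hxy _ hJn (by
        intro z hz
        rw [Finset.mem_sdiff, mem_insert, mem_singleton, not_or]
        refine ⟨hJM hz, ?_, ?_⟩
        · rintro rfl; exact hxJ hz
        · rintro rfl; exact hyJ hz)
      rw [C.T_eq_pot hJn hxJ, C.T_eq_pot hJn hyJ] at h4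
      have h5 := he.pot_succ_le hI hIM hg (j := j) (by omega) hj
      rw [← hy, e2] at h5
      have hA := C.pot_self_pos hJn x
      have hB := C.pot_self_pos hJn y
      have hxJ0 := C.pot_nonneg hJn x y
      have hyJ0 := C.pot_nonneg hJn y x
      have hxB := C.pot_le_self hJn hyJ x
      have hyA := C.pot_le_self hJn hxJ y
      have hT := C.pot_self_pos (insert_nonempty x J) y
      set A := C.pot J x x
      set B := C.pot J y y
      set p := C.pot J x y with hp
      set q := C.pot J y x with hq
      set X := C.pot (insert y J) x x
      set T := C.pot (insert x J) y y
      have hXB : X * B = T * A := by linarith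
      have hBA : B ≤ A := by
        rcases h4 with h4 | h4
        -- Suppose A ≤ εB. By induction T ≤ εA, so the determinant T A is small against A B and the
        -- off-diagonal entries are at least half their maximal values: x and y communicate almost
        -- freely. Going back to Σ_{i-1}, where x was chosen as the slowest point, symmetry gives
        -- Q(y) ≤ 2 Q(x), and symmetry relative to J then gives B ≤ 4A, contrary to A ≤ B/8.
        · exfalso
          have hε0 : 0 < ε := pos_of_mul_pos_left (hA.trans_le h4) hB.le
          have hTB : T ≤ B / 2 := by
            have : T ≤ ε * A := h5.trans (mul_le_mul_of_nonneg_left ih hε0.le)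
            nlinarith
          have hpq : A * B / 2 ≤ p * q := by nlinarith
          have hpB : B / 2 ≤ p := by
            by_contra! hlt'
            nlinarith
          have hqA : A / 2 ≤ q := by
            by_contra! hlt'
            nlinarith
          set S := excl I m (i - 1) with hS
          have hSn : S.Nonempty := hI.mono (subset_excl I m _)
          have hxS : x ∉ S := he.notMem_of_lt (by omega) (by omega)
          have hyS : y ∉ S := he.notMem_of_lt (by omega) hj
          have hSJ : S ⊆ J := fun z hz =>
            mem_erase.2 ⟨by rintro rfl; exact hxS hz, excl_mono I m (by omega) hz⟩
          have r1 := C.pot_ratio_anti hSn hSJ hyJ x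
          have r2 := C.pot_ratio_anti hSn hSJ hxJ y
          have s1 := C.Q_mul_pot hSn hxS hyS
          have s2 := C.Q_mul_pot hJn hxJ hyJ
          have m1 := he.pot_le hI hi (by omega) (Finset.mem_sdiff.2 ⟨hyM, hyS⟩)
          have hQx := C.Q_pos x
          have hQy := C.Q_pos y
          have hSx := C.pot_self_pos hSn x
          have hSy := C.pot_self_pos hSn y
          have t1 := C.pot_le_self hSn hyS x
          rw [← hp] at r1
          rw [← hq] at r2
          have hqS : C.pot S x x / 2 ≤ C.pot S y x := by
            have : A / 2 * C.pot S x x ≤ C.pot S y x * A :=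
              (mul_le_mul_of_nonneg_right hqA hSx.le).trans r2
            refine le_of_mul_le_mul_right ?_ hA
            linarith
          have hQ : C.Q y ≤ 2 * C.Q x := by
            refine le_of_mul_le_mul_right ?_ hSx
            have u1 := mul_le_mul_of_nonneg_left hqS hQy.le
            have u2 := mul_le_mul_of_nonneg_left (t1.trans m1) hQx.le
            linarith
          have hBA : B ≤ 4 * A := by
            refine le_of_mul_le_mul_left ?_ hQx
            have u1 := mul_le_mul_of_nonneg_left hpB hQx.le
            have u2 := mul_le_mul_of_nonneg_left hyA hQy.le
            have u3 := mul_le_mul_of_nonneg_right hQ hA.le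
            linarith
          nlinarith
        · have hε0 : 0 < ε := pos_of_mul_pos_left (hB.trans_le h4) hA.le
          nlinarith
      refine le_of_mul_le_mul_right ?_ hB
      rw [hXB]
      exact mul_le_mul_of_nonneg_left hBA hT.le
    · have hi' : i = j + 1 := by omega
      subst hi'
      rw [excl_succ, erase_insert (he.notMem_of_lt (Nat.lt_succ_self j) hj), Nat.add_sub_cancel]

end IsExitOrder

variable {a b ε ε₂ δ : ℝ}

namespace IsWellSeparated

variable (h : IsWellSeparated C M a b ε δ)
include h

lemma valleyMass_le_selfMass {S : Finset Γ} (hS : S ⊆ M) {x : Γ} (hx : x ∈ S) :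
    valleyMass C M x ≤ 8 * ∑ z, C.Q z * C.pot S z x ^ 2 := by
  have hSn : S.Nonempty := ⟨x, hx⟩
  refine (h.valleyMass_le_sum (hS hx)).trans (mul_le_mul_of_nonneg_left ?_ (by norm_num))
  refine sum_le_sum fun z _ => mul_le_mul_of_nonneg_left ?_ (C.Q_nonneg z)
  have := C.pot_nonneg h.nonempty z x
  have := C.pot_anti hSn hS (z := x) (by simp [hx]) z
  gcongr

lemma greenTrace_self_le : C.greenTrace M ≤ Fintype.card Γ * b⁻¹ := by
  have hb := h.b_pos
  calc C.greenTrace M ≤ ∑ z ∈ Mᶜ, b⁻¹ := sum_le_sum fun z hz => h.pot_self_le (mem_compl.1 hz)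
    _ = (Mᶜ.card : ℝ) * b⁻¹ := by simp
    _ ≤ _ := by gcongr; exact card_le_univ _

/-- The set of all metastable points is a level at the rate of local equilibration. -/
lemma isLevel_self (hδ : δ ≤ 1 / 4096) (hI : I.Nonempty) (hIM : I ⊆ M) {β : ℝ}
    (hβ1 : b / (16 * Fintype.card Γ) ≤ β) (hβ2 : β ≤ b / (8 * Fintype.card Γ)) :
    IsLevel C I M β := by
  have hb := h.b_pos
  have hn := h.card_univ_pos
  have hβ : 0 < β := lt_of_lt_of_le (by positivity) hβ1
  refine ⟨hI, hIM, hβ, ?_, ?_⟩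
  · calc β * C.greenTrace M ≤ (b / (8 * Fintype.card Γ)) * (Fintype.card Γ * b⁻¹) :=
          mul_le_mul hβ2 h.greenTrace_self_le (C.greenTrace_nonneg h.nonempty) (by positivity)
      _ = 1 / 8 := by field_simp
  -- The trace condition used the upper bound on β, this one the lower bound. The factor 512 = 32 ·
  -- 16 together with the 1/8 lost in `valleyMass_le_sum` gives the threshold 1/4096.
  · intro x hx
    have hxM := (Finset.mem_sdiff.1 hx).1
    have hQ := C.Q_pos x
    have h1 := (h.one_sub_hitProb_le hxM).trans h.card_mul_inv_le
    have h2 := h.card_mul_eps_mul_Q_le hxM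
    have h3 := h.valleyMass_le_sum hxM
    have h4 := h.valleyMass_pos hxM
    calc 32 * C.Q x * (1 - C.hitProb M x x) ≤ 32 * C.Q x * (M.card * ε * b) :=
          mul_le_mul_of_nonneg_left h1 (by positivity)
      _ = b / (16 * Fintype.card Γ) * (512 * (Fintype.card Γ * (M.card * ε) * C.Q x)) := by
          field_simp; ring
      _ ≤ b / (16 * Fintype.card Γ) * (512 * (δ * valleyMass C M x)) := by gcongr
      _ ≤ b / (16 * Fintype.card Γ) * (valleyMass C M x / 8) := by
          refine mul_le_mul_of_nonneg_left ?_ (by positivity)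
          nlinarith
      _ ≤ β * (valleyMass C M x / 8) := by gcongr
      _ ≤ _ := mul_le_mul_of_nonneg_left (by linarith) hβ.le

/-- The time |Γ|/b of local equilibration is at most of the order c T_{x,S}: enlarging S to M \ {x}
leaves the inverse escape probability, of size at least 1/(|M| ε b), and r c ≥ 1 turns this into the
condition on r ε |Γ| |M|. -/
lemma card_mul_inv_le_cMax_mul {S : Finset Γ} (hS : S.Nonempty) (hSM : S ⊆ M) {x : Γ}
    (hx : x ∈ M \ S) : Fintype.card Γ * b⁻¹ ≤ 2 * (cMax C M * C.pot S x x) := by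
  have hb := h.b_pos
  have hn := h.card_univ_pos
  have hm := h.card_pos
  have hε := h.eps_pos
  have hc := h.cMax_pos
  have hr := h.rMax_pos
  rw [Finset.mem_sdiff] at hx
  have hSe : S ⊆ M.erase x := fun z hz => mem_erase.2 ⟨by rintro rfl; exact hx.2 hz, hSM hz⟩
  have hne : (M.erase x).Nonempty := hS.mono hSe
  have h1 := C.pot_erase_mul x hne hx.1
  have h2 := (h.one_sub_hitProb_le hx.1).trans h.card_mul_inv_le
  have h3 : C.pot (M.erase x) x x ≤ C.pot S x x := C.pot_anti hS hSe (by simp) x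
  have hp := C.pot_self_pos hS x
  have h4 : 1 ≤ C.pot S x x * (M.card * ε * b) := by
    rw [← h1]
    refine mul_le_mul h3 h2 ?_ hp.le
    have := C.hitProb_self_le_one h.nonempty hx.1 x
    linarith
  have h5 := h.one_le_rMax_mul_cMax
  have h6 := h.le_delta
  have h7 := h.delta_le
  set p := C.pot S x x
  calc Fintype.card Γ * b⁻¹ ≤ Fintype.card Γ * b⁻¹ * (p * (M.card * ε * b)) :=
        le_mul_of_one_le_right (by positivity) h4
    _ = Fintype.card Γ * p * (M.card * ε) := by field_simp
    _ ≤ Fintype.card Γ * p * (M.card * ε) * (rMax C M * cMax C M) :=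
        le_mul_of_one_le_right (by positivity) h5
    _ = (rMax C M * ε * Fintype.card Γ * M.card) * (cMax C M * p) := by ring
    _ ≤ 2 * (cMax C M * p) := by
        refine mul_le_mul_of_nonneg_right (by linarith) (by positivity)

/-- The exclusion sets are levels at the rates given by the effective depths. -/
lemma isLevel_excl (hg : IsGeneric C M ε₂) (hε₂ : ε₂ ≤ 1 / 8)
    (hrc : rMax C M * cMax C M * ε₂ ≤ 1 / 12288) (hI : I.Nonempty) (hIM : I ⊆ M)
    (he : IsExitOrder C M I m) {j : ℕ} (h1 : 1 ≤ j) (hj : j < (M \ I).card) :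
    IsLevel C I (excl I m j)
      (1 / (48 * (cMax C M * C.pot (excl I m j) (m (j + 1)) (m (j + 1))))) := by
  have hb := h.b_pos
  have hc := h.cMax_pos
  have hr := h.rMax_pos
  set S := excl I m j with hS
  have hSn : S.Nonempty := hI.mono (subset_excl I m j)
  have hSM : S ⊆ M := he.excl_subset hIM hj.le
  set t := C.pot S (m (j + 1)) (m (j + 1)) with ht
  have ht0 : 0 < t := C.pot_self_pos hSn _
  refine ⟨hI, subset_excl I m j, by positivity, ?_, ?_⟩
  -- The trace is at most |Γ|/b + 2c ∑ T_{x,S}. Genericity bounds the sum by 2t, and |Γ|/b ≤ 2ct, so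
  -- the total is 6ct = 1/(8β) for β = 1/(48ct).
  · have h2 := C.greenTrace_le hSn hSM (inv_pos.2 hb).le fun z hz => h.pot_self_le hz
    have h3 : ∑ x ∈ M \ S, C.pot S x x ≤ 2 * t := by
      refine sum_le_two_mul_of_generic _ _ ε₂ (by linarith) (fun x _ => C.pot_nonneg hSn x x)
        (fun x hx y hy hxy => ?_) t ht0.le
        (fun x hx => he.pot_le hI (j := j + 1) (by omega) hj hx)
      rw [Finset.mem_sdiff] at hx hy
      rw [← C.T_eq_pot hSn hx.2, ← C.T_eq_pot hSn hy.2]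
      refine hg.times x hx.1 y hy.1 hxy S hSn fun z hz => ?_
      rw [Finset.mem_sdiff, mem_insert, mem_singleton, not_or]
      refine ⟨hSM hz, ?_, ?_⟩
      · rintro rfl; exact hx.2 hz
      · rintro rfl; exact hy.2 hz
    have h4 : ∑ x ∈ M \ S, C.pot S x x * ((∑ z, C.Q z * C.pot M z x) / C.Q x) ≤
        ∑ x ∈ M \ S, C.pot S x x * (2 * cMax C M) := by
      refine sum_le_sum fun x hx => mul_le_mul_of_nonneg_left ?_ (C.pot_nonneg hSn x x)
      have hxM := (Finset.mem_sdiff.1 hx).1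
      have hQ := C.Q_pos x
      rw [div_le_iff₀ hQ]
      refine (h.sum_Q_mul_pot_le hxM).trans ?_
      rw [← h.R_mul_valleyMass hxM]
      have h5 := h.one_le_R_mul_cMax hxM
      have h6 := h.valleyMass_pos hxM
      nlinarith
    rw [← sum_mul] at h4
    have h5 : (∑ x ∈ M \ S, C.pot S x x) * (2 * cMax C M) ≤ 2 * t * (2 * cMax C M) :=
      mul_le_mul_of_nonneg_right h3 (by positivity)
    have h6 := h.card_mul_inv_le_cMax_mul hSn hSM
      (Finset.mem_sdiff.2 ⟨he.mem (by omega) hj, he.notMem_of_lt (Nat.lt_succ_self j) hj⟩)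
    rw [one_div, inv_mul_le_iff₀ (by positivity)]
    change _ ≤ 2 * (cMax C M * t) at h6
    linarith
  · intro x hx
    obtain ⟨i, hi, hij, rfl⟩ := (he.mem_excl_sdiff_iff hj.le).1 hx
    have hxS := (Finset.mem_sdiff.1 hx).1
    have hxM := hSM hxS
    have hxI := (Finset.mem_sdiff.1 hx).2
    have hne : (S.erase (m i)).Nonempty := hI.mono fun z hz =>
      mem_erase.2 ⟨by rintro rfl; exact hxI hz, subset_excl I m j hz⟩
    rw [C.one_sub_hitProb (m i) hne hxS]
    have h2 := he.pot_le_pot_erase hI hIM hε₂ hg hj.le hi hij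
    have h3 := he.pot_succ_le hI hIM hg h1 hj
    have hp := C.pot_self_pos hne (m i)
    have hp0 : 0 < C.pot (excl I m (j - 1)) (m j) (m j) :=
      C.pot_self_pos (hI.mono (subset_excl I m _)) _
    have hε0 : 0 < ε₂ := pos_of_mul_pos_left (ht0.trans_le h3) hp0.le
    have h4 : t ≤ ε₂ * C.pot (S.erase (m i)) (m i) (m i) :=
      h3.trans (mul_le_mul_of_nonneg_left h2 hε0.le)
    have h5 := h.valleyMass_le_selfMass hSM hxS
    have h6 := h.R_mul_valleyMass hxM
    have h7 := h.R_le_rMax hxM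
    have h8 := h.valleyMass_pos hxM
    -- 12288 = 8 · 32 · 48: the 8 of `valleyMass_le_selfMass`, the 32 of `escape_le` and the 48 of
    -- the rate.
    have h9 : C.Q (m i) * (cMax C M * ε₂) * 12288 ≤ valleyMass C M (m i) := by
      calc C.Q (m i) * (cMax C M * ε₂) * 12288
          = R C M (m i) * (valleyMass C M (m i) * (cMax C M * ε₂) * 12288) := by
            rw [← h6]; ring
        _ ≤ rMax C M * (valleyMass C M (m i) * (cMax C M * ε₂) * 12288) :=
            mul_le_mul_of_nonneg_right h7 (by positivity)
        _ = (rMax C M * cMax C M * ε₂) * (12288 * valleyMass C M (m i)) := by ring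
        _ ≤ 1 / 12288 * (12288 * valleyMass C M (m i)) := by gcongr
        _ = _ := by ring
    have hQ := C.Q_pos (m i)
    set p := C.pot (S.erase (m i)) (m i) (m i)
    set Y := ∑ z, C.Q z * C.pot S z (m i) ^ 2
    have h10 : 32 * C.Q (m i) * (48 * (cMax C M * t)) ≤ Y * p := by
      calc 32 * C.Q (m i) * (48 * (cMax C M * t))
          ≤ 32 * C.Q (m i) * (48 * (cMax C M * (ε₂ * p))) := by gcongr
        _ = (C.Q (m i) * (cMax C M * ε₂) * 12288) / 8 * p := by ring
        _ ≤ _ := by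
            refine mul_le_mul_of_nonneg_right ?_ hp.le
            linarith
    rw [← div_eq_mul_inv, div_le_iff₀ hp, one_div, mul_assoc, ← div_eq_inv_mul,
      le_div_iff₀ (by positivity)]
    exact h10

end IsWellSeparated
end ExitOrder

/-! ### Spectral theory of the Dirichlet operator in ℓ²(Q). -/

section Spectral

variable {Γ : Type*} [Fintype Γ] [DecidableEq Γ]

open ReversibleChain

/-- The inner product of `ℓ²(Q)`. -/
def ReversibleChain.ip (C : ReversibleChain Γ) (f g : Γ → ℝ) : ℝ := ∑ x, C.Q x * f x * g x

/-- An orthonormal basis of eigenfunctions of the Dirichlet operator `(1 - P)^S`. -/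
structure SpectralResolution (C : ReversibleChain Γ) (S : Finset Γ) where
  lam : {x // x ∉ S} → ℝ
  fn : {x // x ∉ S} → Γ → ℝ
  fn_eq_zero : ∀ k, ∀ x ∈ S, fn k x = 0
  eigen : ∀ k, ∀ x ∉ S, fn k x - C.step (fn k) x = lam k * fn k x
  orthonormal : ∀ k l, C.ip (fn k) (fn l) = if k = l then 1 else 0
  complete : ∀ x ∉ S, ∀ y ∉ S, ∑ k, fn k x * fn k y * C.Q y = if x = y then 1 else 0
  roots : (dirichlet C S).charpoly.roots = univ.val.map lam

variable (C : ReversibleChain Γ) (S : Finset Γ)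

/-- The Dirichlet operator, conjugated to a symmetric matrix. -/
def symmDirichlet : Matrix {x // x ∉ S} {x // x ∉ S} ℝ :=
  Matrix.diagonal (fun x : {x // x ∉ S} => √(C.Q x)) * dirichlet C S *
    Matrix.diagonal (fun x : {x // x ∉ S} => (√(C.Q x))⁻¹)

lemma symmDirichlet_apply (x y : {x // x ∉ S}) :
    symmDirichlet C S x y = √(C.Q x) * dirichlet C S x y * (√(C.Q y))⁻¹ := by
  simp [symmDirichlet]

lemma sqrt_Q_pos (x : Γ) : 0 < √(C.Q x) := Real.sqrt_pos.2 (C.Q_pos x)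

lemma isHermitian_symmDirichlet : (symmDirichlet C S).IsHermitian := by
  ext x y
  rw [Matrix.conjTranspose_apply, star_trivial, symmDirichlet_apply, symmDirichlet_apply]
  have hx := sqrt_Q_pos C x
  have hy := sqrt_Q_pos C y
  have h := C.reversible x y
  rw [← Real.mul_self_sqrt (C.Q_nonneg x), ← Real.mul_self_sqrt (C.Q_nonneg y)] at h
  have h' : √(C.Q x) * √(C.Q x) * (1 - C.P) x y = √(C.Q y) * √(C.Q y) * (1 - C.P) y x := by
    simp only [Matrix.sub_apply, Matrix.one_apply, mul_sub, h, eq_comm (a := (y : Γ))]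
    split_ifs with hxy
    · rw [hxy]
    · ring
  simp only [dirichlet, Matrix.submatrix_apply]
  field_simp
  linarith

lemma charpoly_symmDirichlet : (symmDirichlet C S).charpoly = (dirichlet C S).charpoly := by
  have h1 : Matrix.diagonal (fun x : {x // x ∉ S} => √(C.Q x)) *
      Matrix.diagonal (fun x : {x // x ∉ S} => (√(C.Q x))⁻¹) = 1 := by
    rw [Matrix.diagonal_mul_diagonal, ← Matrix.diagonal_one]
    congr 1
    funext x
    exact mul_inv_cancel₀ (sqrt_Q_pos C x).ne'
  let U : (Matrix {x // x ∉ S} {x // x ∉ S} ℝ)ˣ :=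
    ⟨_, _, h1, mul_eq_one_comm.1 h1⟩
  have h2 := Matrix.charpoly_units_conj U (dirichlet C S)
  rwa [← Matrix.coe_units_inv] at h2

lemma sum_subtype_notMem (f : Γ → ℝ) (hf : ∀ x ∈ S, f x = 0) :
    ∑ x, f x = ∑ x : {x // x ∉ S}, f x := by
  rw [sum_split S, sum_eq_zero hf, zero_add]
  exact Finset.sum_subtype _ (fun x => by simp) _

/-- Conjugation with √Q makes the operator symmetric; its orthonormal eigenvectors divided by √Q are
the eigenfunctions sought, and the characteristic polynomial does not change. -/
theorem nonempty_spectralResolution : Nonempty (SpectralResolution C S) := by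
  have hB := isHermitian_symmDirichlet C S
  set V : Matrix {x // x ∉ S} {x // x ∉ S} ℝ := (hB.eigenvectorUnitary).1 with hV
  have hVV : V * star V = 1 := Unitary.coe_mul_star_self _
  have hVV' : star V * V = 1 := Unitary.coe_star_mul_self _
  let φ : {x // x ∉ S} → Γ → ℝ := fun k x =>
    if h : x ∉ S then (√(C.Q x))⁻¹ * V ⟨x, h⟩ k else 0
  have hφ : ∀ k (x : {x // x ∉ S}), φ k x = (√(C.Q x))⁻¹ * V x k := fun k x => by
    simp only [φ, dif_pos x.2]
  have hφ0 : ∀ k, ∀ x ∈ S, φ k x = 0 := fun k x hx => by simp [φ, hx]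
  refine ⟨⟨hB.eigenvalues, φ, hφ0, ?_, ?_, ?_, ?_⟩⟩
  · intro k x hx
    have h := congrFun (hB.mulVec_eigenvectorBasis k) ⟨x, hx⟩
    have hxp := sqrt_Q_pos C x
    have h1 : ∀ y, hB.eigenvectorBasis k y = V y k := fun y => by
      rw [hV, hB.eigenvectorUnitary_apply]
    simp only [Matrix.mulVec, dotProduct, Pi.smul_apply, smul_eq_mul, h1, symmDirichlet_apply] at h
    have h2 : φ k x - C.step (φ k) x = ∑ y, (1 - C.P) x y * φ k y := by
      simp [Matrix.sub_apply, Matrix.one_apply, sub_mul, sum_sub_distrib, step]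
    rw [h2, sum_subtype_notMem S _ fun y hy => by rw [hφ0 k y hy, mul_zero], hφ k ⟨x, hx⟩]
    simp only [hφ]
    calc ∑ y : {x // x ∉ S}, (1 - C.P) x y * ((√(C.Q y))⁻¹ * V y k)
        = (√(C.Q x))⁻¹ * ∑ y : {x // x ∉ S},
            √(C.Q x) * dirichlet C S ⟨x, hx⟩ y * (√(C.Q y))⁻¹ * V y k := by
          rw [mul_sum]
          refine sum_congr rfl fun y _ => ?_
          simp only [dirichlet, Matrix.submatrix_apply]
          field_simp
      _ = _ := by rw [h]; ring
  · intro k l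
    rw [ip, sum_subtype_notMem S _ fun y hy => by rw [hφ0 k y hy, mul_zero, zero_mul]]
    have h := congrFun (congrFun hVV' k) l
    rw [Matrix.mul_apply, Matrix.one_apply] at h
    rw [← h]
    refine sum_congr rfl fun x _ => ?_
    have hx := sqrt_Q_pos C x
    rw [hφ, hφ, Matrix.star_apply, star_trivial]
    nth_rw 1 [← Real.mul_self_sqrt (C.Q_nonneg x)]
    field_simp
  · intro x hx y hy
    have h := congrFun (congrFun hVV ⟨x, hx⟩) ⟨y, hy⟩
    rw [Matrix.mul_apply, Matrix.one_apply] at h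
    have hxp := sqrt_Q_pos C x
    have hyp := sqrt_Q_pos C y
    have h2 : ∑ k, φ k x * φ k y * C.Q y = (√(C.Q x))⁻¹ * √(C.Q y) *
        ∑ k, V ⟨x, hx⟩ k * star V k ⟨y, hy⟩ := by
      rw [mul_sum]
      refine sum_congr rfl fun k _ => ?_
      rw [hφ k ⟨x, hx⟩, hφ k ⟨y, hy⟩, Matrix.star_apply, star_trivial]
      nth_rw 2 [← Real.mul_self_sqrt (C.Q_nonneg y)]
      field_simp
    rw [h2, h]
    simp only [Subtype.mk.injEq]
    split_ifs with hxy
    · rw [hxy, mul_one, inv_mul_cancel₀ hyp.ne']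
    · rw [mul_zero]
  · rw [← charpoly_symmDirichlet, hB.roots_charpoly_eq_eigenvalues]
    simp

variable {C S}

lemma ip_comm (f g : Γ → ℝ) : C.ip f g = C.ip g f :=
  sum_congr rfl fun x _ => by ring

lemma ip_sum_right {ι : Type*} (s : Finset ι) (f : Γ → ℝ) (g : ι → Γ → ℝ) :
    C.ip f (fun x => ∑ i ∈ s, g i x) = ∑ i ∈ s, C.ip f (g i) := by
  simp only [ip, mul_sum]
  exact sum_comm

lemma ip_mul_right (f g : Γ → ℝ) (a : ℝ) : C.ip f (fun x => a * g x) = a * C.ip f g := by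
  simp only [ip, mul_sum]
  exact sum_congr rfl fun x _ => by ring

lemma ip_sub_step (f g : Γ → ℝ) :
    C.ip f (fun x => g x - C.step g x) = C.ip g (fun x => f x - C.step f x) :=
  C.sum_mul_sub_step f g

/-- Nonnegativity of the Dirichlet form. -/
lemma ip_sub_step_nonneg (f : Γ → ℝ) : 0 ≤ C.ip f (fun x => f x - C.step f x) := by
  have h1 : C.ip f (C.step f) ≤ C.ip f f := by
    have h2 : C.ip f (C.step f) = ∑ x, ∑ y, C.Q x * C.P x y * (f x * f y) := by
      simp only [ip, step, mul_sum]
      exact sum_congr rfl fun x _ => sum_congr rfl fun y _ => by ring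
    have h3 : ∑ x, ∑ y, C.Q x * C.P x y * f x ^ 2 = C.ip f f := by
      refine sum_congr rfl fun x _ => ?_
      rw [← sum_mul, ← mul_sum, C.row_sum]; ring
    have h4 : ∑ x, ∑ y, C.Q x * C.P x y * f y ^ 2 = C.ip f f := by
      rw [← h3, sum_comm]
      exact sum_congr rfl fun x _ => sum_congr rfl fun y _ => by rw [C.reversible]
    have h5 : C.ip f (C.step f) ≤
        ∑ x, ∑ y, C.Q x * C.P x y * ((f x ^ 2 + f y ^ 2) / 2) := by
      rw [h2]
      refine sum_le_sum fun x _ => sum_le_sum fun y _ =>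
        mul_le_mul_of_nonneg_left ?_ (mul_nonneg (C.Q_nonneg x) (C.P_nonneg x y))
      nlinarith [sq_nonneg (f x - f y)]
    have h6 : ∑ x, ∑ y, C.Q x * C.P x y * ((f x ^ 2 + f y ^ 2) / 2) =
        ((∑ x, ∑ y, C.Q x * C.P x y * f x ^ 2) + ∑ x, ∑ y, C.Q x * C.P x y * f y ^ 2) / 2 := by
      rw [← sum_add_distrib, sum_div]
      refine sum_congr rfl fun x _ => ?_
      rw [← sum_add_distrib, sum_div]
      exact sum_congr rfl fun y _ => by ring
    rw [h6, h3, h4] at h5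
    linarith
  have : C.ip f (fun x => f x - C.step f x) = C.ip f f - C.ip f (C.step f) := by
    simp only [ip, mul_sub, sum_sub_distrib]
  linarith

namespace SpectralResolution

variable (sr : SpectralResolution C S)

lemma expand {f : Γ → ℝ} (hf : ∀ x ∈ S, f x = 0) (x : Γ) :
    f x = ∑ k, C.ip (sr.fn k) f * sr.fn k x := by
  by_cases hx : x ∈ S
  · rw [hf x hx, sum_eq_zero fun k _ => by rw [sr.fn_eq_zero k x hx, mul_zero]]
  · have h1 : ∑ k, C.ip (sr.fn k) f * sr.fn k x =
        ∑ y, f y * ∑ k, sr.fn k x * sr.fn k y * C.Q y := by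
      simp only [ip, sum_mul, mul_sum]
      rw [sum_comm]
      exact sum_congr rfl fun y _ => sum_congr rfl fun k _ => by ring
    rw [h1, Finset.sum_eq_single x]
    · rw [sr.complete x hx x hx, if_pos rfl, mul_one]
    · intro y _ hy
      by_cases hyS : y ∈ S
      · rw [hf y hyS, zero_mul]
      · rw [sr.complete x hx y hyS, if_neg hy.symm, mul_zero]
    · simp

lemma ip_eq {f : Γ → ℝ} (hf : ∀ x ∈ S, f x = 0) (g : Γ → ℝ) :
    C.ip g f = ∑ k, C.ip (sr.fn k) f * C.ip (sr.fn k) g := by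
  conv_lhs => rw [show f = fun x => ∑ k, C.ip (sr.fn k) f * sr.fn k x from
    funext (sr.expand hf)]
  rw [ip_sum_right]
  refine sum_congr rfl fun k _ => ?_
  rw [ip_mul_right, ip_comm g]

lemma ip_fn_sub_step {f : Γ → ℝ} (hf : ∀ x ∈ S, f x = 0) (k : {x // x ∉ S}) :
    C.ip (sr.fn k) (fun x => f x - C.step f x) = sr.lam k * C.ip (sr.fn k) f := by
  rw [ip_sub_step]
  simp only [ip, mul_sum]
  refine sum_congr rfl fun x _ => ?_
  by_cases hx : x ∈ S
  · rw [hf x hx]; ring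
  · rw [sr.eigen k x hx]; ring

lemma energy_eq {f : Γ → ℝ} (hf : ∀ x ∈ S, f x = 0) :
    C.ip f (fun x => f x - C.step f x) = ∑ k, sr.lam k * C.ip (sr.fn k) f ^ 2 := by
  rw [ip_comm, sr.ip_eq hf]
  exact sum_congr rfl fun k _ => by rw [sr.ip_fn_sub_step hf]; ring

lemma energy_fn (k : {x // x ∉ S}) :
    C.ip (sr.fn k) (fun x => sr.fn k x - C.step (sr.fn k) x) = sr.lam k := by
  rw [sr.ip_fn_sub_step (sr.fn_eq_zero k), sr.orthonormal, if_pos rfl, mul_one]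

lemma lam_nonneg (k : {x // x ∉ S}) : 0 ≤ sr.lam k := by
  rw [← sr.energy_fn k]
  exact ip_sub_step_nonneg _

/-- An eigenfunction satisfies f = λ G f with G the Green operator. Evaluate this where |f| is
largest and bound the row of G by its diagonal. -/
lemma one_le_lam_mul_greenTrace (hS : S.Nonempty) (k : {x // x ∉ S}) :
    1 ≤ sr.lam k * C.greenTrace S := by
  obtain ⟨x, -, hx⟩ := exists_max_image univ (fun x => |sr.fn k x|) ⟨k.1, mem_univ _⟩
  have hpos : 0 < |sr.fn k x| := by
    by_contra! h0
    have h1 : ∀ y, sr.fn k y = 0 := fun y =>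
      abs_nonpos_iff.1 ((hx y (mem_univ y)).trans h0)
    have := sr.orthonormal k k
    rw [if_pos rfl, ip, sum_eq_zero fun y _ => by rw [h1, mul_zero]] at this
    exact zero_ne_one this
  have hl := sr.lam_nonneg k
  have h1 : sr.fn k x = ∑ z ∈ Sᶜ, C.pot S x z * (sr.lam k * sr.fn k z) := by
    rw [C.eq_sum_pot hS (sr.fn k) x, sum_split S, sum_eq_zero (s := S), zero_add]
    · exact sum_congr rfl fun z hz => by
        rw [if_neg (mem_compl.1 hz), sr.eigen k z (mem_compl.1 hz)]
    · intro z hz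
      rw [if_pos hz, sr.fn_eq_zero k z hz, mul_zero]
  have h2 : |sr.fn k x| ≤ ∑ z ∈ Sᶜ, C.pot S z z * (sr.lam k * |sr.fn k x|) := by
    conv_lhs => rw [h1]
    refine (abs_sum_le_sum_abs _ _).trans (sum_le_sum fun z hz => ?_)
    rw [abs_mul, abs_mul, abs_of_nonneg hl, abs_of_nonneg (C.pot_nonneg hS x z)]
    exact mul_le_mul (C.pot_le_self hS (mem_compl.1 hz) x)
      (mul_le_mul_of_nonneg_left (hx z (mem_univ z)) hl)
      (mul_nonneg hl (abs_nonneg _)) (C.pot_nonneg hS z z)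
  rw [← sum_mul] at h2
  change _ ≤ C.greenTrace S * _ at h2
  refine le_of_mul_le_mul_right ?_ hpos
  linarith

end SpectralResolution

/-- For the empty set the resolution diagonalises 1 - P itself, so its eigenvalues are in the
assumed spectrum. The bound on the form then passes to every Dirichlet operator by restriction. -/
lemma ip_sub_step_le (hspec : spectrum ℝ (1 - C.P) ⊆ Set.Icc 0 1) (f : Γ → ℝ) :
    C.ip f (fun x => f x - C.step f x) ≤ C.ip f f := by
  obtain ⟨sr⟩ := nonempty_spectralResolution C ∅
  have h1 : ∀ k, sr.lam k ≤ 1 := by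
    intro k
    refine (hspec ?_).2
    rw [← Matrix.spectrum_toLin', ← Module.End.hasEigenvalue_iff_mem_spectrum]
    refine Module.End.hasEigenvalue_of_hasEigenvector (x := sr.fn k) ⟨?_, ?_⟩
    · rw [Module.End.mem_eigenspace_iff]
      funext x
      have := sr.eigen k x (by simp)
      simpa [Matrix.sub_mulVec, Matrix.mulVec, dotProduct, step] using this
    · intro h0
      have := sr.orthonormal k k
      rw [if_pos rfl, ip, sum_eq_zero fun y _ => by rw [h0]; simp] at this
      exact zero_ne_one this
  rw [sr.energy_eq (f := f) (by simp), sr.ip_eq (f := f) (by simp)]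
  refine sum_le_sum fun k _ => ?_
  nlinarith [sq_nonneg (C.ip (sr.fn k) f), h1 k]

lemma SpectralResolution.lam_le_one (sr : SpectralResolution C S)
    (hspec : spectrum ℝ (1 - C.P) ⊆ Set.Icc 0 1) (k : {x // x ∉ S}) : sr.lam k ≤ 1 := by
  have h := ip_sub_step_le hspec (sr.fn k)
  rwa [sr.energy_fn, sr.orthonormal, if_pos rfl] at h

/-- A quadratic form with dominant negative diagonal is negative definite. -/
lemma sum_sum_neg_of_diag_dominant {α : Type*} [DecidableEq α] (T : Finset α) (A w : α → α → ℝ)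
    (hw : ∀ x ∈ T, ∀ y ∈ T, w x y = w y x)
    (hA : ∀ x ∈ T, ∀ y ∈ T, x ≠ y → |A x y| ≤ w x y)
    (hd : ∀ x ∈ T, A x x + ∑ y ∈ T.erase x, w x y < 0) (v : α → ℝ) (hv : ∃ x ∈ T, v x ≠ 0) :
    ∑ x ∈ T, ∑ y ∈ T, v x * v y * A x y < 0 := by
  have h1 : ∀ x ∈ T, ∑ y ∈ T, v x * v y * A x y ≤
      v x ^ 2 * A x x + ∑ y ∈ T.erase x, (v x ^ 2 / 2 * w x y + v y ^ 2 / 2 * w x y) := by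
    intro x hx
    rw [← add_sum_erase T _ hx]
    refine add_le_add (by rw [sq]) (sum_le_sum fun y hy => ?_)
    have h2 := hA x hx y (mem_of_mem_erase hy) (ne_of_mem_erase hy).symm
    have h3 : v x * v y * A x y ≤ |v x * v y| * w x y := by
      refine (le_abs_self _).trans ?_
      rw [abs_mul]
      exact mul_le_mul_of_nonneg_left h2 (abs_nonneg _)
    have h4 : |v x * v y| ≤ v x ^ 2 / 2 + v y ^ 2 / 2 := by
      rw [abs_le]
      constructor <;> nlinarith [sq_nonneg (v x - v y), sq_nonneg (v x + v y)]
    have := mul_le_mul_of_nonneg_right h4 ((abs_nonneg _).trans h2)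
    linarith
  have h2 : ∑ x ∈ T, ∑ y ∈ T.erase x, v y ^ 2 / 2 * w x y =
      ∑ x ∈ T, ∑ y ∈ T.erase x, v x ^ 2 / 2 * w x y := by
    rw [sum_comm' (t' := T) (s' := fun y => T.erase y)]
    · exact sum_congr rfl fun x hx => sum_congr rfl fun y hy => by
        rw [hw x hx y (mem_of_mem_erase hy)]
    · intro x y
      simp only [mem_erase]
      tauto
  calc ∑ x ∈ T, ∑ y ∈ T, v x * v y * A x y
      ≤ ∑ x ∈ T, (v x ^ 2 * A x x +
          ∑ y ∈ T.erase x, (v x ^ 2 / 2 * w x y + v y ^ 2 / 2 * w x y)) := sum_le_sum h1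
    _ = ∑ x ∈ T, v x ^ 2 * (A x x + ∑ y ∈ T.erase x, w x y) := by
        simp only [sum_add_distrib, h2]
        rw [← sum_add_distrib, ← sum_add_distrib]
        refine sum_congr rfl fun x _ => ?_
        rw [← mul_sum]; ring
    _ < 0 := by
        obtain ⟨x, hx, hvx⟩ := hv
        refine sum_neg' (fun y hy => mul_nonpos_of_nonneg_of_nonpos (sq_nonneg _) (hd y hy).le)
          ⟨x, hx, mul_neg_of_pos_of_neg (by positivity) (hd x hx)⟩

/-- Dimension count: fewer linear conditions than unknowns. -/
lemma exists_ne_zero_of_card_lt {α β : Type*} (s : Finset α) (t : Finset β) (h : t.card < s.card)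
    (A : β → α → ℝ) : ∃ v : α → ℝ, (∃ x ∈ s, v x ≠ 0) ∧ (∀ x ∉ s, v x = 0) ∧
      ∀ y ∈ t, ∑ x ∈ s, v x * A y x = 0 := by
  classical
  let F : (s → ℝ) →ₗ[ℝ] (t → ℝ) :=
    { toFun := fun v y => ∑ x, v x * A y x
      map_add' := fun u v => by funext y; simp [add_mul, sum_add_distrib]
      map_smul' := fun c v => by funext y; simp [mul_sum, mul_assoc] }
  have hker : LinearMap.ker F ≠ ⊥ := LinearMap.ker_ne_bot_of_finrank_lt (by simpa using h)
  obtain ⟨v, hv, hv0⟩ := (Submodule.ne_bot_iff _).1 hker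
  obtain ⟨x, hx⟩ := Function.ne_iff.1 hv0
  refine ⟨fun a => if ha : a ∈ s then v ⟨a, ha⟩ else 0, ⟨x, x.2, by simpa using hx⟩,
    fun a ha => by simp [ha], fun y hy => ?_⟩
  have h1 := congrFun (LinearMap.mem_ker.1 hv) ⟨y, hy⟩
  rw [← sum_coe_sort s]
  simpa [F] using h1

/-! ### Counting eigenvalues below and above a level by variational arguments. -/

section Counting

variable [MeasurableSpace Γ] [DiscreteMeasurableSpace Γ] {I : Finset Γ} {β : ℝ}

lemma IsLevel.nonempty' (h : IsLevel C I S β) : S.Nonempty := h.nonempty.mono h.subset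

lemma Q_le_selfMass (hS : S.Nonempty) {x : Γ} (hx : x ∈ S) :
    C.Q x ≤ ∑ z, C.Q z * C.pot S z x ^ 2 := by
  have := single_le_sum (f := fun z => C.Q z * C.pot S z x ^ 2)
    (fun z _ => mul_nonneg (C.Q_nonneg z) (sq_nonneg _)) (mem_univ x)
  beta_reduce at this
  rwa [C.pot_mem_self hS hx, one_pow, mul_one] at this

/-- The overlap of two equilibrium potentials is controlled by the conductance between their points;
off-diagonal Gram entries are thereby compared with off-diagonal entries of the Dirichlet form. -/
lemma sum_Q_mul_pot_mul_pot_le (hS : S.Nonempty) {x y : Γ} (hx : x ∈ S) (hxy : x ≠ y) :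
    ∑ z, C.Q z * C.pot S z x * C.pot S z y ≤ C.greenTrace S * (C.Q x * C.hitProb S x y) := by
  rw [sum_split S, sum_eq_zero (s := S), zero_add, greenTrace, sum_mul]
  · refine sum_le_sum fun z hz => ?_
    have := C.Q_mul_pot_mul_pot_le hS (y := y) (mem_compl.1 hz) hx
    linarith
  · intro z hz
    by_cases hzx : z = x
    · rw [hzx, C.pot_mem_ne hS hx hxy, mul_zero]
    · rw [C.pot_mem_ne hS hz hzx]; ring

/-- Eigenvalues of the Dirichlet operator for `I` below the level are at most as many as there are
metastable points. -/
lemma IsLevel.card_le (h : IsLevel C I S β) (sr : SpectralResolution C I) :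
    (univ.filter fun k => sr.lam k < 8 * β).card ≤ (S \ I).card := by
  by_contra! hlt
  obtain ⟨v, ⟨k₀, hk₀, hv₀⟩, -, hv⟩ := exists_ne_zero_of_card_lt _ _ hlt (fun x k => sr.fn k x)
  set A := univ.filter fun k => sr.lam k < 8 * β with hA
  set f : Γ → ℝ := fun x => ∑ k ∈ A, v k * sr.fn k x with hf
  have hfS : ∀ x ∈ S, f x = 0 := by
    intro x hx
    by_cases hxI : x ∈ I
    · exact sum_eq_zero fun k _ => by rw [sr.fn_eq_zero k x hxI, mul_zero]
    · exact hv x (mem_sdiff.2 ⟨hx, hxI⟩)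
  have hcoef : ∀ k, C.ip (sr.fn k) f = if k ∈ A then v k else 0 := by
    intro k
    rw [hf, ip_sum_right]
    simp only [ip_mul_right, sr.orthonormal, mul_ite, mul_one, mul_zero, sum_ite_eq]
  have hI : ∀ x ∈ I, f x = 0 := fun x hx => hfS x (h.subset hx)
  obtain ⟨sr'⟩ := nonempty_spectralResolution C S
  have hpos : 0 < C.ip f f := by
    rw [sr.ip_eq hI]
    refine sum_pos' (fun k _ => mul_self_nonneg _) ⟨k₀, mem_univ _, ?_⟩
    rw [hcoef, if_pos hk₀]
    exact mul_self_pos.2 hv₀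
  have h1 : 8 * β * C.ip f f ≤ C.ip f (fun x => f x - C.step f x) := by
    rw [sr'.energy_eq hfS, sr'.ip_eq hfS, mul_sum]
    refine sum_le_sum fun k _ => ?_
    rw [← sq]
    refine mul_le_mul_of_nonneg_right ?_ (sq_nonneg _)
    have h2 := sr'.one_le_lam_mul_greenTrace h.nonempty' k
    have h3 := h.trace_le
    have h4 := C.greenTrace_nonneg h.nonempty'
    have h5 : 0 < C.greenTrace S := by
      refine h4.lt_of_ne fun h0 => ?_
      rw [← h0, mul_zero] at h2
      linarith
    refine le_of_mul_le_mul_right ?_ h5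
    linarith
  have h2 : C.ip f (fun x => f x - C.step f x) < 8 * β * C.ip f f := by
    rw [sr.energy_eq hI, sr.ip_eq hI, mul_sum]
    refine sum_lt_sum (fun k _ => ?_) ⟨k₀, mem_univ _, ?_⟩
    · rw [hcoef]
      split_ifs with hk
      · rw [← sq]
        exact mul_le_mul_of_nonneg_right (mem_filter.1 hk).2.le (sq_nonneg _)
      · simp
    · rw [hcoef, if_pos hk₀, ← sq]
      exact mul_lt_mul_of_pos_right (mem_filter.1 hk₀).2 (by positivity)
  linarith

/-- The trial space is spanned by the equilibrium potentials of the points of S \ I. On it the form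
energy - (β/2)·norm² has diagonal dominated by -(β/2)·mass, since escape costs at most β/32 of the
mass, and off-diagonal entries bounded by twice the conductance; so it is negative definite. With
too few low eigenvalues, some nonzero element would be orthogonal to all of their eigenfunctions and
have energy at least (β/2)·norm². -/
lemma IsLevel.le_card (h : IsLevel C I S β) (sr : SpectralResolution C I) :
    (S \ I).card ≤ (univ.filter fun k => sr.lam k ≤ β / 2).card := by
  by_contra! hlt
  have hS := h.nonempty'
  have hβ := h.beta_pos
  obtain ⟨v, hv₀, -, hv⟩ := exists_ne_zero_of_card_lt _ _ hlt
    (fun k x => C.ip (sr.fn k) (fun z => C.pot S z x))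
  set T := S \ I with hT
  set f : Γ → ℝ := fun z => ∑ x ∈ T, v x * C.pot S z x with hf
  have hI : ∀ x ∈ I, f x = 0 := by
    intro x hx
    refine sum_eq_zero fun y hy => ?_
    rw [C.pot_mem_ne hS (h.subset hx), mul_zero]
    rintro rfl
    exact (mem_sdiff.1 hy).2 hx
  have h1 : β / 2 * C.ip f f ≤ C.ip f (fun x => f x - C.step f x) := by
    rw [sr.energy_eq hI, sr.ip_eq hI, mul_sum]
    refine sum_le_sum fun k _ => ?_
    rw [← sq]
    by_cases hk : sr.lam k ≤ β / 2
    · have : C.ip (sr.fn k) f = 0 := by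
        rw [hf, ip_sum_right]
        simp only [ip_mul_right]
        exact hv k (mem_filter.2 ⟨mem_univ _, hk⟩)
      rw [this]; simp
    · exact mul_le_mul_of_nonneg_right (not_le.1 hk).le (sq_nonneg _)
  set N : Γ → Γ → ℝ := fun x y => ∑ z, C.Q z * C.pot S z x * C.pot S z y with hN
  have e1 : C.ip f f = ∑ x ∈ T, ∑ y ∈ T, v x * v y * N x y := by
    rw [hf, ip_sum_right]
    simp only [ip_mul_right]
    refine sum_congr rfl fun x _ => ?_
    rw [ip_comm, ip_sum_right, mul_sum]
    refine sum_congr rfl fun y _ => ?_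
    rw [ip_mul_right]
    simp only [hN, ip]; ring
  have e2 : C.ip f (fun x => f x - C.step f x) = ∑ x ∈ T, ∑ y ∈ T, v x * v y *
      (C.Q x * ((if x = y then 1 else 0) - C.hitProb S x y)) := by
    have hst : ∀ x, C.step f x = ∑ y ∈ T, v y * C.hitProb S x y := fun x => by
      rw [hf, C.step_sum]
      simp only [step_mul_left]
      rfl
    have hfx : ∀ x ∈ T, f x = v x := by
      intro x hx
      rw [hf]
      beta_reduce
      rw [Finset.sum_eq_single x]
      · rw [C.pot_mem_self hS (mem_sdiff.1 hx).1, mul_one]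
      · intro y _ hy
        rw [C.pot_mem_ne hS (mem_sdiff.1 hx).1 hy.symm, mul_zero]
      · exact fun h' => absurd hx h'
    have h0 : C.ip f (fun x => f x - C.step f x) =
        ∑ x ∈ T, C.Q x * f x * (f x - C.step f x) := by
      rw [ip]
      symm
      refine sum_subset (subset_univ _) fun x _ hx => ?_
      by_cases hxI : x ∈ I
      · rw [hI x hxI]; ring
      · have hxS : x ∉ S := fun h' => hx (mem_sdiff.2 ⟨h', hxI⟩)
        have : f x - C.step f x = 0 := by
          rw [hst, hf]
          beta_reduce
          rw [← sum_sub_distrib]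
          refine sum_eq_zero fun y hy => ?_
          rw [C.hitProb_of_notMem hS hxS (mem_sdiff.1 hy).1, sub_self]
        rw [this, mul_zero]
    rw [h0]
    refine sum_congr rfl fun x hx => ?_
    rw [hst, hfx x hx]
    simp only [mul_sub, sum_sub_distrib, mul_ite, mul_one, mul_zero, sum_ite_eq, if_pos hx,
      mul_sum]
    congr 1
    · ring
    · exact sum_congr rfl fun y _ => by ring
  have hYN : ∀ x, N x x = ∑ z, C.Q z * C.pot S z x ^ 2 := fun x =>
    sum_congr rfl fun z _ => by ring
  have key := sum_sum_neg_of_diag_dominant T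
    (fun x y => C.Q x * ((if x = y then 1 else 0) - C.hitProb S x y) - β / 2 * N x y)
    (fun x y => 2 * (C.Q x * C.hitProb S x y))
    (fun x hx y hy => by rw [C.Q_mul_hitProb hS (mem_sdiff.1 hx).1 (mem_sdiff.1 hy).1])
    (fun x hx y hy hxy => by
      have hxS := (mem_sdiff.1 hx).1
      have h2 := sum_Q_mul_pot_mul_pot_le (C := C) hS hxS hxy
      have h3 : 0 ≤ N x y := sum_nonneg fun z _ => mul_nonneg
        (mul_nonneg (C.Q_nonneg z) (C.pot_nonneg hS z x)) (C.pot_nonneg hS z y)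
      have h4 : 0 ≤ C.Q x * C.hitProb S x y := mul_nonneg (C.Q_nonneg x) (C.hitProb_nonneg hS x y)
      have h5 : β * N x y ≤ 1 / 8 * (C.Q x * C.hitProb S x y) := by
        calc β * N x y ≤ β * (C.greenTrace S * (C.Q x * C.hitProb S x y)) :=
              mul_le_mul_of_nonneg_left h2 hβ.le
          _ = β * C.greenTrace S * (C.Q x * C.hitProb S x y) := by ring
          _ ≤ _ := mul_le_mul_of_nonneg_right h.trace_le h4
      rw [if_neg hxy, abs_le]
      have h6 : 0 ≤ β * N x y := mul_nonneg hβ.le h3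
      constructor <;> linarith)
    (fun x hx => by
      have hxS := (mem_sdiff.1 hx).1
      have h2 := h.escape_le x hx
      have h3 := Q_le_selfMass (C := C) hS hxS
      have h4 := C.Q_pos x
      have h5 : ∑ y ∈ T.erase x, 2 * (C.Q x * C.hitProb S x y) ≤
          2 * (C.Q x * (1 - C.hitProb S x x)) := by
        rw [← C.sum_erase_hitProb hS hxS x, mul_sum, mul_sum]
        refine sum_le_sum_of_subset_of_nonneg (erase_subset_erase _ sdiff_subset) fun y _ _ => ?_
        have := C.hitProb_nonneg hS x y
        positivity
      rw [if_pos rfl, hYN]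
      have h6 : 0 < β * ∑ z, C.Q z * C.pot S z x ^ 2 := mul_pos hβ (h4.trans_le h3)
      linarith)
    v hv₀
  have e3 : C.ip f (fun x => f x - C.step f x) - β / 2 * C.ip f f = ∑ x ∈ T, ∑ y ∈ T, v x * v y *
      (C.Q x * ((if x = y then 1 else 0) - C.hitProb S x y) - β / 2 * N x y) := by
    rw [e1, e2, mul_sum, ← sum_sub_distrib]
    refine sum_congr rfl fun x _ => ?_
    rw [mul_sum, ← sum_sub_distrib]
    exact sum_congr rfl fun y _ => by ring
  rw [← e3] at key
  linarith

/-- The spectrum of the Dirichlet operator for `I` splits at the rate of a level. -/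
lemma IsLevel.card_eq (h : IsLevel C I S β) (sr : SpectralResolution C I) :
    (univ.filter fun k => sr.lam k ≤ β / 2).card = (S \ I).card := by
  refine le_antisymm (le_trans (card_le_card fun k hk => ?_) (h.card_le sr)) (h.le_card sr)
  have := h.beta_pos
  rw [mem_filter] at hk ⊢
  exact ⟨hk.1, by linarith [hk.2]⟩

/-- The eigenvalues at most β/2 and those below 8β are equally many, so there is none in between. -/
lemma IsLevel.lam_le_or (h : IsLevel C I S β) (sr : SpectralResolution C I) (k : {x // x ∉ I}) :
    sr.lam k ≤ β / 2 ∨ 8 * β ≤ sr.lam k := by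
  have hsub : (univ.filter fun k => sr.lam k ≤ β / 2) ⊆
      univ.filter fun k => sr.lam k < 8 * β := fun k hk => by
    have := h.beta_pos
    rw [mem_filter] at hk ⊢
    exact ⟨hk.1, by linarith [hk.2]⟩
  have heq := eq_of_subset_of_card_le hsub ((h.card_le sr).trans (h.card_eq sr).ge)
  by_contra! hk
  have h1 : k ∈ univ.filter fun k => sr.lam k < 8 * β := mem_filter.2 ⟨mem_univ _, hk.2⟩
  rw [← heq] at h1
  exact absurd (mem_filter.1 h1).2 (not_le.2 hk.1)

end Counting
end Spectral

/-! ### Bounds of the resolvent kernel away from the spectrum. -/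

section Resolvent

variable {Γ : Type*} [Fintype Γ] [DecidableEq Γ]

namespace ReversibleChain

variable (C : ReversibleChain Γ) {S : Finset Γ}

/-- Functions that are nearly subharmonic off `S` are controlled by their values on `S`. -/
lemma le_sum_pot_of_sub_step_le (hS : S.Nonempty) {β : ℝ} (hβ : 0 ≤ β)
    (hτ : β * C.greenTrace S ≤ 1 / 4) {f : Γ → ℝ} (hf : ∀ y, 0 ≤ f y)
    (h : ∀ y ∉ S, f y - C.step f y ≤ β * f y) (y : Γ) :
    f y ≤ 4 / 3 * ∑ x ∈ S, C.pot S y x * f x := by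
  set H : Γ → ℝ := fun y => ∑ x ∈ S, C.pot S y x * f x with hH
  have hH0 : ∀ y, 0 ≤ H y := fun y =>
    sum_nonneg fun x _ => mul_nonneg (C.pot_nonneg hS y x) (hf x)
  have h1 : ∀ y, f y ≤ H y + β * ∑ z ∈ Sᶜ, C.pot S y z * f z := by
    intro y
    conv_lhs => rw [C.eq_sum_pot hS f y, sum_split S]
    refine add_le_add (sum_congr rfl fun x hx => by rw [if_pos hx]).le ?_
    rw [mul_sum]
    refine sum_le_sum fun z hz => ?_
    rw [if_neg (mem_compl.1 hz)]
    have := mul_le_mul_of_nonneg_left (h z (mem_compl.1 hz)) (C.pot_nonneg hS y z)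
    linarith
  -- At the maximum m of f - (4/3) H, inserting f ≤ m + (4/3) H into f ≤ H + β G f gives m ≤ m/4;
  -- the factor 4/3 is 1/(1 - 1/4).
  obtain ⟨u, -, hu⟩ := exists_max_image univ (fun y => f y - 4 / 3 * H y) ⟨y, mem_univ y⟩
  set m := f u - 4 / 3 * H u with hm
  have hm0 : m ≤ 0 := by
    by_contra! hpos
    have h2 : ∑ z ∈ Sᶜ, C.pot S u z * f z ≤
        m * C.greenTrace S + 4 / 3 * (C.greenTrace S * H u) := by
      have h3 : ∑ z ∈ Sᶜ, C.pot S u z * H z ≤ C.greenTrace S * H u := by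
        simp only [hH, mul_sum]
        rw [sum_comm]
        refine sum_le_sum fun x _ => ?_
        have := mul_le_mul_of_nonneg_right (C.sum_pot_mul_pot_le hS u x) (hf x)
        rw [sum_mul] at this
        refine (sum_congr rfl fun z _ => by ring).le.trans (this.trans (le_of_eq (by ring)))
      have h4 : ∑ z ∈ Sᶜ, C.pot S u z ≤ C.greenTrace S :=
        sum_le_sum fun z hz => C.pot_le_self hS (mem_compl.1 hz) u
      calc ∑ z ∈ Sᶜ, C.pot S u z * f z ≤
            ∑ z ∈ Sᶜ, (m * C.pot S u z + 4 / 3 * (C.pot S u z * H z)) := by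
            refine sum_le_sum fun z _ => ?_
            have := mul_le_mul_of_nonneg_left (hu z (mem_univ z)) (C.pot_nonneg hS u z)
            linarith
        _ = m * ∑ z ∈ Sᶜ, C.pot S u z + 4 / 3 * ∑ z ∈ Sᶜ, C.pot S u z * H z := by
            rw [sum_add_distrib, mul_sum, mul_sum]
        _ ≤ _ := by
            have := mul_le_mul_of_nonneg_left h4 hpos.le
            linarith
    have h5 := mul_le_mul_of_nonneg_left h2 hβ
    have h6 := mul_le_mul_of_nonneg_right hτ hpos.le
    have h7 := mul_le_mul_of_nonneg_right hτ (hH0 u)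
    have h8 := h1 u
    nlinarith
  have := hu y (mem_univ y)
  linarith

/-- The transition operator on complex functions. -/
def stepC (f : Γ → ℂ) (x : Γ) : ℂ := ∑ y, (C.P x y : ℂ) * f y

lemma norm_stepC_le (f : Γ → ℂ) (x : Γ) : ‖C.stepC f x‖ ≤ C.step (fun y => ‖f y‖) x := by
  refine (norm_sum_le _ _).trans (sum_le_sum fun y _ => ?_)
  rw [norm_mul, Complex.norm_real, Real.norm_of_nonneg (C.P_nonneg x y)]

lemma sum_mul_stepC (f g : Γ → ℂ) :
    ∑ x, (C.Q x : ℂ) * f x * C.stepC g x = ∑ x, (C.Q x : ℂ) * g x * C.stepC f x := by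
  simp only [stepC, mul_sum]
  rw [sum_comm]
  refine sum_congr rfl fun y _ => sum_congr rfl fun x _ => ?_
  have : (C.Q x : ℂ) * C.P x y = C.Q y * C.P y x := by exact_mod_cast C.reversible x y
  linear_combination f x * g y * this

/-- If (1 - ζ) f = P f and |1 - ζ| ≥ 1 - β, then |f| is nearly subharmonic, with defect β. -/
lemma norm_le_sum_pot (hS : S.Nonempty) {β : ℝ} (hβ : 0 ≤ β)
    (hτ : β * C.greenTrace S ≤ 1 / 4) {f : Γ → ℂ} {ζ : ℂ} (hζ : 1 - β ≤ ‖1 - ζ‖)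
    (h : ∀ y ∉ S, (1 - ζ) * f y = C.stepC f y) (y : Γ) :
    ‖f y‖ ≤ 4 / 3 * ∑ x ∈ S, C.pot S y x * ‖f x‖ := by
  refine C.le_sum_pot_of_sub_step_le hS hβ hτ (f := fun y => ‖f y‖) (fun _ => norm_nonneg _)
    (fun z hz => ?_) y
  have h1 := C.norm_stepC_le f z
  rw [← h z hz, norm_mul] at h1
  have := mul_le_mul_of_nonneg_right hζ (norm_nonneg (f z))
  linarith

end ReversibleChain

open ReversibleChain

variable [MeasurableSpace Γ] [DiscreteMeasurableSpace Γ] {C : ReversibleChain Γ} {I S : Finset Γ}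
  {β : ℝ}

namespace SpectralResolution

/-- The resolvent kernel of the Dirichlet operator, as a function of `y`, with pole in `x`. -/
def green (sr : SpectralResolution C S) (ζ : ℂ) (x y : Γ) : ℂ :=
  ∑ k, (sr.fn k y * sr.fn k x * C.Q x : ℝ) / (sr.lam k - ζ)

/-- The resolvent kernel at `-β`. -/
def greenReal (sr : SpectralResolution C S) (β : ℝ) (x y : Γ) : ℝ :=
  ∑ k, sr.fn k y * sr.fn k x * C.Q x / (sr.lam k + β)

variable (sr : SpectralResolution C S)

lemma green_of_mem (ζ : ℂ) (x : Γ) {y : Γ} (hy : y ∈ S) : sr.green ζ x y = 0 :=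
  sum_eq_zero fun k _ => by rw [sr.fn_eq_zero k y hy]; simp

lemma greenReal_of_mem (β : ℝ) (x : Γ) {y : Γ} (hy : y ∈ S) : sr.greenReal β x y = 0 :=
  sum_eq_zero fun k _ => by rw [sr.fn_eq_zero k y hy]; simp

lemma greenReal_sub_step (hβ : 0 < β) {x y : Γ} (hx : x ∉ S) (hy : y ∉ S) :
    sr.greenReal β x y - C.step (sr.greenReal β x) y =
      (if y = x then 1 else 0) - β * sr.greenReal β x y := by
  rw [← sr.complete y hy x hx]
  have h1 : C.step (sr.greenReal β x) y =
      ∑ k, sr.fn k x * C.Q x / (sr.lam k + β) * C.step (sr.fn k) y := by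
    simp only [← C.step_mul_left]
    rw [← C.step_sum]
    congr 1
    funext z
    exact sum_congr rfl fun k _ => by ring
  rw [h1, greenReal, mul_sum, ← sum_sub_distrib, ← sum_sub_distrib]
  refine sum_congr rfl fun k _ => ?_
  have h2 := sr.eigen k y hy
  have h3 : sr.lam k + β ≠ 0 := by have := sr.lam_nonneg k; positivity
  rw [show C.step (sr.fn k) y = (1 - sr.lam k) * sr.fn k y by linarith]
  field_simp
  ring

lemma green_sub_stepC {ζ : ℂ} (hζ : ∀ k, (sr.lam k : ℂ) - ζ ≠ 0) {x y : Γ} (hx : x ∉ S)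
    (hy : y ∉ S) :
    (1 - ζ) * sr.green ζ x y - C.stepC (sr.green ζ x) y = if y = x then 1 else 0 := by
  have h0 : ((∑ k, sr.fn k y * sr.fn k x * C.Q x : ℝ) : ℂ) = if y = x then 1 else 0 := by
    rw [sr.complete y hy x hx]; split_ifs <;> simp
  rw [← h0]
  have h1 : C.stepC (sr.green ζ x) y =
      ∑ k, (sr.fn k x * C.Q x : ℝ) / (sr.lam k - ζ) * (C.step (sr.fn k) y : ℝ) := by
    simp only [stepC, green, step, mul_sum, Complex.ofReal_sum]
    rw [sum_comm]
    refine sum_congr rfl fun k _ => sum_congr rfl fun z _ => ?_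
    push_cast; ring
  rw [h1, green, mul_sum, ← sum_sub_distrib]
  push_cast
  refine sum_congr rfl fun k _ => ?_
  have h2 := sr.eigen k y hy
  have h3 := hζ k
  rw [show C.step (sr.fn k) y = (1 - sr.lam k) * sr.fn k y by linarith]
  push_cast
  field_simp
  ring

/-- On the diagonal the spectral weights are nonnegative, so that a comparison of denominators
suffices. Off the diagonal the spectral sum is not usable in this way. -/
lemma norm_green_self_le {ζ : ℂ} (x : Γ) {κ : ℝ}
    (hκ : ∀ k, sr.lam k + β ≤ κ * ‖(sr.lam k : ℂ) - ζ‖) (hβ : 0 < β) :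
    ‖sr.green ζ x x‖ ≤ κ * sr.greenReal β x x := by
  rw [greenReal, mul_sum]
  refine (norm_sum_le _ _).trans (sum_le_sum fun k _ => ?_)
  have h1 : 0 < sr.lam k + β := by have := sr.lam_nonneg k; positivity
  have h2 : 0 ≤ sr.fn k x * sr.fn k x * C.Q x :=
    mul_nonneg (mul_self_nonneg _) (C.Q_nonneg x)
  have h3 : 0 < ‖(sr.lam k : ℂ) - ζ‖ := by
    refine (norm_nonneg _).lt_of_ne fun h => ?_
    have := hκ k
    rw [← h] at this
    linarith
  rw [norm_div, Complex.norm_real, Real.norm_of_nonneg h2, ← mul_div_assoc,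
    div_le_div_iff₀ h3 h1]
  have := mul_le_mul_of_nonneg_left (hκ k) h2
  linarith

lemma norm_green_self_le_div {ζ : ℂ} {x : Γ} (hx : x ∉ S) {κ : ℝ} (hκ0 : 0 < κ)
    (hκ : ∀ k, κ ≤ ‖(sr.lam k : ℂ) - ζ‖) : ‖sr.green ζ x x‖ ≤ 1 / κ := by
  rw [← (sr.complete x hx x hx).trans (if_pos rfl), sum_div]
  refine (norm_sum_le _ _).trans (sum_le_sum fun k _ => ?_)
  have h2 : 0 ≤ sr.fn k x * sr.fn k x * C.Q x :=
    mul_nonneg (mul_self_nonneg _) (C.Q_nonneg x)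
  rw [norm_div, Complex.norm_real, Real.norm_of_nonneg h2]
  exact div_le_div_of_nonneg_left h2 hκ0 (hκ k)

end SpectralResolution

lemma IsLevel.nonempty_erase (h : IsLevel C I S β) {x : Γ} (hx : x ∉ I) : (S.erase x).Nonempty :=
  h.nonempty.mono fun _ hy => mem_erase.2 ⟨fun h' => hx (h' ▸ hy), h.subset hy⟩

/-- The conditions on S involve I only through the set of points whose escape is controlled. So the
spectral gap also holds with S \ {x} in place of I, where a single low eigenvalue is left. -/
lemma IsLevel.erase (h : IsLevel C I S β) {x : Γ} (hx : x ∈ S \ I) :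
    IsLevel C (S.erase x) S β where
  nonempty := h.nonempty_erase (mem_sdiff.1 hx).2
  subset := erase_subset x S
  beta_pos := h.beta_pos
  trace_le := h.trace_le
  escape_le y hy := by
    have : y = x := by
      by_contra hne
      exact (mem_sdiff.1 hy).2 (mem_erase.2 ⟨hne, (mem_sdiff.1 hy).1⟩)
    rw [this]
    exact h.escape_le x hx

/-- The resolvent of the Dirichlet operator that leaves out one metastable point. -/
lemma IsLevel.mul_greenReal_le (h : IsLevel C I S β) {x : Γ} (hx : x ∈ S \ I)
    (sr : SpectralResolution C (S.erase x)) :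
    7 / 8 * (β * (∑ z, C.Q z * C.pot S z x ^ 2) * sr.greenReal β x x) ≤ C.Q x := by
  have hS := h.nonempty'
  have hβ := h.beta_pos
  have hxS := (mem_sdiff.1 hx).1
  have hJ := h.nonempty_erase (mem_sdiff.1 hx).2
  set γ := sr.greenReal β x with hγ
  have hxJ := notMem_erase x S
  have heq : ∀ y ∉ S.erase x, γ y - C.step γ y = (if y = x then 1 else 0) - β * γ y :=
    fun y hy => sr.greenReal_sub_step hβ hxJ hy
  have h0 : ∀ y ∈ S.erase x, γ y = 0 := fun y hy => sr.greenReal_of_mem β x hy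
  have hpos : ∀ y, 0 ≤ γ y := by
    intro y
    -- The maximum principle for -γ, with the set where γ ≥ 0 added to the boundary: where γ < 0,
    -- the function -γ is subharmonic.
    have := C.nonpos_of_subharmonic (S := S.erase x ∪ univ.filter fun y => 0 ≤ γ y)
      (hJ.mono subset_union_left) (f := fun y => (-1) * γ y) (fun y hy => ?_) (fun y hy => ?_) y
    · linarith
    · rcases mem_union.1 hy with hy | hy
      · rw [h0 y hy]; simp
      · have := (mem_filter.1 hy).2
        linarith
    · rw [mem_union, not_or, mem_filter, not_and, not_le] at hy
      have h1 := hy.2 (mem_univ y)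
      have h2 := heq y hy.1
      rw [C.step_mul_left]
      have h3 : β * γ y < 0 := mul_neg_of_pos_of_neg hβ h1
      have h4 : (0 : ℝ) ≤ if y = x then 1 else 0 := by positivity
      linarith
  have hharm : ∀ y ∉ S, γ y - C.step γ y = - (β * γ y) := by
    intro y hy
    rw [heq y fun h' => hy (mem_of_mem_erase h'), if_neg (by rintro rfl; exact hy hxS), zero_sub]
  have hS0 : ∀ y ∈ S, γ y = γ x * C.pot S y x := by
    intro y hy
    rw [C.pot_of_mem hS hy]
    split_ifs with hyx
    · rw [hyx, mul_one]
    · rw [h0 y (mem_erase.2 ⟨hyx, hy⟩), mul_zero]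
  have hup : ∀ y, γ y ≤ γ x * C.pot S y x := by
    refine C.le_of_sub_step_le hS (g := fun y => γ x * C.pot S y x) (fun y hy => (hS0 y hy).le)
      fun y hy => ?_
    rw [C.step_mul_left, ← mul_sub,
      C.pot_harmonic hS hy (by rintro rfl; exact hy hxS), mul_zero, hharm y hy]
    have := mul_nonneg hβ.le (hpos y)
    linarith
  -- γ solves the harmonic problem up to the killing term βγ, and the trace bound makes this at most
  -- 1/8 of the harmonic extension. Hence γ is its value at x times the equilibrium potential, up to
  -- a factor in [7/8, 1].
  have hlow : ∀ y, 7 / 8 * (γ x * C.pot S y x) ≤ γ y := by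
    intro y
    have h1 := C.eq_sum_pot hS γ y
    rw [sum_split S] at h1
    have h2 : ∑ z ∈ S, (C.pot S y z * if z ∈ S then γ z else γ z - C.step γ z) =
        γ x * C.pot S y x := by
      rw [sum_eq_single x]
      · rw [if_pos hxS, mul_comm]
      · intro z hz hzx
        rw [if_pos hz, h0 z (mem_erase.2 ⟨hzx, hz⟩), mul_zero]
      · exact fun h' => absurd hxS h'
    have h3 : -(1 / 8 * (γ x * C.pot S y x)) ≤
        ∑ z ∈ Sᶜ, (C.pot S y z * if z ∈ S then γ z else γ z - C.step γ z) := by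
      have h4 : ∑ z ∈ Sᶜ, (C.pot S y z * if z ∈ S then γ z else γ z - C.step γ z) =
          - (β * ∑ z ∈ Sᶜ, C.pot S y z * γ z) := by
        rw [mul_sum, ← sum_neg_distrib]
        refine sum_congr rfl fun z hz => ?_
        rw [if_neg (mem_compl.1 hz), hharm z (mem_compl.1 hz)]; ring
      have h5 : ∑ z ∈ Sᶜ, C.pot S y z * γ z ≤ γ x * (C.greenTrace S * C.pot S y x) := by
        refine le_trans (sum_le_sum fun z _ =>
          mul_le_mul_of_nonneg_left (hup z) (C.pot_nonneg hS y z)) ?_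
        refine le_trans (le_of_eq ?_)
          (mul_le_mul_of_nonneg_left (C.sum_pot_mul_pot_le hS y x) (hpos x))
        rw [mul_sum]
        exact sum_congr rfl fun z _ => by ring
      have h6 := mul_le_mul_of_nonneg_left h5 hβ.le
      have h7 := mul_le_mul_of_nonneg_right h.trace_le
        (mul_nonneg (hpos x) (C.pot_nonneg hS y x))
      rw [h4]
      linarith
    linarith
  -- Pair (1 - P + β) γ = δ_x with the equilibrium potential of x; the Dirichlet part equals Q(x)
  -- γ(x) times the escape probability and is dropped because it is nonnegative.
  have hpair : β * ∑ z, C.Q z * C.pot S z x * γ z ≤ C.Q x := by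
    have h1 := C.sum_mul_sub_step (fun z => C.pot S z x) γ
    have h2 : ∑ z, C.Q z * γ z * (C.pot S z x - C.step (fun z => C.pot S z x) z) =
        C.Q x * γ x * (1 - C.hitProb S x x) := by
      rw [sum_eq_single x]
      · rw [C.pot_mem_self hS hxS]; rfl
      · intro z _ hzx
        by_cases hz : z ∈ S
        · rw [h0 z (mem_erase.2 ⟨hzx, hz⟩)]; ring
        · rw [C.pot_harmonic hS hz hzx, mul_zero]
      · simp
    have h3 : ∑ z, C.Q z * C.pot S z x * (γ z - C.step γ z) =
        C.Q x - β * ∑ z, C.Q z * C.pot S z x * γ z := by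
      have : ∀ z, C.Q z * C.pot S z x * (γ z - C.step γ z) =
          (if z = x then C.Q x else 0) - β * (C.Q z * C.pot S z x * γ z) := by
        intro z
        by_cases hz : z ∈ S.erase x
        · rw [C.pot_mem_ne hS (mem_of_mem_erase hz) (ne_of_mem_erase hz),
            if_neg (ne_of_mem_erase hz)]
          ring
        · rw [heq z hz]
          split_ifs with hzx
          · rw [hzx, C.pot_mem_self hS hxS]; ring
          · ring
      simp only [this, sum_sub_distrib, ← mul_sum]
      simp
    have h4 := mul_nonneg (mul_nonneg (C.Q_nonneg x) (hpos x))
      (sub_nonneg.2 (C.hitProb_self_le_one hS hxS x))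
    linarith
  have h1 : 7 / 8 * (γ x * ∑ z, C.Q z * C.pot S z x ^ 2) ≤ ∑ z, C.Q z * C.pot S z x * γ z := by
    rw [mul_sum, mul_sum]
    refine sum_le_sum fun z _ => ?_
    have := mul_le_mul_of_nonneg_left (hlow z) (mul_nonneg (C.Q_nonneg z) (C.pot_nonneg hS z x))
    linarith
  have h2 := mul_le_mul_of_nonneg_left h1 hβ.le
  linarith

/-- The region excludes the open discs |ζ| < β and |1 - ζ| < 1 - β, which touch at β. An eigenvalue
at most β/2 is well inside the first, one at least 8β well inside the second. -/
lemma IsLevel.lam_add_le (h : IsLevel C I S β) (hspec : spectrum ℝ (1 - C.P) ⊆ Set.Icc 0 1)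
    (sr : SpectralResolution C I) {ζ : ℂ} (hζ : β ≤ ‖ζ‖) (hζ' : 1 - β ≤ ‖1 - ζ‖)
    (k : {x // x ∉ I}) : sr.lam k + β ≤ 4 * ‖(sr.lam k : ℂ) - ζ‖ := by
  have hβ := h.beta_pos
  have h0 := sr.lam_nonneg k
  have h1 := sr.lam_le_one hspec k
  rcases h.lam_le_or sr k with h2 | h2
  · have h3 := norm_sub_norm_le ζ (sr.lam k : ℂ)
    rw [Complex.norm_real, Real.norm_of_nonneg h0, norm_sub_rev] at h3
    linarith
  · have h3 := norm_sub_norm_le (1 - ζ) (1 - (sr.lam k : ℂ))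
    rw [show (1 : ℂ) - sr.lam k = ((1 - sr.lam k : ℝ) : ℂ) by push_cast; rfl, Complex.norm_real,
      Real.norm_of_nonneg (by linarith)] at h3
    rw [show (1 - ζ) - ((1 - sr.lam k : ℝ) : ℂ) = sr.lam k - ζ by push_cast; ring] at h3
    linarith

/-- A second form of the distance to the spectrum, which keeps the decay in |ζ| needed to integrate
along the whole contour. -/
lemma IsLevel.norm_le (h : IsLevel C I S β) (hspec : spectrum ℝ (1 - C.P) ⊆ Set.Icc 0 1)
    (sr : SpectralResolution C I) {ζ : ℂ} (hζ : β ≤ ‖ζ‖) (hζ' : 1 - β ≤ ‖1 - ζ‖)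
    (k : {x // x ∉ I}) : ‖ζ‖ ≤ 3 * ‖(sr.lam k : ℂ) - ζ‖ := by
  have hβ := h.beta_pos
  have h0 := sr.lam_nonneg k
  have h1 := norm_sub_norm_le ζ (sr.lam k : ℂ)
  rw [Complex.norm_real, Real.norm_of_nonneg h0, norm_sub_rev] at h1
  have h2 := h.lam_add_le hspec sr hζ hζ' k
  rcases h.lam_le_or sr k with h3 | h3
  · linarith
  · have h4 := norm_sub_norm_le (1 - ζ) (1 - (sr.lam k : ℂ))
    rw [show (1 : ℂ) - sr.lam k = ((1 - sr.lam k : ℝ) : ℂ) by push_cast; rfl, Complex.norm_real,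
      Real.norm_of_nonneg (by linarith [sr.lam_le_one hspec k])] at h4
    rw [show (1 - ζ) - ((1 - sr.lam k : ℝ) : ℂ) = sr.lam k - ζ by push_cast; ring] at h4
    linarith

lemma IsLevel.sub_ne_zero (h : IsLevel C I S β) (hspec : spectrum ℝ (1 - C.P) ⊆ Set.Icc 0 1)
    (sr : SpectralResolution C I) {ζ : ℂ} (hζ : β ≤ ‖ζ‖) (hζ' : 1 - β ≤ ‖1 - ζ‖)
    (k : {x // x ∉ I}) : (sr.lam k : ℂ) - ζ ≠ 0 := by
  intro h0
  have h1 := h.lam_add_le hspec sr hζ hζ' k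
  rw [h0, norm_zero, mul_zero] at h1
  linarith [h.beta_pos, sr.lam_nonneg k]

/-- The bound of the resolvent of the Dirichlet operator for `S \ {x}` on the diagonal. -/
def diagBound (C : ReversibleChain Γ) (S : Finset Γ) (β : ℝ) (x : Γ) : ℝ :=
  5 * C.Q x / (β * ∑ z, C.Q z * C.pot S z x ^ 2)

lemma IsLevel.mass_pos (h : IsLevel C I S β) {x : Γ} (hx : x ∈ S) :
    0 < β * ∑ z, C.Q z * C.pot S z x ^ 2 :=
  mul_pos h.beta_pos ((C.Q_pos x).trans_le (Q_le_selfMass h.nonempty' hx))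

lemma IsLevel.diagBound_mul_le (h : IsLevel C I S β) {x : Γ} (hx : x ∈ S \ I) :
    diagBound C S β x * (1 - C.hitProb S x x) ≤ 5 / 32 := by
  have h1 := h.mass_pos (mem_sdiff.1 hx).1
  have h2 := h.escape_le x hx
  rw [diagBound, div_mul_eq_mul_div, div_le_iff₀ h1]
  linarith

/-- The factor 4 of `lam_add_le` and the 8/7 of `mul_greenReal_le` give 32/7 ≤ 5. -/
lemma IsLevel.norm_green_erase_le (h : IsLevel C I S β)
    (hspec : spectrum ℝ (1 - C.P) ⊆ Set.Icc 0 1) {x : Γ} (hx : x ∈ S \ I)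
    (sr : SpectralResolution C (S.erase x)) {ζ : ℂ} (hζ : β ≤ ‖ζ‖) (hζ' : 1 - β ≤ ‖1 - ζ‖) :
    ‖sr.green ζ x x‖ ≤ diagBound C S β x := by
  have h1 := sr.norm_green_self_le x ((h.erase hx).lam_add_le hspec sr hζ hζ') h.beta_pos
  have h2 := h.mul_greenReal_le hx sr
  have h3 := h.mass_pos (mem_sdiff.1 hx).1
  rw [diagBound, le_div_iff₀ h3]
  have h4 := mul_le_mul_of_nonneg_right h1 h3.le
  have := C.Q_pos x
  linarith

lemma IsLevel.four_trace_le (h : IsLevel C I S β) : β * C.greenTrace S ≤ 1 / 4 := by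
  linarith [h.trace_le]

/-- A renewal inequality for the resolvent. -/
lemma IsLevel.norm_green_le (h : IsLevel C I S β)
    (hspec : spectrum ℝ (1 - C.P) ⊆ Set.Icc 0 1) (sr : SpectralResolution C I) {ζ : ℂ}
    (hζ : β ≤ ‖ζ‖) (hζ' : 1 - β ≤ ‖1 - ζ‖) {m : Γ} (hm : m ∈ S \ I) {x : Γ} (hx : x ∈ S \ I) :
    ‖sr.green ζ m x‖ ≤ diagBound C S β x * ((if x = m then 1 else 0) +
      4 / 3 * ∑ z ∈ S.erase x, C.hitProb S x z * ‖sr.green ζ m z‖) := by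
  have hS := h.nonempty'
  have hβ := h.beta_pos
  have hxS := (mem_sdiff.1 hx).1
  have hxI := (mem_sdiff.1 hx).2
  obtain ⟨sx⟩ := nonempty_spectralResolution C (S.erase x)
  set f := sr.green ζ m with hf
  set g := sx.green ζ x with hg
  have hxJ := notMem_erase x S
  have hIJ : I ⊆ S.erase x := fun y hy =>
    mem_erase.2 ⟨fun h' => hxI (h' ▸ hy), h.subset hy⟩
  have hf0 : ∀ y ∈ I, f y = 0 := fun y hy => sr.green_of_mem ζ m hy
  have hg0 : ∀ y ∈ S.erase x, g y = 0 := fun y hy => sx.green_of_mem ζ x hy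
  have hfe : ∀ y ∉ I, (1 - ζ) * f y - C.stepC f y = if y = m then 1 else 0 := fun y hy =>
    sr.green_sub_stepC (h.sub_ne_zero hspec sr hζ hζ') (mem_sdiff.1 hm).2 hy
  have hge : ∀ y ∉ S.erase x, (1 - ζ) * g y - C.stepC g y = if y = x then 1 else 0 :=
    fun y hy => sx.green_sub_stepC ((h.erase hx).sub_ne_zero hspec sx hζ hζ') hxJ hy
  have hgb : ∀ y, ‖g y‖ ≤ 4 / 3 * (‖g x‖ * C.pot S y x) := by
    intro y
    have h1 := C.norm_le_sum_pot hS hβ.le h.four_trace_le hζ' (f := g) (fun y hy => by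
      have := hge y fun h' => hy (mem_of_mem_erase h')
      rw [if_neg (by rintro rfl; exact hy hxS)] at this
      exact sub_eq_zero.1 this) y
    refine h1.trans (le_of_eq ?_)
    rw [sum_eq_single x]
    · ring
    · intro z hz hzx
      rw [hg0 z (mem_erase.2 ⟨hzx, hz⟩), norm_zero, mul_zero]
    · exact fun h' => absurd hxS h'
  -- Green's second identity for the two kernels: g vanishes on S \ {x}, so f enters only through
  -- its values there and at x.
  have hgreen : (C.Q x : ℂ) * f x = (if x = m then (C.Q x : ℂ) * g x else 0) +
      ∑ z ∈ S.erase x, (C.Q z : ℂ) * f z * C.stepC g z := by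
    have h1 := C.sum_mul_stepC f g
    have h2 : ∑ z, (C.Q z : ℂ) * f z * C.stepC g z =
        ∑ z ∈ S.erase x, (C.Q z : ℂ) * f z * C.stepC g z +
          (∑ z, (C.Q z : ℂ) * f z * ((1 - ζ) * g z) - C.Q x * f x) := by
      rw [← sum_add_sum_compl (S.erase x) fun z => (C.Q z : ℂ) * f z * C.stepC g z,
        ← sum_add_sum_compl (S.erase x) fun z => (C.Q z : ℂ) * f z * ((1 - ζ) * g z),
        sum_eq_zero (s := S.erase x) (f := fun z => (C.Q z : ℂ) * f z * ((1 - ζ) * g z))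
          fun z hz => by rw [hg0 z hz]; ring, zero_add]
      congr 1
      have h3 : ∑ z ∈ (S.erase x)ᶜ, (if z = x then (C.Q x : ℂ) * f x else 0) = C.Q x * f x := by
        rw [sum_ite_eq', if_pos (mem_compl.2 hxJ)]
      rw [← h3, ← sum_sub_distrib]
      refine sum_congr rfl fun z hz => ?_
      have h4 := hge z (mem_compl.1 hz)
      split_ifs at h4 ⊢ with hzx
      · subst hzx; linear_combination -(C.Q z : ℂ) * f z * h4
      · linear_combination -(C.Q z : ℂ) * f z * h4
    have h5 : ∑ z, (C.Q z : ℂ) * g z * C.stepC f z =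
        ∑ z, (C.Q z : ℂ) * f z * ((1 - ζ) * g z) - if x = m then (C.Q x : ℂ) * g x else 0 := by
      have h6 : ∑ z, (if z = m then (C.Q z : ℂ) * g z else 0) =
          if x = m then (C.Q x : ℂ) * g x else 0 := by
        rw [sum_ite_eq', if_pos (mem_univ m)]
        split_ifs with hxm
        · rw [hxm]
        · rw [hg0 m (mem_erase.2 ⟨Ne.symm hxm, (mem_sdiff.1 hm).1⟩), mul_zero]
      rw [← h6, ← sum_sub_distrib]
      refine sum_congr rfl fun z _ => ?_
      by_cases hz : z ∈ I
      · rw [hg0 z (hIJ hz)]; simp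
      · have h4 := hfe z hz
        split_ifs at h4 ⊢ with hzm
        · linear_combination -(C.Q z : ℂ) * g z * h4
        · linear_combination -(C.Q z : ℂ) * g z * h4
    linear_combination h2 - h1 - h5
  have hb := h.norm_green_erase_le hspec hx sx hζ hζ'
  have hQ := C.Q_pos x
  have h1 : C.Q x * ‖f x‖ ≤ C.Q x * (‖g x‖ * ((if x = m then 1 else 0) +
      4 / 3 * ∑ z ∈ S.erase x, C.hitProb S x z * ‖f z‖)) := by
    have h2 := congrArg norm hgreen
    rw [norm_mul, Complex.norm_real, Real.norm_of_nonneg hQ.le] at h2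
    rw [h2]
    refine (norm_add_le _ _).trans ?_
    rw [mul_add, mul_add]
    refine add_le_add ?_ ?_
    · split_ifs
      · rw [norm_mul, Complex.norm_real, Real.norm_of_nonneg hQ.le, mul_one]
      · simp
    · refine (norm_sum_le _ _).trans ?_
      rw [mul_sum, mul_sum, mul_sum]
      refine sum_le_sum fun z hz => ?_
      rw [norm_mul, norm_mul, Complex.norm_real, Real.norm_of_nonneg (C.Q_nonneg z)]
      have h3 : ‖C.stepC g z‖ ≤ 4 / 3 * (‖g x‖ * C.hitProb S z x) := by
        refine (C.norm_stepC_le g z).trans ((C.step_mono hgb z).trans (le_of_eq ?_))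
        rw [C.step_mul_left, C.step_mul_left]; rfl
      have h4 := C.Q_mul_hitProb hS hxS (mem_of_mem_erase hz)
      calc C.Q z * ‖f z‖ * ‖C.stepC g z‖
          ≤ C.Q z * ‖f z‖ * (4 / 3 * (‖g x‖ * C.hitProb S z x)) :=
            mul_le_mul_of_nonneg_left h3 (mul_nonneg (C.Q_nonneg z) (norm_nonneg _))
        _ = 4 / 3 * ‖f z‖ * ‖g x‖ * (C.Q z * C.hitProb S z x) := by ring
        _ = _ := by rw [← h4]; ring
  refine (le_of_mul_le_mul_left h1 hQ).trans (mul_le_mul_of_nonneg_right hb ?_)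
  have : 0 ≤ ∑ z ∈ S.erase x, C.hitProb S x z * ‖f z‖ :=
    sum_nonneg fun z _ => mul_nonneg (C.hitProb_nonneg hS x z) (norm_nonneg _)
  positivity

lemma IsLevel.sum_hitProb_norm_nonneg (h : IsLevel C I S β) (f : Γ → ℂ) (x : Γ) :
    0 ≤ ∑ z ∈ S.erase x, C.hitProb S x z * ‖f z‖ :=
  sum_nonneg fun z _ => mul_nonneg (C.hitProb_nonneg h.nonempty' x z) (norm_nonneg _)

lemma IsLevel.one_sub_hitProb_pos (h : IsLevel C I S β) {x : Γ} (hx : x ∈ S \ I) :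
    0 < 1 - C.hitProb S x x := by
  have h1 := h.nonempty_erase (mem_sdiff.1 hx).2
  rw [C.one_sub_hitProb x h1 (mem_sdiff.1 hx).1]
  exact inv_pos.2 (C.pot_self_pos h1 x)

/-- On the resolvent set of the level, the resolvent kernel with pole in `m` is dominated by the
equilibrium potential of `m`. -/
lemma IsLevel.norm_green_le_pot (h : IsLevel C I S β)
    (hspec : spectrum ℝ (1 - C.P) ⊆ Set.Icc 0 1) (sr : SpectralResolution C I) {ζ : ℂ}
    (hζ : β ≤ ‖ζ‖) (hζ' : 1 - β ≤ ‖1 - ζ‖) {m : Γ} (hm : m ∈ S \ I) (y : Γ) :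
    ‖sr.green ζ m y‖ ≤ 4 / 3 * ‖sr.green ζ m m‖ * C.pot (insert m I) y m := by
  have hS := h.nonempty'
  set f := sr.green ζ m with hf
  have hfe : ∀ y ∉ I, (1 - ζ) * f y - C.stepC f y = if y = m then 1 else 0 := fun y hy =>
    sr.green_sub_stepC (h.sub_ne_zero hspec sr hζ hζ') (mem_sdiff.1 hm).2 hy
  have hmI := insert_nonempty m I
  -- The harmonic extension of |f| from S. It dominates |f| up to 4/3, and it remains to see that it
  -- is subharmonic off I ∪ {m}.
  set g : Γ → ℝ := fun y => ∑ x ∈ S, C.pot S y x * ‖f x‖ with hg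
  have hgS : ∀ x ∈ S, g x = ‖f x‖ := by
    intro x hx
    rw [hg]
    beta_reduce
    rw [sum_eq_single x]
    · rw [C.pot_mem_self hS hx, one_mul]
    · intro z _ hzx
      rw [C.pot_mem_ne hS hx hzx.symm, zero_mul]
    · exact fun h' => absurd hx h'
  have hstep : ∀ x, C.step g x = ∑ z ∈ S, C.hitProb S x z * ‖f z‖ := by
    intro x
    have : g = fun y => ∑ x ∈ S, ‖f x‖ * C.pot S y x := by
      funext y
      exact sum_congr rfl fun x _ => mul_comm _ _
    rw [this, C.step_sum]
    simp only [C.step_mul_left]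
    exact sum_congr rfl fun x _ => mul_comm _ _
  have h1 : ‖f y‖ ≤ 4 / 3 * g y :=
    C.norm_le_sum_pot hS h.beta_pos.le h.four_trace_le hζ' (fun y hy => by
      have := hfe y fun h' => hy (h.subset h')
      rw [if_neg (by rintro rfl; exact hy (mem_sdiff.1 hm).1)] at this
      exact sub_eq_zero.1 this) y
  have h2 : g y ≤ ‖f m‖ * C.pot (insert m I) y m := by
    refine C.le_of_sub_step_le hmI (f := g) (g := fun y => ‖f m‖ * C.pot (insert m I) y m)
      (fun x hx => ?_) (fun x hx => ?_) y
    · rcases mem_insert.1 hx with rfl | hxI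
      · rw [hgS x (mem_sdiff.1 hm).1, C.pot_mem_self hmI (mem_insert_self _ _), mul_one]
      · rw [hgS x (h.subset hxI), hf, sr.green_of_mem ζ m hxI, norm_zero]
        exact mul_nonneg (norm_nonneg _) (C.pot_nonneg hmI _ _)
    · rw [mem_insert, not_or] at hx
      rw [C.step_mul_left, ← mul_sub, C.pot_harmonic hmI (by simp [hx]) hx.1, mul_zero]
      -- At a point x of S the renewal inequality gives (1 - hitProb) |f(x)| ≤ (4/3)(5/32) ∑ over
      -- the other points, with a factor below 1. This is subharmonicity of g at x; off S it is
      -- harmonic by construction.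
      by_cases hxS : x ∈ S
      · have hxSI := mem_sdiff.2 ⟨hxS, hx.2⟩
        rw [hgS x hxS, hstep, ← add_sum_erase S _ hxS]
        have h3 := h.norm_green_le hspec sr hζ hζ' hm hxSI
        rw [if_neg hx.1, zero_add] at h3
        have h4 := h.diagBound_mul_le hxSI
        have h5 := h.one_sub_hitProb_pos hxSI
        have h6 := h.sum_hitProb_norm_nonneg f x
        have h7 := mul_le_mul_of_nonneg_right h3 h5.le
        have h8 := mul_le_mul_of_nonneg_right h4 h6
        nlinarith
      · rw [hstep]
        have : g x = ∑ z ∈ S, C.hitProb S x z * ‖f z‖ :=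
          sum_congr rfl fun z hz => by rw [C.hitProb_of_notMem hS hxS hz]
        rw [this, sub_self]
  linarith

/-- The renewal inequality at m itself bounds the kernel by the diagonal bound plus (16/9)(5/32) =
5/18 of itself, and 18/13 ≤ 3/2. -/
lemma IsLevel.norm_green_self_le (h : IsLevel C I S β)
    (hspec : spectrum ℝ (1 - C.P) ⊆ Set.Icc 0 1) (sr : SpectralResolution C I) {ζ : ℂ}
    (hζ : β ≤ ‖ζ‖) (hζ' : 1 - β ≤ ‖1 - ζ‖) {m : Γ} (hm : m ∈ S \ I) :
    ‖sr.green ζ m m‖ ≤ 3 / 2 * diagBound C S β m := by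
  have hS := h.nonempty'
  have hmS := (mem_sdiff.1 hm).1
  have h1 := h.norm_green_le hspec sr hζ hζ' hm hm
  rw [if_pos rfl] at h1
  have h2 : ∑ z ∈ S.erase m, C.hitProb S m z * ‖sr.green ζ m z‖ ≤
      (1 - C.hitProb S m m) * (4 / 3 * ‖sr.green ζ m m‖) := by
    rw [← C.sum_erase_hitProb hS hmS, sum_mul]
    refine sum_le_sum fun z _ => mul_le_mul_of_nonneg_left ?_ (C.hitProb_nonneg hS m z)
    refine (h.norm_green_le_pot hspec sr hζ hζ' hm z).trans ?_
    exact mul_le_of_le_one_right (by positivity)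
      (C.pot_mem_le_one (insert_nonempty m I) z (mem_insert_self m I))
  have h3 := h.diagBound_mul_le hm
  have h4 : 0 ≤ diagBound C S β m :=
    div_nonneg (by have := C.Q_nonneg m; positivity) (h.mass_pos hmS).le
  have h5 := mul_le_mul_of_nonneg_left h2 h4
  have h6 := mul_le_mul_of_nonneg_right h3 (norm_nonneg (sr.green ζ m m))
  nlinarith

/-- The weight `c_k` of the eigenvalue `lam k` in the law of the hitting time of `S`. -/
def SpectralResolution.weight (sr : SpectralResolution C S) (x : Γ) (k : {x // x ∉ S}) : ℝ :=
  sr.fn k x * C.ip (sr.fn k) (fun y => if y ∈ S then 0 else 1)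

/-- The generating function of the law of the hitting time, in the variable `ζ`. -/
def SpectralResolution.genFun (sr : SpectralResolution C S) (x : Γ) (ζ : ℂ) : ℂ :=
  ∑ k, (sr.weight x k * sr.lam k : ℝ) / (sr.lam k - ζ)

/-- The generating function is the resolvent kernel tested against (1 - P) applied to the indicator
of the complement of S, which off S is the probability of entering S in one step. -/
lemma SpectralResolution.mul_genFun (sr : SpectralResolution C S) (x : Γ) (ζ : ℂ) :
    (C.Q x : ℂ) * sr.genFun x ζ = ∑ y, (C.Q y * ((if y ∈ S then 0 else 1) -
      C.step (fun y => if y ∈ S then 0 else 1) y) : ℝ) * sr.green ζ x y := by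
  simp only [genFun, green, mul_sum]
  rw [sum_comm]
  refine sum_congr rfl fun k _ => ?_
  have h1 := sr.ip_fn_sub_step (f := fun y => if y ∈ S then 0 else 1)
    (fun y hy => by simp [hy]) k
  have h2 : sr.weight x k * sr.lam k = sr.fn k x * ∑ y, C.Q y * sr.fn k y *
      ((if y ∈ S then 0 else 1) - C.step (fun y => if y ∈ S then 0 else 1) y) := by
    rw [weight]
    simp only [ip] at h1 ⊢
    rw [h1]; ring
  rw [h2, ← mul_div_assoc, Complex.ofReal_mul, Complex.ofReal_sum, mul_sum, mul_sum, sum_div]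
  refine sum_congr rfl fun y _ => ?_
  push_cast
  ring

/-- The same functional applied to an equilibrium potential gives the capacity Q(m)/T, and so brings
the factor 1/T_1 into all final bounds. -/
lemma sum_mul_pot_insert (hS : S.Nonempty) {m : Γ} (hm : m ∉ S) :
    ∑ y, C.Q y * ((if y ∈ S then 0 else 1) - C.step (fun y => if y ∈ S then 0 else 1) y) *
      C.pot (insert m S) y m = C.Q m / C.pot S m m := by
  have h0 := C.pot_self_pos hS m
  have h1 : ∀ y, C.pot S m m * C.pot (insert m S) y m = C.pot S y m := by
    intro y
    have := C.pot_erase m (S := insert m S) (by rwa [erase_insert hm]) (mem_insert_self m S) y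
    rw [erase_insert hm] at this
    exact this.symm
  rw [eq_div_iff h0.ne', sum_mul]
  have h2 := C.sum_mul_sub_step (fun y => C.pot S y m) (fun y => if y ∈ S then 0 else 1)
  have h3 : ∑ y, C.Q y * (if y ∈ S then 0 else 1) *
      (C.pot S y m - C.step (fun y => C.pot S y m) y) = C.Q m := by
    rw [sum_eq_single m]
    · rw [C.pot_self_sub_step hS hm, if_neg hm]; ring
    · intro y _ hy
      split_ifs with hyS
      · ring
      · rw [C.pot_harmonic hS hyS hy, mul_zero]
    · simp
  rw [h3] at h2
  rw [← h2]
  refine sum_congr rfl fun y _ => ?_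
  rw [← h1 y]; ring

/-- The testing weights are nonnegative where the kernel does not vanish, so a pointwise domination
can be summed. -/
lemma SpectralResolution.norm_genFun_le (sr : SpectralResolution C S) (hS : S.Nonempty) {m : Γ}
    (hm : m ∉ S) {ζ : ℂ} {A : ℝ} (hA : ∀ y, ‖sr.green ζ m y‖ ≤ A * C.pot (insert m S) y m) :
    ‖sr.genFun m ζ‖ ≤ A / C.pot S m m := by
  have hQ := C.Q_pos m
  have h1 := congrArg norm (sr.mul_genFun m ζ)
  rw [norm_mul, Complex.norm_real, Real.norm_of_nonneg hQ.le] at h1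
  refine le_of_mul_le_mul_left ?_ hQ
  rw [h1, show C.Q m * (A / C.pot S m m) = A * (C.Q m / C.pot S m m) by ring,
    ← sum_mul_pot_insert hS hm, mul_sum]
  refine (norm_sum_le _ _).trans (sum_le_sum fun y _ => ?_)
  by_cases hy : y ∈ S
  · rw [sr.green_of_mem ζ m hy, C.pot_mem_ne (insert_nonempty m S) (mem_insert_of_mem hy)
      (by rintro rfl; exact hm hy)]
    simp
  · have h2 : 0 ≤ C.Q y * ((if y ∈ S then 0 else 1) -
        C.step (fun y => if y ∈ S then 0 else 1) y) := by
      refine mul_nonneg (C.Q_nonneg y) ?_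
      have h3 := C.step_mono (f := fun y => if y ∈ S then (0 : ℝ) else 1) (g := fun _ => 1)
        (fun z => by split_ifs <;> norm_num) y
      rw [C.step_const] at h3
      rw [if_neg hy]
      linarith
    rw [norm_mul, Complex.norm_real, Real.norm_of_nonneg h2]
    have := mul_le_mul_of_nonneg_left (hA y) h2
    linarith

lemma IsLevel.norm_genFun_le (h : IsLevel C I S β)
    (hspec : spectrum ℝ (1 - C.P) ⊆ Set.Icc 0 1) (sr : SpectralResolution C I) {ζ : ℂ}
    (hζ : β ≤ ‖ζ‖) (hζ' : 1 - β ≤ ‖1 - ζ‖) {m : Γ} (hm : m ∈ S \ I) :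
    ‖sr.genFun m ζ‖ ≤ 2 * diagBound C S β m / C.pot I m m := by
  refine sr.norm_genFun_le h.nonempty (mem_sdiff.1 hm).2 fun y => ?_
  refine (h.norm_green_le_pot hspec sr hζ hζ' hm y).trans
    (mul_le_mul_of_nonneg_right ?_ (C.pot_nonneg (insert_nonempty m I) y m))
  linarith [h.norm_green_self_le hspec sr hζ hζ' hm]

/-- The variant for the vertical contour, with the kernel on the diagonal bounded by the inverse
distance to the spectrum, of order 1/|ζ|. -/
lemma IsLevel.norm_mul_genFun_le (h : IsLevel C I S β)
    (hspec : spectrum ℝ (1 - C.P) ⊆ Set.Icc 0 1) (sr : SpectralResolution C I) {ζ : ℂ}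
    (hζ : β ≤ ‖ζ‖) (hζ' : 1 - β ≤ ‖1 - ζ‖) {m : Γ} (hm : m ∈ S \ I) :
    ‖sr.genFun m ζ‖ ≤ 4 / ‖ζ‖ / C.pot I m m := by
  have hpos : 0 < ‖ζ‖ := h.beta_pos.trans_le hζ
  refine sr.norm_genFun_le h.nonempty (mem_sdiff.1 hm).2 fun y => ?_
  refine (h.norm_green_le_pot hspec sr hζ hζ' hm y).trans
    (mul_le_mul_of_nonneg_right ?_ (C.pot_nonneg (insert_nonempty m I) y m))
  have h1 := sr.norm_green_self_le_div (mem_sdiff.1 hm).2 (ζ := ζ) (κ := ‖ζ‖ / 3) (by positivity)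
    fun k => by linarith [h.norm_le hspec sr hζ hζ' k]
  rw [show 4 / ‖ζ‖ = 4 / 3 * (1 / (‖ζ‖ / 3)) by field_simp]
  linarith

end Resolvent

/-! ### The sorted list of eigenvalues. -/

section Sorting

lemma getElem_le_iff_lt_countP {l : List ℝ} (hl : l.Pairwise (· ≤ ·)) (a : ℝ) {i : ℕ}
    (hi : i < l.length) : l[i] ≤ a ↔ i < l.countP (· ≤ a) := by
  induction l generalizing i with
  | nil => simp at hi
  | cons x l ih =>
    rw [List.pairwise_cons] at hl
    by_cases hx : x ≤ a
    · rw [List.countP_cons_of_pos (by simpa using hx)]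
      cases i with
      | zero => simpa using hx
      | succ i => simpa using ih hl.2 (by simpa using hi)
    · have h0 : l.countP (· ≤ a) = 0 := by
        rw [List.countP_eq_zero]
        intro y hy
        simpa using (not_le.1 hx).trans_le (hl.1 y hy)
      rw [List.countP_cons_of_neg (by simpa using hx), h0]
      simp only [not_lt_zero, iff_false, not_le]
      cases i with
      | zero => simpa using hx
      | succ i => simpa using (not_le.1 hx).trans_le (hl.1 _ (List.getElem_mem _))

variable {Γ : Type*} [Fintype Γ] [DecidableEq Γ] {C : ReversibleChain Γ} {S : Finset Γ}

namespace SpectralResolution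

variable (sr : SpectralResolution C S)

include sr in
lemma length_sort_roots :
    ((dirichlet C S).charpoly.roots.sort (· ≤ ·)).length = Fintype.card {x // x ∉ S} := by
  rw [Multiset.length_sort, sr.roots]; simp

/-- Turns statements on the j-th eigenvalue into counting statements. Under the bounds on j the
index j - 1 is in range, so the default value of `getD` does not occur. -/
lemma eigenvalue_le_iff {j : ℕ} (h1 : 1 ≤ j) (hj : j ≤ Fintype.card {x // x ∉ S}) (a : ℝ) :
    eigenvalue C S j ≤ a ↔ j ≤ (univ.filter fun k => sr.lam k ≤ a).card := by
  have hlen := sr.length_sort_roots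
  have hlt : j - 1 < ((dirichlet C S).charpoly.roots.sort (· ≤ ·)).length := by omega
  have hcount : ((dirichlet C S).charpoly.roots.sort (· ≤ ·)).countP (· ≤ a) =
      (univ.filter fun k => sr.lam k ≤ a).card := by
    rw [← Multiset.coe_countP, Multiset.sort_eq, sr.roots, Multiset.countP_map]
    rfl
  rw [eigenvalue, List.getD_eq_getElem _ _ hlt,
    getElem_le_iff_lt_countP (Multiset.pairwise_sort _ _) a hlt, hcount]
  omega

lemma exists_lam_eq_eigenvalue {j : ℕ} (h1 : 1 ≤ j) (hj : j ≤ Fintype.card {x // x ∉ S}) :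
    ∃ k, sr.lam k = eigenvalue C S j := by
  have hlen := sr.length_sort_roots
  have hlt : j - 1 < ((dirichlet C S).charpoly.roots.sort (· ≤ ·)).length := by omega
  have h2 : eigenvalue C S j ∈ (dirichlet C S).charpoly.roots := by
    rw [eigenvalue, List.getD_eq_getElem _ _ hlt, ← Multiset.mem_sort (· ≤ ·)]
    exact List.getElem_mem _
  rw [sr.roots, Multiset.mem_map] at h2
  obtain ⟨k, -, hk⟩ := h2
  exact ⟨k, hk⟩

lemma card_filter_le (a : ℝ) :
    (univ.filter fun k => sr.lam k ≤ a).card ≤ Fintype.card {x // x ∉ S} :=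
  card_le_univ _

end SpectralResolution

end Sorting

/-! ### Residues, Fourier integrals and contour estimates. -/

section ComplexAnalysis

open Complex

lemma hasResidueAt_of_eventually_eq {f ψ : ℂ → ℂ} {z : ℂ} (hψ : AnalyticAt ℂ ψ z)
    (h : ∀ᶠ w in 𝓝[≠] z, f w = (w - z)⁻¹ * ψ w) : HasResidueAt f z (ψ z) := by
  rw [eventually_nhdsWithin_iff] at h
  obtain ⟨r, hr, hball⟩ := Metric.eventually_nhds_iff_ball.1 (h.and hψ.eventually_analyticAt)
  have : ∀ᶠ ρ in 𝓝[>] (0 : ℝ), ρ ∈ Set.Ioo 0 r := Ioo_mem_nhdsGT hr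
  filter_upwards [this] with ρ hρ
  have hsub : Metric.closedBall z ρ ⊆ Metric.ball z r := Metric.closedBall_subset_ball hρ.2
  have hd : DifferentiableOn ℂ ψ (Metric.closedBall z ρ) := fun w hw =>
    (hball w (hsub hw)).2.differentiableAt.differentiableWithinAt
  have hne : ∀ w ∈ Metric.sphere z ρ, w ≠ z := fun w hw h' => by
    rw [h', Metric.mem_sphere, dist_self] at hw
    exact hρ.1.ne hw
  have heq : Set.EqOn f (fun w => (w - z)⁻¹ • ψ w) (Metric.sphere z ρ) := fun w hw =>
    (hball w (hsub (Metric.sphere_subset_closedBall hw))).1 (hne w hw)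
  constructor
  · refine ContinuousOn.circleIntegrable hρ.1.le (ContinuousOn.congr ?_ heq)
    have h1 : ContinuousOn (fun w : ℂ => (w - z)⁻¹) (Metric.sphere z ρ) :=
      ContinuousOn.inv₀ (by fun_prop) fun w hw => sub_ne_zero.2 (hne w hw)
    exact h1.smul (hd.continuousOn.mono Metric.sphere_subset_closedBall)
  · rw [circleIntegral.integral_congr hρ.1.le heq]
    exact (hd.diffContOnCl_ball subset_rfl).circleIntegral_sub_inv_smul
      (Metric.mem_ball_self hρ.1)

lemma hasResidueAt_sum_div_one_sub_exp {ι : Type*} [Fintype ι] [DecidableEq ι] (c p : ι → ℝ)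
    (k₀ : ι) (hpos : 0 < p k₀) (hne : ∀ k, k ≠ k₀ → p k ≠ p k₀) :
    HasResidueAt (fun u => ∑ k, (c k : ℂ) / (1 - cexp u * p k)) (-Real.log (p k₀) : ℝ)
      (-c k₀) := by
  set z : ℂ := ((-Real.log (p k₀) : ℝ) : ℂ) with hz
  have hez : cexp z = ((p k₀)⁻¹ : ℝ) := by
    rw [hz, ← Complex.ofReal_exp, Real.exp_neg, Real.exp_log hpos]
  set g : ℂ → ℂ := fun w => cexp w * p k₀ with hg
  have hgz : g z = 1 := by
    rw [hg]; beta_reduce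
    rw [hez, ← Complex.ofReal_mul, inv_mul_cancel₀ hpos.ne', Complex.ofReal_one]
  have hgd : Differentiable ℂ g := by fun_prop
  have hdg : deriv g z = 1 := by
    have : HasDerivAt g (cexp z * p k₀) z := (Complex.hasDerivAt_exp z).mul_const _
    rw [this.deriv]; exact hgz
  -- Since g(z) = g'(z) = 1, the denominator is -(w - z) φ(w) with φ(z) = 1, which gives a simple
  -- pole with residue -c; the other terms are analytic because their p_k differ.
  set φ := dslope g z with hφ
  have hφz : φ z = 1 := by rw [hφ, dslope_same, hdg]
  have hφa : AnalyticAt ℂ φ z := by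
    have : DifferentiableOn ℂ φ Set.univ :=
      (differentiableOn_dslope univ_mem).2 hgd.differentiableOn
    exact this.analyticAt univ_mem
  have hφw : ∀ w, (w - z) * φ w = g w - 1 := fun w => by
    rw [← hgz, ← smul_eq_mul]; exact sub_smul_dslope g z w
  set ψ : ℂ → ℂ := fun w => -(c k₀ : ℂ) / φ w +
    (w - z) * ∑ k ∈ univ.erase k₀, (c k : ℂ) / (1 - cexp w * p k) with hψ
  have hψz : ψ z = -c k₀ := by
    rw [hψ]; beta_reduce
    rw [sub_self, zero_mul, add_zero, hφz, div_one]
  rw [← hψz]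
  refine hasResidueAt_of_eventually_eq ?_ ?_
  · refine (analyticAt_const.div hφa (by rw [hφz]; exact one_ne_zero)).add
      ((analyticAt_id.sub analyticAt_const).mul ?_)
    refine Finset.analyticAt_fun_sum _ fun k hk => ?_
    refine analyticAt_const.div
      (analyticAt_const.sub (analyticAt_cexp.mul analyticAt_const)) ?_
    rw [hez, ← Complex.ofReal_mul, ← Complex.ofReal_one, ← Complex.ofReal_sub]
    rw [Complex.ofReal_ne_zero, sub_ne_zero]
    intro h
    refine hne k (ne_of_mem_erase hk) ?_
    field_simp at h
    exact h.symm
  · have h1 : ∀ᶠ w in 𝓝[≠] z, φ w ≠ 0 :=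
      (hφa.continuousAt.eventually_ne (by rw [hφz]; exact one_ne_zero)).filter_mono
        nhdsWithin_le_nhds
    filter_upwards [h1, self_mem_nhdsWithin] with w hw hwz
    have hwz' : w - z ≠ 0 := sub_ne_zero.2 hwz
    rw [← add_sum_erase univ _ (mem_univ k₀), hψ]
    beta_reduce
    rw [mul_add, ← mul_assoc, inv_mul_cancel₀ hwz', one_mul]
    congr 1
    have h2 : 1 - cexp w * p k₀ = -((w - z) * φ w) := by rw [hφw, hg]; ring
    rw [h2]
    field_simp

lemma circleIntegral_pow_div_sub (q : ℝ) (hq0 : 0 ≤ q) (hq : q ≠ 1) (t : ℕ) :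
    (∮ w in C(0, 1), (w - q)⁻¹ • w ^ t) =
      if q < 1 then 2 * Real.pi * I * (q : ℂ) ^ t else 0 := by
  split_ifs with h
  · have hd : DiffContOnCl ℂ (fun w : ℂ => w ^ t) (Metric.ball 0 1) :=
      (differentiable_pow t).diffContOnCl
    rw [hd.circleIntegral_sub_inv_smul (by simpa [abs_of_nonneg hq0] using h), smul_eq_mul]
  · have hq1 : 1 < q := lt_of_le_of_ne (not_lt.1 h) hq.symm
    have hne : ∀ w ∈ Metric.closedBall (0 : ℂ) 1, w - q ≠ 0 := by
      intro w hw h0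
      rw [mem_closedBall_zero_iff, sub_eq_zero.1 h0, Complex.norm_real, Real.norm_of_nonneg hq0]
        at hw
      linarith
    refine Complex.circleIntegral_eq_zero_of_differentiable_on_off_countable zero_le_one
      Set.countable_empty ?_ fun w hw => ?_
    · have h1 : ContinuousOn (fun w : ℂ => (w - q)⁻¹) (Metric.closedBall 0 1) :=
        ContinuousOn.inv₀ (by fun_prop) hne
      exact h1.smul (by fun_prop)
    · have h1 : DifferentiableAt ℂ (fun w : ℂ => (w - q)⁻¹) w :=
        DifferentiableAt.inv (by fun_prop) (hne w (Metric.ball_subset_closedBall hw.1))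
      exact h1.smul (by fun_prop)

/-- A Fourier coefficient of a geometric function, computed as a Cauchy integral over the unit
circle. For q > 1 the expansion has only the opposite frequencies, so nothing of order t ≥ 0
survives. -/
lemma integral_exp_div_one_sub (q : ℝ) (hq0 : 0 ≤ q) (hq : q ≠ 1) (t : ℕ) :
    ∫ v in (-Real.pi)..Real.pi, cexp (-(t * (v * I))) * (1 / (1 - q * cexp (v * I))) =
      if q < 1 then 2 * Real.pi * (q : ℂ) ^ t else 0 := by
  set G : ℝ → ℂ := fun v => cexp (t * (v * I)) * (1 / (1 - q * cexp (-(v * I)))) with hG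
  have h1 : ∫ v in (-Real.pi)..Real.pi, cexp (-(t * (v * I))) * (1 / (1 - q * cexp (v * I))) =
      ∫ v in (-Real.pi)..Real.pi, G v := by
    have := intervalIntegral.integral_comp_neg (a := -Real.pi) (b := Real.pi) G
    rw [neg_neg] at this
    rw [← this]
    refine intervalIntegral.integral_congr fun v _ => ?_
    simp only [hG]
    push_cast
    ring_nf
  have hper : Function.Periodic G (2 * Real.pi) := by
    intro v
    have e1 : cexp ((v + 2 * Real.pi) * I) = cexp (v * I) := by
      rw [add_mul]; exact Complex.exp_periodic _
    simp only [hG]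
    push_cast
    rw [Complex.exp_neg, Complex.exp_nat_mul, e1, Complex.exp_neg, Complex.exp_nat_mul]
  have h2 : ∫ v in (-Real.pi)..Real.pi, G v = ∫ v in (0)..(2 * Real.pi), G v := by
    have := hper.intervalIntegral_add_eq (-Real.pi) 0
    rwa [zero_add, show -Real.pi + 2 * Real.pi = Real.pi by ring] at this
  have h3 : (∮ w in C(0, 1), (w - q)⁻¹ • w ^ t) = I * ∫ v in (0)..(2 * Real.pi), G v := by
    rw [circleIntegral, ← intervalIntegral.integral_const_mul]
    refine intervalIntegral.integral_congr fun v _ => ?_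
    simp only [hG, deriv_circleMap, circleMap, zero_add, Complex.ofReal_one, one_mul, smul_eq_mul]
    rw [← Complex.exp_nat_mul]
    have e0 : cexp (v * I) ≠ 0 := Complex.exp_ne_zero _
    have e1 : (1 : ℂ) - q * cexp (-(v * I)) = (cexp (v * I) - q) * (cexp (v * I))⁻¹ := by
      rw [sub_mul, mul_inv_cancel₀ e0, Complex.exp_neg]
    rw [e1, one_div, mul_inv, inv_inv]
    ring
  rw [h1, h2]
  rw [circleIntegral_pow_div_sub q hq0 hq t] at h3
  have hI : I * (∫ v in (0)..(2 * Real.pi), G v) =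
      I * if q < 1 then 2 * Real.pi * (q : ℂ) ^ t else 0 := by
    rw [← h3]
    split_ifs <;> ring
  exact mul_left_cancel₀ Complex.I_ne_zero hI

lemma integral_inv_sq_add_sq_le {α : ℝ} (hα : 0 < α) :
    ∫ v in (-Real.pi)..Real.pi, (α ^ 2 + v ^ 2)⁻¹ ≤ Real.pi / α := by
  have hd : ∀ v : ℝ, HasDerivAt (fun v => α⁻¹ * Real.arctan (v / α)) ((α ^ 2 + v ^ 2)⁻¹) v := by
    intro v
    have h1 := (((hasDerivAt_id v).div_const α).arctan).const_mul α⁻¹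
    refine h1.congr_deriv ?_
    have : 0 < α ^ 2 + v ^ 2 := by positivity
    simp only [id]
    field_simp
  rw [intervalIntegral.integral_eq_sub_of_hasDerivAt (fun v _ => hd v)]
  · have h1 := Real.arctan_lt_pi_div_two (Real.pi / α)
    have h2 := Real.neg_pi_div_two_lt_arctan (-Real.pi / α)
    rw [← mul_sub, mul_comm, ← div_eq_mul_inv]
    exact div_le_div_of_nonneg_right (by linarith) hα.le
  · refine Continuous.intervalIntegrable (Continuous.inv₀ (by fun_prop) fun v => ?_) _ _
    positivity

lemma integrable_inv_sq_add_sq {α : ℝ} (hα : 0 < α) :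
    IntervalIntegrable (fun v : ℝ => (α ^ 2 + v ^ 2)⁻¹) volume (-Real.pi) Real.pi := by
  refine Continuous.intervalIntegrable (Continuous.inv₀ (by fun_prop) fun v => ?_) _ _
  positivity

/-- The contour `ζ = 1 - e^{-u}`, `u = α + i v`, stays away from the origin. -/
lemma sq_add_sq_le_norm_sq {α : ℝ} (hα0 : 0 < α) (hα : α ≤ 1 / 8) {v : ℝ} (hv : |v| ≤ Real.pi) :
    (α ^ 2 + v ^ 2) / 4 ≤ ‖1 - cexp (-(v * I + α))‖ ^ 2 := by
  have he : cexp (-(v * I + α)) = ((Real.exp (-α) * Real.cos v : ℝ) : ℂ) -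
      ((Real.exp (-α) * Real.sin v : ℝ) : ℂ) * I := by
    rw [show -(v * I + (α : ℂ)) = ((-α : ℝ) : ℂ) + ((-v : ℝ) : ℂ) * I by push_cast; ring,
      Complex.exp_add, Complex.exp_mul_I, ← Complex.ofReal_exp, ← Complex.ofReal_cos,
      ← Complex.ofReal_sin, Real.cos_neg, Real.sin_neg]
    push_cast; ring
  have hn : ‖1 - cexp (-(v * I + α))‖ ^ 2 =
      (1 - Real.exp (-α) * Real.cos v) ^ 2 + (Real.exp (-α) * Real.sin v) ^ 2 := by
    rw [he, show (1 : ℂ) - (((Real.exp (-α) * Real.cos v : ℝ) : ℂ) -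
      ((Real.exp (-α) * Real.sin v : ℝ) : ℂ) * I) = ((1 - Real.exp (-α) * Real.cos v : ℝ) : ℂ) +
      ((Real.exp (-α) * Real.sin v : ℝ) : ℂ) * I by push_cast; ring, Complex.sq_norm,
      Complex.normSq_add_mul_I]
  set s := Real.exp (-α) with hs
  have hs1 : 7 / 8 ≤ s := by have := Real.add_one_le_exp (-α); linarith
  have hs2 : s ≤ 1 - α / 2 := by
    have h2 : s ≤ 1 / (1 + α) := by
      rw [hs, Real.exp_neg, one_div]
      exact inv_anti₀ (by linarith) (by have := Real.add_one_le_exp α; linarith)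
    refine h2.trans ?_
    rw [div_le_iff₀ (by linarith)]
    nlinarith
  have hcos := Real.cos_le_one_sub_mul_cos_sq hv
  have hpi : 1 / 7 * v ^ 2 ≤ 2 / Real.pi ^ 2 * v ^ 2 := by
    refine mul_le_mul_of_nonneg_right ?_ (sq_nonneg v)
    have h3 : Real.pi < 3.15 := Real.pi_lt_d2
    have h4 : Real.pi ^ 2 ≤ 14 := by nlinarith [Real.pi_pos]
    rw [div_le_div_iff₀ (by norm_num) (by have := Real.pi_pos; positivity)]
    linarith
  have hsc := Real.sin_sq_add_cos_sq v
  rw [hn]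
  have h5 : (1 - s * Real.cos v) ^ 2 + (s * Real.sin v) ^ 2 =
      (1 - s) ^ 2 + 2 * s * (1 - Real.cos v) := by
    linear_combination s ^ 2 * hsc
  rw [h5]
  have h6 : 1 / 7 * v ^ 2 ≤ 1 - Real.cos v := by linarith
  have h7 : (α / 2) ^ 2 ≤ (1 - s) ^ 2 := by
    apply pow_le_pow_left₀ <;> linarith
  have h8 : 7 / 8 * (1 / 7 * v ^ 2) ≤ s * (1 - Real.cos v) :=
    mul_le_mul hs1 h6 (by positivity) (by linarith)
  nlinarith

lemma hasSum_exp_mul_sum {ι : Type*} [Fintype ι] (c p : ι → ℝ) {u : ℂ}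
    (h : ∀ k, ‖cexp u * p k‖ < 1) :
    HasSum (fun t : ℕ => cexp (u * t) * ((∑ k, c k * p k ^ t : ℝ) : ℂ))
      (∑ k, (c k : ℂ) / (1 - cexp u * p k)) := by
  have h1 : HasSum (fun t : ℕ => ∑ k, (c k : ℂ) * (cexp u * p k) ^ t)
      (∑ k, (c k : ℂ) / (1 - cexp u * p k)) := by
    refine hasSum_sum fun k _ => ?_
    rw [div_eq_mul_inv]
    exact (hasSum_geometric_of_norm_lt_one (h k)).mul_left _
  convert h1 using 2 with t
  rw [mul_comm u, Complex.exp_nat_mul, Complex.ofReal_sum, mul_sum]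
  refine sum_congr rfl fun k _ => ?_
  push_cast
  ring

lemma meromorphic_sum_div_one_sub_exp {ι : Type*} [Fintype ι] (c p : ι → ℝ) :
    Meromorphic fun u => ∑ k, (c k : ℂ) / (1 - cexp u * p k) := by
  intro z
  refine MeromorphicAt.fun_sum fun k _ => ?_
  exact (MeromorphicAt.const _ _).div
    ((MeromorphicAt.const _ _).sub (analyticAt_cexp.meromorphicAt.mul (MeromorphicAt.const _ _)))

/-- Residue theorem for `(∑ c_k λ_k / (λ_k - ζ)) / ζ` on a circle around the origin. -/
lemma norm_one_sub_sum_le {ι : Type*} [Fintype ι] (c l : ι → ℝ) (hc : ∑ k, c k = 1)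
    (hl : ∀ k, 0 ≤ l k) {r A : ℝ} (hr : 0 < r) (hlr : ∀ k, l k ≠ r)
    (hA : ∀ ζ : ℂ, ‖ζ‖ = r → ‖∑ k, (c k * l k : ℝ) / (l k - ζ)‖ ≤ A) :
    |1 - ∑ k ∈ univ.filter fun k => l k < r, c k| ≤ A := by
  have hne : ∀ ζ ∈ Metric.sphere (0 : ℂ) r, ζ ≠ 0 ∧ ∀ k, (l k : ℂ) - ζ ≠ 0 := by
    intro ζ hζ
    rw [mem_sphere_zero_iff_norm] at hζ
    refine ⟨fun h => ?_, fun k h => ?_⟩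
    · rw [h, norm_zero] at hζ; exact hr.ne hζ
    · rw [← sub_eq_zero.1 h, Complex.norm_real, Real.norm_of_nonneg (hl k)] at hζ
      exact hlr k hζ
  -- Partial fractions λ/(ζ(λ - ζ)) = 1/ζ - 1/(ζ - λ), summed with total weight 1. The eigenvalues
  -- inside the circle then contribute their weights.
  have heq : Set.EqOn (fun ζ : ℂ => ζ⁻¹ * ∑ k, (c k * l k : ℝ) / (l k - ζ))
      (fun ζ => ζ⁻¹ - ∑ k, (c k : ℂ) • (ζ - l k)⁻¹) (Metric.sphere 0 r) := by
    intro ζ hζ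
    obtain ⟨h0, h1⟩ := hne ζ hζ
    have hc' : ζ⁻¹ = ∑ k, (c k : ℂ) * ζ⁻¹ := by
      rw [← sum_mul, ← Complex.ofReal_sum, hc, Complex.ofReal_one, one_mul]
    beta_reduce
    nth_rw 2 [hc']
    rw [← sum_sub_distrib, mul_sum]
    refine sum_congr rfl fun k _ => ?_
    have h2 := h1 k
    have h3 : ζ - l k ≠ 0 := by rw [← neg_sub]; exact neg_ne_zero.2 h2
    rw [smul_eq_mul]
    push_cast
    field_simp
    ring
  have hint : (∮ ζ in C(0, r), ζ⁻¹ * ∑ k, (c k * l k : ℝ) / (l k - ζ)) =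
      2 * Real.pi * I * (1 - ∑ k ∈ univ.filter fun k => l k < r, c k : ℝ) := by
    rw [circleIntegral.integral_congr hr.le heq]
    have hci : ∀ k, CircleIntegrable (fun ζ : ℂ => (c k : ℂ) • (ζ - l k)⁻¹) 0 r := by
      intro k
      have h1 : ContinuousOn (fun ζ : ℂ => (ζ - l k)⁻¹) (Metric.sphere 0 r) :=
        ContinuousOn.inv₀ (by fun_prop) fun ζ hζ => by
          rw [← neg_sub]; exact neg_ne_zero.2 ((hne ζ hζ).2 k)
      have h2 : ContinuousOn (fun ζ : ℂ => (c k : ℂ) • (ζ - l k)⁻¹) (Metric.sphere 0 r) :=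
        h1.const_smul (c k : ℂ)
      exact h2.circleIntegrable hr.le
    have hci0 : CircleIntegrable (fun ζ : ℂ => ζ⁻¹) 0 r :=
      ContinuousOn.circleIntegrable hr.le
        (ContinuousOn.inv₀ (by fun_prop) fun ζ hζ => (hne ζ hζ).1)
    rw [circleIntegral.integral_sub hci0 (CircleIntegrable.fun_sum _ fun k _ => hci k),
      circleIntegral.integral_fun_sum fun k _ => hci k]
    have h0 : (∮ ζ in C(0, r), ζ⁻¹) = 2 * Real.pi * I := by
      have := circleIntegral.integral_sub_inv_of_mem_ball (c := 0) (w := 0) (R := r)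
        (Metric.mem_ball_self hr)
      simpa using this
    have h1 : ∀ k, (∮ ζ in C(0, r), (c k : ℂ) • (ζ - l k)⁻¹) =
        2 * Real.pi * I * (if l k < r then c k else 0 : ℝ) := by
      intro k
      rw [circleIntegral.integral_smul]
      split_ifs with hk
      · rw [circleIntegral.integral_sub_inv_of_mem_ball
          (by simpa [abs_of_nonneg (hl k)] using hk), smul_eq_mul]
        ring
      · rw [Complex.circleIntegral_eq_zero_of_differentiable_on_off_countable hr.le
          Set.countable_empty]
        · simp
        all_goals
          have hk' : r < l k := lt_of_le_of_ne (not_lt.1 hk) (hlr k).symm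
          have hne' : ∀ w ∈ Metric.closedBall (0 : ℂ) r, w - l k ≠ 0 := by
            intro w hw h0
            rw [mem_closedBall_zero_iff, sub_eq_zero.1 h0, Complex.norm_real,
              Real.norm_of_nonneg (hl k)] at hw
            linarith
        · exact ContinuousOn.inv₀ (by fun_prop) hne'
        · exact fun w hw => DifferentiableAt.inv (by fun_prop)
            (hne' w (Metric.ball_subset_closedBall hw.1))
    rw [h0]
    simp only [h1]
    rw [← mul_sum, ← Complex.ofReal_sum, ← sum_filter]
    push_cast
    ring
  have hb := circleIntegral.norm_integral_le_of_norm_le_const hr.le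
    (f := fun ζ : ℂ => ζ⁻¹ * ∑ k, (c k * l k : ℝ) / (l k - ζ)) (c := 0) (C := r⁻¹ * A)
    fun ζ hζ => by
      rw [mem_sphere_zero_iff_norm] at hζ
      rw [norm_mul, norm_inv, hζ]
      exact mul_le_mul_of_nonneg_left (hA ζ hζ) (inv_nonneg.2 hr.le)
  rw [hint, norm_mul, Complex.norm_real, Real.norm_eq_abs] at hb
  have hpi := Real.pi_pos
  have h2 : ‖(2 * Real.pi * I : ℂ)‖ = 2 * Real.pi := by
    simp [abs_of_pos hpi]
  rw [h2, show 2 * Real.pi * r * (r⁻¹ * A) = 2 * Real.pi * A by field_simp] at hb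
  exact le_of_mul_le_mul_left hb (by positivity)

/-! ### The integral over the line Re u = α. -/

section Remainder

variable {ι : Type*} [Fintype ι] {c p : ι → ℝ} {α : ℝ}

lemma one_sub_exp_ne_zero {q : ℝ} (hq0 : 0 ≤ q) (hq : q ≠ 1) (v : ℝ) :
    (1 : ℂ) - q * cexp (v * I) ≠ 0 := by
  intro h
  have h1 := congrArg norm (sub_eq_zero.1 h)
  rw [norm_one, norm_mul, Complex.norm_exp_ofReal_mul_I, mul_one, Complex.norm_real,
    Real.norm_of_nonneg hq0] at h1
  exact hq h1.symm

lemma continuous_one_div_one_sub_exp {q : ℝ} (hq0 : 0 ≤ q) (hq : q ≠ 1) :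
    Continuous fun v : ℝ => 1 / (1 - (q : ℂ) * cexp (v * I)) :=
  Continuous.div (by fun_prop) (by fun_prop) (one_sub_exp_ne_zero hq0 hq)

lemma sum_div_one_sub_exp_line (v : ℝ) :
    ∑ k, (c k : ℂ) / (1 - cexp (v * I + α) * p k) =
      ∑ k, (c k : ℂ) * (1 / (1 - ((Real.exp α * p k : ℝ) : ℂ) * cexp (v * I))) := by
  refine sum_congr rfl fun k _ => ?_
  rw [Complex.exp_add, mul_one_div]
  push_cast
  ring_nf

lemma continuous_sum_line (hp : ∀ k, 0 ≤ p k) (hq : ∀ k, Real.exp α * p k ≠ 1) :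
    Continuous fun v : ℝ => ∑ k, (c k : ℂ) / (1 - cexp (v * I + α) * p k) := by
  simp only [sum_div_one_sub_exp_line]
  exact continuous_finsetSum _ fun k _ => continuous_const.mul
    (continuous_one_div_one_sub_exp (mul_nonneg (Real.exp_pos α).le (hp k)) (hq k))

lemma remainder_sum (hp : ∀ k, 0 ≤ p k) (hq : ∀ k, Real.exp α * p k ≠ 1) (t : ℕ) :
    remainder (fun u => ∑ k, (c k : ℂ) / (1 - cexp u * p k)) α t =
      ∑ k, (c k : ℂ) * if Real.exp α * p k < 1 then ((Real.exp α * p k : ℝ) : ℂ) ^ t else 0 := by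
  have hq0 : ∀ k, 0 ≤ Real.exp α * p k := fun k => mul_nonneg (Real.exp_pos α).le (hp k)
  have hpi : (2 * Real.pi : ℂ) ≠ 0 := by
    exact_mod_cast (mul_pos two_pos Real.pi_pos).ne'
  rw [remainder]
  simp only [sum_div_one_sub_exp_line, mul_sum]
  rw [intervalIntegral.integral_finsetSum, mul_sum]
  · refine sum_congr rfl fun k _ => ?_
    have h1 := integral_exp_div_one_sub _ (hq0 k) (hq k) t
    rw [← mul_right_inj' hpi, mul_inv_cancel_left₀ hpi]
    calc _ = ∫ v in (-Real.pi)..Real.pi, (c k : ℂ) * (cexp (-(t * (v * I))) *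
          (1 / (1 - ((Real.exp α * p k : ℝ) : ℂ) * cexp (v * I)))) := by
          refine intervalIntegral.integral_congr fun v _ => ?_
          ring
      _ = _ := by
          rw [intervalIntegral.integral_const_mul, h1]
          split_ifs <;> ring
  · intro k _
    refine Continuous.intervalIntegrable ?_ _ _
    have := continuous_one_div_one_sub_exp (hq0 k) (hq k)
    fun_prop

/-- L itself is of order 1/|ζ| and not small. Subtracting 1/(1 - e^{α + iv}) does not change the
integral, since e^α > 1, and leaves (1 - ζ)/ζ times the generating function; this is at most B/|ζ|²,
whose integral is of order B/α. -/
lemma norm_remainder_le (hc : ∑ k, c k = 1) (hp : ∀ k, 0 ≤ p k)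
    (hq : ∀ k, Real.exp α * p k ≠ 1) (hα0 : 0 < α) (hα : α ≤ 1 / 8) {B : ℝ} (hB0 : 0 ≤ B)
    (hB : ∀ v : ℝ, ‖∑ k, (c k * (1 - p k) : ℝ) / (((1 - p k : ℝ) : ℂ) - (1 - cexp (-(v * I + α))))‖ ≤
      B / ‖1 - cexp (-(v * I + α))‖) (t : ℕ) :
    ‖remainder (fun u => ∑ k, (c k : ℂ) / (1 - cexp u * p k)) α t‖ ≤ 2 * B / α := by
  have hq0 : ∀ k, 0 ≤ Real.exp α * p k := fun k => mul_nonneg (Real.exp_pos α).le (hp k)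
  have hα1 : 1 < Real.exp α := by simpa using hα0
  have h0 := integral_exp_div_one_sub _ (Real.exp_pos α).le hα1.ne' t
  rw [if_neg (not_lt.2 hα1.le)] at h0
  have hcL := continuous_sum_line (c := c) hp hq
  have hc1 := continuous_one_div_one_sub_exp (Real.exp_pos α).le hα1.ne'
  have h1 : remainder (fun u => ∑ k, (c k : ℂ) / (1 - cexp u * p k)) α t =
      (2 * Real.pi : ℂ)⁻¹ * ∫ v in (-Real.pi)..Real.pi, cexp (-(t * (v * I))) *
        (∑ k, (c k : ℂ) / (1 - cexp (v * I + α) * p k) -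
          1 / (1 - (Real.exp α : ℂ) * cexp (v * I))) := by
    simp only [mul_sub]
    rw [intervalIntegral.integral_sub, h0, sub_zero, remainder]
    · exact Continuous.intervalIntegrable (by fun_prop) _ _
    · exact Continuous.intervalIntegrable (by fun_prop) _ _
  have hpt : ∀ v : ℝ, |v| ≤ Real.pi → ‖cexp (-(t * (v * I))) *
      (∑ k, (c k : ℂ) / (1 - cexp (v * I + α) * p k) -
        1 / (1 - (Real.exp α : ℂ) * cexp (v * I)))‖ ≤ 4 * B * (α ^ 2 + v ^ 2)⁻¹ := by
    intro v hv
    set ζ : ℂ := 1 - cexp (-(v * I + α)) with hζ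
    have hz := sq_add_sq_le_norm_sq hα0 hα hv
    rw [← hζ] at hz
    have hpos : 0 < α ^ 2 + v ^ 2 := by positivity
    have hζ0 : 0 < ‖ζ‖ := by
      refine (norm_nonneg _).lt_of_ne fun h => ?_
      rw [← h] at hz
      nlinarith
    have he : cexp (v * I + α) = (1 - ζ)⁻¹ := by rw [hζ, sub_sub_cancel, ← Complex.exp_neg, neg_neg]
    have he0 : (1 : ℂ) - ζ ≠ 0 := by rw [hζ, sub_sub_cancel]; exact Complex.exp_ne_zero _
    have hne : ∀ k, ((1 - p k : ℝ) : ℂ) - ζ ≠ 0 := by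
      intro k h2
      have h3 : cexp (v * I + α) * p k = 1 := by
        rw [he, inv_mul_eq_one₀ he0]
        push_cast at h2
        linear_combination h2
      have h4 := one_sub_exp_ne_zero (hq0 k) (hq k) v
      apply h4
      rw [Complex.exp_add] at h3
      push_cast
      linear_combination -h3
    have hid : ∑ k, (c k : ℂ) / (1 - cexp (v * I + α) * p k) -
        1 / (1 - (Real.exp α : ℂ) * cexp (v * I)) =
        (1 - ζ) / ζ * ∑ k, (c k * (1 - p k) : ℝ) / (((1 - p k : ℝ) : ℂ) - ζ) := by
      have h2 : (Real.exp α : ℂ) * cexp (v * I) = (1 - ζ)⁻¹ := by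
        rw [← he, Complex.exp_add, Complex.ofReal_exp]; ring
      have h3 : (1 : ℂ) / (1 - (1 - ζ)⁻¹) = ∑ k, (c k : ℂ) * (1 / (1 - (1 - ζ)⁻¹)) := by
        rw [← sum_mul, ← Complex.ofReal_sum, hc, Complex.ofReal_one, one_mul]
      rw [h2, h3, he, mul_sum, ← sum_sub_distrib]
      refine sum_congr rfl fun k _ => ?_
      have hk := hne k
      have hζn : ζ ≠ 0 := norm_pos_iff.1 hζ0
      have e1 : (1 : ℂ) - (1 - ζ)⁻¹ = -ζ / (1 - ζ) := by field_simp; ring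
      have e2 : (1 : ℂ) - (1 - ζ)⁻¹ * p k = (((1 - p k : ℝ) : ℂ) - ζ) / (1 - ζ) := by
        push_cast; field_simp; ring
      rw [e1, e2]
      set d : ℂ := ((1 - p k : ℝ) : ℂ) - ζ with hd
      have e3 : ((c k * (1 - p k) : ℝ) : ℂ) = c k * (d + ζ) := by rw [hd]; push_cast; ring
      rw [e3]
      field_simp
      ring
    have hn1 : ‖(1 : ℂ) - ζ‖ ≤ 1 := by
      rw [hζ, sub_sub_cancel, Complex.norm_exp]
      simp [hα0.le]
    rw [hid, norm_mul, norm_mul, norm_div]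
    have hexp : ‖cexp (-(t * (v * I)))‖ = 1 := by
      rw [Complex.norm_exp]; simp
    rw [hexp, one_mul]
    calc ‖(1 : ℂ) - ζ‖ / ‖ζ‖ *
          ‖∑ k, (c k * (1 - p k) : ℝ) / (((1 - p k : ℝ) : ℂ) - ζ)‖
        ≤ 1 / ‖ζ‖ * (B / ‖ζ‖) :=
          mul_le_mul (div_le_div_of_nonneg_right hn1 hζ0.le) (hB v) (norm_nonneg _)
            (by positivity)
      _ = B / ‖ζ‖ ^ 2 := by ring
      _ ≤ B / ((α ^ 2 + v ^ 2) / 4) := div_le_div_of_nonneg_left hB0 (by positivity) hz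
      _ = _ := by field_simp
  have h2 : ‖∫ v in (-Real.pi)..Real.pi, cexp (-(t * (v * I))) *
        (∑ k, (c k : ℂ) / (1 - cexp (v * I + α) * p k) -
          1 / (1 - (Real.exp α : ℂ) * cexp (v * I)))‖ ≤
      ∫ v in (-Real.pi)..Real.pi, 4 * B * (α ^ 2 + v ^ 2)⁻¹ := by
    have hpi := Real.pi_pos
    refine intervalIntegral.norm_integral_le_of_norm_le (by linarith)
      (Filter.Eventually.of_forall fun v hv => hpt v (abs_le.2 ⟨hv.1.le, hv.2⟩))
      ((integrable_inv_sq_add_sq hα0).const_mul _)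
  rw [intervalIntegral.integral_const_mul] at h2
  have h3 := mul_le_mul_of_nonneg_left (integral_inv_sq_add_sq_le hα0)
    (by positivity : 0 ≤ 4 * B)
  have hpi := Real.pi_pos
  rw [h1, norm_mul]
  have h4 : ‖(2 * Real.pi : ℂ)⁻¹‖ = (2 * Real.pi)⁻¹ := by simp [abs_of_pos hpi]
  rw [h4]
  calc (2 * Real.pi)⁻¹ * _ ≤ (2 * Real.pi)⁻¹ * (4 * B * (Real.pi / α)) :=
        mul_le_mul_of_nonneg_left (h2.trans h3) (by positivity)
    _ = 2 * B / α := by field_simp; ring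

end Remainder

end ComplexAnalysis

/-! ### The law of the hitting time and the rates of the levels in terms of the depths. -/

section HittingLaw

variable {Γ : Type*} [Fintype Γ] [DecidableEq Γ] [MeasurableSpace Γ] [DiscreteMeasurableSpace Γ]
  {C : ReversibleChain Γ} {S I M : Finset Γ} {m : ℕ → Γ} {β a b ε₁ ε₂ δ : ℝ}

open ReversibleChain

namespace SpectralResolution

variable (sr : SpectralResolution C S)

lemma sum_weight {x : Γ} (hx : x ∉ S) : ∑ k, sr.weight x k = 1 := by
  have h := sr.expand (f := fun y => if y ∈ S then 0 else 1) (fun y hy => if_pos hy) x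
  rw [if_neg hx] at h
  rw [h]
  exact sum_congr rfl fun k _ => mul_comm _ _

/-- By first-step analysis the survival probability is a power of the substochastic operator P
restricted off S, applied to 1. -/
lemma prob_lt_hit (t : ℕ) {x : Γ} (hx : x ∉ S) :
    C.prob x {ω | (t : WithTop ℕ) < hit S ω} = ∑ k, sr.weight x k * (1 - sr.lam k) ^ t := by
  induction t generalizing x with
  | zero => rw [C.prob_zero_lt_hit]; simp [sr.sum_weight hx]
  | succ t ih =>
    have h1 : ∀ y, (if y ∈ S then 0 else C.prob y {ω | (t : WithTop ℕ) < hit S ω}) =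
        ∑ k, (C.ip (sr.fn k) (fun y => if y ∈ S then 0 else 1) * (1 - sr.lam k) ^ t) *
          sr.fn k y := by
      intro y
      split_ifs with hy
      · exact (sum_eq_zero fun k _ => by rw [sr.fn_eq_zero k y hy, mul_zero]).symm
      · rw [ih hy]
        exact sum_congr rfl fun k _ => by rw [weight]; ring
    rw [C.prob_succ_lt_hit]
    simp only [h1]
    change C.step (fun y => ∑ k, _ * sr.fn k y) x = _
    rw [C.step_sum]
    refine sum_congr rfl fun k _ => ?_
    rw [C.step_mul_left, weight]
    have := sr.eigen k x hx
    rw [show C.step (sr.fn k) x = (1 - sr.lam k) * sr.fn k x by linarith]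
    ring

end SpectralResolution

/-- The part of the law of the hitting time that belongs to the eigenvalues below a level. -/
lemma IsLevel.abs_one_sub_sum_weight_le (h : IsLevel C I S β)
    (hspec : spectrum ℝ (1 - C.P) ⊆ Set.Icc 0 1) (sr : SpectralResolution C I) {x : Γ}
    (hx : x ∈ S \ I) :
    |1 - ∑ k ∈ univ.filter fun k => sr.lam k ≤ β / 2, sr.weight x k| ≤
      2 * diagBound C S β x / C.pot I x x := by
  have hβ := h.beta_pos
  have hf : (univ.filter fun k => sr.lam k ≤ β / 2) = univ.filter fun k => sr.lam k < β := by
    refine filter_congr fun k _ => ⟨fun hk => by linarith, fun hk => ?_⟩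
    rcases h.lam_le_or sr k with h1 | h1
    · exact h1
    · linarith
  rw [hf]
  refine norm_one_sub_sum_le (sr.weight x) sr.lam (sr.sum_weight (mem_sdiff.1 hx).2)
    sr.lam_nonneg hβ (fun k hk => ?_) fun ζ hζ => ?_
  · rcases h.lam_le_or sr k with h1 | h1 <;> linarith
  · refine h.norm_genFun_le hspec sr hζ.ge ?_ hx
    have := norm_sub_norm_le (1 : ℂ) ζ
    rw [norm_one, hζ] at this
    exact this

/-- The rate that separates the first `j` exit times from the others. -/
def levelRate (C : ReversibleChain Γ) (M I : Finset Γ) (m : ℕ → Γ) (b : ℝ) (j : ℕ) : ℝ :=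
  if j < (M \ I).card then
    1 / (48 * (cMax C M * C.pot (excl I m j) (m (j + 1)) (m (j + 1))))
  else 1 - Real.exp (-(1 / 8 * b * (Fintype.card Γ : ℝ)⁻¹))

section

variable (h : IsWellSeparated C M a b ε₁ δ) (hδ : δ ≤ 1 / 4096) (hg : IsGeneric C M ε₂)
  (hrc : rMax C M * cMax C M * ε₂ ≤ 1 / 12288) (hI : I.Nonempty) (hIM : I ⊆ M)
  (he : IsExitOrder C M I m)

include h in
lemma IsWellSeparated.one_le_cMax : 1 ≤ cMax C M := by
  obtain ⟨x, hx⟩ := id h.nonempty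
  have h1 := h.one_le_R_mul_cMax hx
  have h2 := h.R_le_one hx
  have h3 := h.cMax_pos
  nlinarith

include h in
lemma IsWellSeparated.rate_pos : 0 < 1 / 8 * b * (Fintype.card Γ : ℝ)⁻¹ := by
  have := h.b_pos
  have := h.card_univ_pos
  positivity

include h in
lemma IsWellSeparated.rate_le : 1 / 8 * b * (Fintype.card Γ : ℝ)⁻¹ ≤ 1 / 8 := by
  have h1 := h.b_le_one
  have h2 := h.b_pos
  obtain ⟨x, -⟩ := id h.nonempty
  have h3 : (1 : ℝ) ≤ Fintype.card Γ := by exact_mod_cast Fintype.card_pos_iff.2 ⟨x⟩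
  have h4 : (Fintype.card Γ : ℝ)⁻¹ ≤ 1 := inv_le_one_of_one_le₀ h3
  have h5 : 0 ≤ (Fintype.card Γ : ℝ)⁻¹ := by positivity
  nlinarith

include h in
lemma IsWellSeparated.one_sub_exp_bounds :
    b / (16 * Fintype.card Γ) ≤ 1 - Real.exp (-(1 / 8 * b * (Fintype.card Γ : ℝ)⁻¹)) ∧
      1 - Real.exp (-(1 / 8 * b * (Fintype.card Γ : ℝ)⁻¹)) ≤ b / (8 * Fintype.card Γ) := by
  have h1 := h.rate_pos
  have h2 := h.rate_le
  have hn := h.card_univ_pos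
  set α := 1 / 8 * b * (Fintype.card Γ : ℝ)⁻¹ with hα
  have e1 : b / (16 * Fintype.card Γ) = α / 2 := by rw [hα]; field_simp; ring
  have e2 : b / (8 * Fintype.card Γ) = α := by rw [hα]; field_simp
  rw [e1, e2]
  constructor
  · have h3 : Real.exp (-α) ≤ 1 / (1 + α) := by
      rw [Real.exp_neg, one_div]
      exact inv_anti₀ (by linarith) (by have := Real.add_one_le_exp α; linarith)
    have h4 : 1 / (1 + α) ≤ 1 - α / 2 := by
      rw [div_le_iff₀ (by linarith)]
      nlinarith
    linarith
  · have := Real.add_one_le_exp (-α)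
    linarith

include h hδ hg hrc hI hIM he in
-- The last level is M with β = 1 - e^{-α}, so that the circle |1 - ζ| = 1 - β is the image of the
-- line Re u = α. The bound ε₂ ≤ 1/8 needed below it follows from r c ≥ 1.
lemma IsWellSeparated.isLevel_levelRate {j : ℕ} (h1 : 1 ≤ j) (hj : j ≤ (M \ I).card) :
    IsLevel C I (excl I m j) (levelRate C M I m b j) := by
  rw [levelRate]
  split_ifs with hlt
  · refine h.isLevel_excl hg ?_ hrc hI hIM he h1 hlt
    have h2 := h.one_le_rMax_mul_cMax
    by_contra! h3
    nlinarith
  · obtain rfl : j = (M \ I).card := by omega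
    rw [he.excl_card hIM]
    exact h.isLevel_self hδ hI hIM h.one_sub_exp_bounds.1 h.one_sub_exp_bounds.2

include h hI in
lemma IsWellSeparated.levelRate_le_one (j : ℕ) : levelRate C M I m b j ≤ 1 := by
  rw [levelRate]
  split_ifs
  · have h1 := h.one_le_cMax
    have h2 := C.one_le_pot_self (hI.mono (subset_excl I m j)) (m (j + 1))
    rw [div_le_one (by positivity)]
    nlinarith
  · have := Real.exp_pos (-(1 / 8 * b * (Fintype.card Γ : ℝ)⁻¹))
    linarith

include hI he in
lemma IsExitOrder.depth_eq {j : ℕ} (h1 : 1 ≤ j) (hj : j ≤ (M \ I).card) :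
    depth C M I m b j = C.pot (excl I m (j - 1)) (m j) (m j) := by
  rw [depth, if_pos hj, he.TSup_eq hI h1 hj]

include hI he in
lemma IsExitOrder.depth_succ_eq {j : ℕ} (hj : j < (M \ I).card) :
    depth C M I m b (j + 1) = C.pot (excl I m j) (m (j + 1)) (m (j + 1)) :=
  he.depth_eq hI (j := j + 1) (by omega) hj

include h hI he in
lemma IsWellSeparated.inv_levelRate_le {j : ℕ} :
    1 / levelRate C M I m b j ≤ 48 * (cMax C M * depth C M I m b (j + 1)) := by
  have hc := h.one_le_cMax
  have hb := h.b_pos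
  have hn := h.card_univ_pos
  by_cases hlt : j < (M \ I).card
  · rw [he.depth_succ_eq hI hlt, levelRate, if_pos hlt, one_div_one_div]
  · have h7 := h.one_sub_exp_bounds.1
    rw [depth, if_neg (by omega), levelRate, if_neg hlt]
    refine (one_div_le_one_div_of_le (by positivity) h7).trans ?_
    have h9 : 1 / (b / (16 * (Fintype.card Γ : ℝ))) = 16 * (b⁻¹ * Fintype.card Γ) := by
      field_simp
    rw [h9]
    have h10 : 0 < b⁻¹ * Fintype.card Γ := by positivity
    nlinarith

include h hg hrc hI hIM he in
-- The weaker bound by T_j instead of T_{j+1}: the j-th residue is a difference of partial sums at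
-- levels j - 1 and j, and both errors must be measured in T_j.
lemma IsWellSeparated.inv_levelRate_le_self {j : ℕ} (h1 : 1 ≤ j) (hj : j ≤ (M \ I).card) :
    1 / levelRate C M I m b j ≤ 48 * (cMax C M * depth C M I m b j) := by
  have hp := C.pot_self_pos (hI.mono (subset_excl I m (j - 1))) (m j)
  have hc := h.one_le_cMax
  have hb := h.b_pos
  have hn := h.card_univ_pos
  rw [he.depth_eq hI h1 hj]
  by_cases hlt : j < (M \ I).card
  · have h2 := he.pot_succ_le hI hIM hg h1 hlt
    have h3 := h.one_le_rMax_mul_cMax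
    have h4 : ε₂ ≤ 1 := by
      by_contra! h4
      nlinarith
    rw [levelRate, if_pos hlt, one_div_one_div]
    gcongr
    nlinarith
  · have h2 := h.card_mul_inv_le_cMax_mul (hI.mono (subset_excl I m (j - 1)))
      (he.excl_subset hIM (by omega)) (he.mem_sdiff h1 hj)
    have h7 := h.one_sub_exp_bounds.1
    rw [levelRate, if_neg hlt]
    refine (one_div_le_one_div_of_le (by positivity) h7).trans ?_
    have h9 : 1 / (b / (16 * (Fintype.card Γ : ℝ))) = 16 * (Fintype.card Γ * b⁻¹) := by
      field_simp
    rw [h9]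
    have := mul_pos (zero_lt_one.trans_le hc) hp
    linarith

include h hδ hg hrc hI hIM he in
/-- The bound of the resolvent at a level in terms of the depths. -/
lemma IsWellSeparated.diagBound_div_le {j : ℕ} (h1 : 1 ≤ j) (hj : j ≤ (M \ I).card) {D : ℝ}
    (hD : 1 / levelRate C M I m b j ≤ 48 * (cMax C M * D)) :
    2 * diagBound C (excl I m j) (levelRate C M I m b j) (m 1) / C.pot I (m 1) (m 1) ≤
      3840 * (R C M (m 1) * cMax C M * D / depth C M I m b 1) := by
  have hlev := h.isLevel_levelRate hδ hg hrc hI hIM he h1 hj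
  have hβ := hlev.beta_pos
  have hd1 : depth C M I m b 1 = C.pot I (m 1) (m 1) := by
    rw [he.depth_eq hI le_rfl (h1.trans hj), Nat.sub_self, excl_zero]
  have hp := C.pot_self_pos hI (m 1)
  have hmM := he.mem le_rfl (h1.trans hj)
  have hR := h.R_pos hmM
  -- 40 is the 5 of `diagBound` times the 8 of `valleyMass_le_selfMass`; with 48 and the factor 2 of
  -- the claim this makes 3840.
  have h2 : diagBound C (excl I m j) (levelRate C M I m b j) (m 1) ≤
      40 * R C M (m 1) / levelRate C M I m b j := by
    have h3 := h.valleyMass_le_selfMass (he.excl_subset hIM hj) (mem_excl I m le_rfl h1)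
    have h4 := h.R_mul_valleyMass hmM
    have h5 := h.valleyMass_pos hmM
    rw [diagBound, mul_comm (levelRate C M I m b j), ← div_div]
    refine div_le_div_of_nonneg_right ?_ hβ.le
    rw [div_le_iff₀ (by linarith), ← h4]
    have := mul_le_mul_of_nonneg_left h3 hR.le
    linarith
  rw [hd1, ← mul_div_assoc]
  refine div_le_div_of_nonneg_right ?_ hp.le
  have h11 := mul_le_mul_of_nonneg_left hD hR.le
  have h12 : 40 * R C M (m 1) / levelRate C M I m b j =
      40 * (R C M (m 1) * (1 / levelRate C M I m b j)) := by ring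
  linarith

end

end HittingLaw

/-! ### Assembly for a single chain. -/

section ExitLaw

variable {Γ : Type*} [Fintype Γ] [DecidableEq Γ] [MeasurableSpace Γ] [DiscreteMeasurableSpace Γ]
  {C : ReversibleChain Γ} {I M : Finset Γ} {m : ℕ → Γ} {a b ε₁ ε₂ δ : ℝ}

open ReversibleChain

/-- The eigenvalues below the levels, one for each metastable point outside `I`. -/
lemma SpectralResolution.exists_low (sr : SpectralResolution C I) {n : ℕ} (hn : 1 ≤ n) {β : ℕ → ℝ}
    (hcard : ∀ j ∈ Icc 1 n, (univ.filter fun k => sr.lam k ≤ β j / 2).card = j) :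
    ∃ e : ℕ → {x // x ∉ I}, (∀ j ∈ Icc 1 n, sr.lam (e j) = eigenvalue C I j) ∧
      (∀ j ∈ Icc 1 n, sr.lam (e j) ≤ β j / 2) ∧ Set.InjOn e (Icc 1 n) ∧
      (∀ j ∈ Icc 1 n, (univ.filter fun k => sr.lam k ≤ β j / 2) = (Icc 1 j).image e) ∧
      (∀ j ∈ Icc 1 n, ∀ k, k ≠ e j → sr.lam k ≠ sr.lam (e j)) ∧
      ∀ k, eigenvalue C I 1 ≤ sr.lam k := by
  have hle : ∀ j ∈ Icc 1 n, j ≤ Fintype.card {x // x ∉ I} := fun j hj => by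
    rw [← hcard j hj]
    exact sr.card_filter_le _
  have hex : ∀ j, ∃ k, j ∈ Icc 1 n → sr.lam k = eigenvalue C I j := by
    intro j
    by_cases hj : j ∈ Icc 1 n
    · obtain ⟨k, hk⟩ := sr.exists_lam_eq_eigenvalue (mem_Icc.1 hj).1 (hle j hj)
      exact ⟨k, fun _ => hk⟩
    · have h1 : 1 ∈ Icc 1 n := mem_Icc.2 ⟨le_rfl, hn⟩
      obtain ⟨k, -⟩ := sr.exists_lam_eq_eigenvalue le_rfl (hle 1 h1)
      exact ⟨k, fun h => absurd h hj⟩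
  choose e he using hex
  -- Exactly j eigenvalues are at most β_j / 2, so the i-th is among them if and only if i ≤ j.
  -- Strict ordering and simplicity follow.
  have hiff : ∀ i ∈ Icc 1 n, ∀ j ∈ Icc 1 n, sr.lam (e i) ≤ β j / 2 ↔ i ≤ j := by
    intro i hi j hj
    rw [he i hi, sr.eigenvalue_le_iff (mem_Icc.1 hi).1 (hle i hi), hcard j hj]
  have hlt : ∀ i ∈ Icc 1 n, ∀ j ∈ Icc 1 n, i < j → sr.lam (e i) < sr.lam (e j) := by
    intro i hi j hj hij
    have h1 := (hiff i hi i hi).2 le_rfl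
    have h2 := mt (hiff j hj i hi).1 (not_le.2 hij)
    linarith
  have hinj : ∀ i ∈ Icc 1 n, ∀ j ∈ Icc 1 n, sr.lam (e i) = sr.lam (e j) → i = j := by
    intro i hi j hj hij
    rcases lt_trichotomy i j with h | h | h
    · exact absurd hij (hlt i hi j hj h).ne
    · exact h
    · exact absurd hij.symm (hlt j hj i hi h).ne
  have hinj' : Set.InjOn e (Icc 1 n) := fun i hi j hj hij =>
    hinj i (mem_coe.1 hi) j (mem_coe.1 hj) (by rw [hij])
  have hset : ∀ j ∈ Icc 1 n,
      (univ.filter fun k => sr.lam k ≤ β j / 2) = (Icc 1 j).image e := by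
    intro j hj
    have hsub : Icc 1 j ⊆ Icc 1 n := Icc_subset_Icc_right (mem_Icc.1 hj).2
    symm
    refine eq_of_subset_of_card_le (fun k hk => ?_) ?_
    · obtain ⟨i, hi, rfl⟩ := mem_image.1 hk
      exact mem_filter.2 ⟨mem_univ _, (hiff i (hsub hi) j hj).2 (mem_Icc.1 hi).2⟩
    · rw [hcard j hj, card_image_of_injOn (hinj'.mono (coe_subset.2 hsub)), Nat.card_Icc]
      omega
  refine ⟨e, he, fun j hj => (hiff j hj j hj).2 le_rfl, hinj', hset, ?_, ?_⟩
  · intro j hj k hk heq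
    have h1 : k ∈ univ.filter fun k => sr.lam k ≤ β j / 2 :=
      mem_filter.2 ⟨mem_univ _, heq.le.trans ((hiff j hj j hj).2 le_rfl)⟩
    rw [hset j hj] at h1
    obtain ⟨i, hi, rfl⟩ := mem_image.1 h1
    have hsub : Icc 1 j ⊆ Icc 1 n := Icc_subset_Icc_right (mem_Icc.1 hj).2
    exact hk (by rw [hinj i (hsub hi) j hj heq])
  · intro k
    rw [sr.eigenvalue_le_iff le_rfl (hle 1 (mem_Icc.2 ⟨le_rfl, hn⟩))]
    exact card_pos.2 ⟨k, mem_filter.2 ⟨mem_univ _, le_rfl⟩⟩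

/-- The law of the exit time of a single chain. -/
theorem IsWellSeparated.exit_law (h : IsWellSeparated C M a b ε₁ δ) (hδ : δ ≤ 1 / 4096)
    (hg : IsGeneric C M ε₂) (hrc : rMax C M * cMax C M * ε₂ ≤ 1 / 12288)
    (hspec : spectrum ℝ (1 - C.P) ⊆ Set.Icc 0 1) (hI : I.Nonempty) (hIM : I ⊆ M)
    (hMI : (M \ I).Nonempty) (he : IsExitOrder C M I m) :
    ∃ (L : ℂ → ℂ) (res : ℕ → ℂ),
      IsLaplaceContinuation C I (m 1) L ∧
      (∀ j ∈ Icc 1 (M \ I).card, HasResidueAt L (rate C I j) (res j)) ∧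
      IntervalIntegrable
        (fun v : ℝ => L (v * Complex.I + (1 / 8 * b * (Fintype.card Γ : ℝ)⁻¹ : ℝ)))
        volume (-Real.pi) Real.pi ∧
      (∀ t : ℕ, (C.prob (m 1) {ω | (t : WithTop ℕ) < hit I ω} : ℂ) =
        -∑ j ∈ Icc 1 (M \ I).card, Complex.exp (-(t * rate C I j)) * res j +
        Complex.exp (-(t * (1 / 8 * b * (Fintype.card Γ : ℝ)⁻¹ : ℝ))) *
          remainder L (1 / 8 * b * (Fintype.card Γ : ℝ)⁻¹) t) ∧
      ‖res 1 + 1‖ ≤ 8000 * (R C M (m 1) * cMax C M * depth C M I m b 2 / depth C M I m b 1) ∧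
      (∀ j ∈ Icc 2 (M \ I).card, ‖res j‖ ≤
        8000 * (R C M (m 1) * cMax C M * depth C M I m b j / depth C M I m b 1)) ∧
      (∀ t : ℕ, ‖remainder L (1 / 8 * b * (Fintype.card Γ : ℝ)⁻¹) t‖ ≤
        8000 * ((cMax C M)⁻¹ * b⁻¹ ^ 2 * (Fintype.card Γ : ℝ) ^ 2 / depth C M I m b 1)) := by
  obtain ⟨sr⟩ := nonempty_spectralResolution C I
  set j₀ := (M \ I).card with hj₀
  have hj1 : 1 ≤ j₀ := Finset.card_pos.2 hMI
  set β := levelRate C M I m b with hβ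
  set α := 1 / 8 * b * (Fintype.card Γ : ℝ)⁻¹ with hα
  have hα0 : 0 < α := h.rate_pos
  have hα1 : α ≤ 1 / 8 := h.rate_le
  have hlev : ∀ j ∈ Icc 1 j₀, IsLevel C I (excl I m j) (β j) := fun j hj =>
    h.isLevel_levelRate hδ hg hrc hI hIM he (mem_Icc.1 hj).1 (mem_Icc.1 hj).2
  have hj0mem : j₀ ∈ Icc 1 j₀ := mem_Icc.2 ⟨hj1, le_rfl⟩
  have h1mem : 1 ∈ Icc 1 j₀ := mem_Icc.2 ⟨le_rfl, hj1⟩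
  obtain ⟨e, hee, hele, hinj, hset, hne, hmin⟩ := sr.exists_low hj1 (β := β) fun j hj => by
    rw [(hlev j hj).card_eq sr, he.card_excl_sdiff (mem_Icc.1 hj).2]
  have hm1 : m 1 ∉ I := he.notMem le_rfl hj1
  have hmS : ∀ j ∈ Icc 1 j₀, m 1 ∈ excl I m j \ I := fun j hj =>
    Finset.mem_sdiff.2 ⟨mem_excl I m le_rfl (mem_Icc.1 hj).1, hm1⟩
  have hmM := he.mem le_rfl hj1
  set c := sr.weight (m 1) with hc
  set p : {x // x ∉ I} → ℝ := fun k => 1 - sr.lam k with hp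
  have hp0 : ∀ k, 0 ≤ p k := fun k => sub_nonneg.2 (sr.lam_le_one hspec k)
  have hcsum : ∑ k, c k = 1 := sr.sum_weight hm1
  have hβα : β j₀ = 1 - Real.exp (-α) := if_neg (lt_irrefl _)
  clear_value α
  -- By the choice of β_{j₀} the line Re u = α corresponds to λ = β_{j₀}, and the gap around this
  -- value keeps all poles off the line.
  have hqiff : ∀ k, Real.exp α * p k < 1 ↔ β j₀ < sr.lam k := fun k => by
    rw [← lt_div_iff₀' (Real.exp_pos α), one_div, ← Real.exp_neg, hβα]
    constructor <;> intro hk <;> simp only [hp] at * <;> linarith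
  have hq : ∀ k, Real.exp α * p k ≠ 1 := fun k hk => by
    have h1 : p k = Real.exp (-α) := by
      rw [Real.exp_neg, eq_comm, inv_eq_iff_eq_inv, ← one_div, eq_div_iff (fun h0 => by
        rw [h0, mul_zero] at hk; exact zero_ne_one hk), hk]
    have h2 : sr.lam k = β j₀ := by rw [hβα, ← h1]; simp [hp]
    have h3 := (hlev j₀ hj0mem).beta_pos
    rcases (hlev j₀ hj0mem).lam_le_or sr k with h4 | h4 <;> linarith
  have hrate : ∀ j ∈ Icc 1 j₀, rate C I j = -Real.log (p (e j)) := fun j hj => by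
    rw [rate, ← hee j hj]
  have hpe : ∀ j ∈ Icc 1 j₀, 0 < p (e j) := fun j hj => by
    have h1 := hele j hj
    have h2 : β j ≤ 1 := h.levelRate_le_one hI j
    simp only [hp]
    linarith
  have hsum : ∀ j ∈ Icc 1 j₀, ∀ {D : ℝ}, 1 / β j ≤ 48 * (cMax C M * D) →
      |1 - ∑ i ∈ Icc 1 j, c (e i)| ≤
        3840 * (R C M (m 1) * cMax C M * D / depth C M I m b 1) := by
    intro j hj D hD
    have h1 := (hlev j hj).abs_one_sub_sum_weight_le hspec sr (hmS j hj)
    rw [hset j hj, sum_image (hinj.mono (coe_subset.2 (Icc_subset_Icc_right (mem_Icc.1 hj).2)))]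
      at h1
    exact h1.trans (h.diagBound_div_le hδ hg hrc hI hIM he (mem_Icc.1 hj).1 (mem_Icc.1 hj).2 hD)
  have hcm := h.cMax_pos
  have hR := h.R_pos hmM
  have hd1 : depth C M I m b 1 = C.pot I (m 1) (m 1) := by
    rw [he.depth_eq hI le_rfl hj1, Nat.sub_self, excl_zero]
  have hT1 : 0 < depth C M I m b 1 := by rw [hd1]; exact C.pot_self_pos hI _
  have hbnd : ∀ D, 0 ≤ D → 0 ≤ R C M (m 1) * cMax C M * D / depth C M I m b 1 := fun D hD => by
    positivity
  refine ⟨fun u => ∑ k, (c k : ℂ) / (1 - Complex.exp u * p k), fun j => -(c (e j) : ℂ),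
    ⟨meromorphic_sum_div_one_sub_exp c p, fun u hu => ?_⟩, fun j hj => ?_, ?_, fun t => ?_, ?_,
    fun j hj => ?_, fun t => ?_⟩
  · simp only [sr.prob_lt_hit _ hm1]
    refine hasSum_exp_mul_sum c p fun k => ?_
    have h1 : p k ≤ p (e 1) := by
      have := hmin k
      rw [← hee 1 h1mem] at this
      simp only [hp]
      linarith
    have h2 := hpe 1 h1mem
    rw [hrate 1 h1mem] at hu
    rw [norm_mul, Complex.norm_exp, Complex.norm_real, Real.norm_of_nonneg (hp0 k)]
    calc Real.exp u.re * p k ≤ Real.exp u.re * p (e 1) :=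
          mul_le_mul_of_nonneg_left h1 (Real.exp_pos _).le
      _ < Real.exp (-Real.log (p (e 1))) * p (e 1) :=
          mul_lt_mul_of_pos_right (Real.exp_lt_exp.2 hu) h2
      _ = 1 := by rw [Real.exp_neg, Real.exp_log h2, inv_mul_cancel₀ h2.ne']
  · rw [hrate j hj]
    refine hasResidueAt_sum_div_one_sub_exp c p (e j) (hpe j hj) fun k hk heq => hne j hj k hk ?_
    simp only [hp] at heq
    linarith
  · exact (continuous_sum_line hp0 hq).intervalIntegrable _ _
  · rw [remainder_sum hp0 hq, sr.prob_lt_hit t hm1]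
    have h1 : ∑ k, c k * p k ^ t = ∑ j ∈ Icc 1 j₀, c (e j) * p (e j) ^ t +
        ∑ k, c k * if Real.exp α * p k < 1 then p k ^ t else 0 := by
      rw [← sum_image (f := fun k => c k * p k ^ t) hinj, ← hset j₀ hj0mem, sum_filter,
        ← sum_add_distrib]
      refine sum_congr rfl fun k _ => ?_
      have h3 := (hlev j₀ hj0mem).beta_pos
      rcases (hlev j₀ hj0mem).lam_le_or sr k with h4 | h4
      · rw [if_pos h4, if_neg fun h5 => by have := (hqiff k).1 h5; linarith]
        ring
      · rw [if_neg (by linarith), if_pos ((hqiff k).2 (by linarith))]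
        ring
    change ((∑ k, c k * p k ^ t : ℝ) : ℂ) = _
    rw [h1, Complex.ofReal_add]
    congr 1
    · rw [Complex.ofReal_sum, ← sum_neg_distrib]
      refine sum_congr rfl fun j hj => ?_
      have h2 := hpe j hj
      have h3 : Complex.exp (-(t * rate C I j)) = ((p (e j) ^ t : ℝ) : ℂ) := by
        rw [hrate j hj, show (-((t : ℂ) * ((-Real.log (p (e j)) : ℝ) : ℂ))) =
          ((t * Real.log (p (e j)) : ℝ) : ℂ) by push_cast; ring, ← Complex.ofReal_exp,
          Real.exp_nat_mul, Real.exp_log h2]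
      rw [h3]
      push_cast
      ring
    · rw [Complex.ofReal_sum, mul_sum]
      refine sum_congr rfl fun k _ => ?_
      have h3 : Complex.exp (-(t * (α : ℂ))) * ((Real.exp α * p k : ℝ) : ℂ) ^ t = (p k : ℂ) ^ t := by
        rw [Complex.exp_neg, Complex.exp_nat_mul, Complex.ofReal_mul, mul_pow, Complex.ofReal_exp,
          ← mul_assoc, inv_mul_cancel₀ (pow_ne_zero _ (Complex.exp_ne_zero _)), one_mul]
      split_ifs
      · rw [mul_left_comm, h3]
        push_cast
        ring
      · simp
  · have h1 := hsum 1 h1mem (D := depth C M I m b 2) (h.inv_levelRate_le hI he)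
    rw [Icc_self, sum_singleton] at h1
    -- Read off from the bound on the rate, which covers j₀ = 1, where T_2 is |Γ|/b, as well.
    have h2 : 0 ≤ depth C M I m b 2 := by
      by_contra! h3
      have h4 := h.inv_levelRate_le hI he (j := 1)
      have h5 := (hlev 1 h1mem).beta_pos
      have h6 := one_div_pos.2 h5
      have h7 := mul_neg_of_pos_of_neg hcm h3
      linarith
    have h3 := hbnd _ h2
    have h4 : ‖-(c (e 1) : ℂ) + 1‖ = |1 - c (e 1)| := by
      rw [← Real.norm_eq_abs, ← Complex.norm_real]
      congr 1
      push_cast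
      ring
    rw [h4]
    linarith
  · have hj2 := mem_Icc.1 hj
    have hjm : j ∈ Icc 1 j₀ := mem_Icc.2 ⟨by omega, hj2.2⟩
    have hj1m : j - 1 ∈ Icc 1 j₀ := mem_Icc.2 ⟨by omega, by omega⟩
    -- The weight of mode j is the difference of two partial sums, each within 3840 R c T_j / T_1 of
    -- 1, so 7680 ≤ 8000 suffices.
    have h1 := hsum j hjm (h.inv_levelRate_le_self hg hrc hI hIM he (mem_Icc.1 hjm).1 hj2.2)
    have h2 := hsum (j - 1) hj1m (D := depth C M I m b j) (by
      have := h.inv_levelRate_le hI he (j := j - 1)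
      rwa [Nat.sub_add_cancel (by omega)] at this)
    have h3 : ∑ i ∈ Icc 1 j, c (e i) = ∑ i ∈ Icc 1 (j - 1), c (e i) + c (e j) := by
      obtain ⟨i, rfl⟩ : ∃ i, j = i + 1 := ⟨j - 1, by omega⟩
      rw [sum_Icc_succ_top (by omega), Nat.add_sub_cancel]
    rw [norm_neg, Complex.norm_real, Real.norm_eq_abs]
    have h4 : 0 ≤ depth C M I m b j := by
      rw [he.depth_eq hI (by omega) hj2.2]
      exact (C.pot_self_pos (hI.mono (subset_excl I m _)) _).le
    have h5 := hbnd _ h4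
    rw [abs_le] at h1 h2 ⊢
    constructor <;> linarith
  -- B = 4/T_1 comes from `norm_mul_genFun_le` and leads to 64 |Γ|/(b T_1). The bound 1/c ≥ b/(4|Γ|)
  -- converts this to the stated form.
  · have h1 := norm_remainder_le (c := c) (p := p) (α := α) hcsum hp0 hq hα0 hα1
      (B := 4 / depth C M I m b 1) (by positivity) (fun v => ?_) t
    · refine h1.trans ?_
      have h2 := h.le_inv_cMax
      have hn := h.card_univ_pos
      have hb := h.b_pos
      have h3 : 1 / 4 ≤ (cMax C M)⁻¹ * (b⁻¹ * Fintype.card Γ) := by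
        calc (1 : ℝ) / 4 = b / (4 * Fintype.card Γ) * (b⁻¹ * Fintype.card Γ) := by field_simp
          _ ≤ _ := mul_le_mul_of_nonneg_right h2 (by positivity)
      have h4 : 2 * (4 / depth C M I m b 1) / α =
          64 * (b⁻¹ * Fintype.card Γ) / depth C M I m b 1 := by
        rw [hα]; field_simp; ring
      rw [h4, ← mul_div_assoc]
      refine div_le_div_of_nonneg_right ?_ hT1.le
      have h5 : 0 < b⁻¹ * (Fintype.card Γ : ℝ) := by positivity
      nlinarith [mul_le_mul_of_nonneg_right h3 h5.le]
    · set ζ : ℂ := 1 - Complex.exp (-(v * Complex.I + α)) with hζ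
      have hn1 : ‖1 - ζ‖ = 1 - β j₀ := by
        rw [hζ, sub_sub_cancel, Complex.norm_exp, hβα]
        simp
      have hn2 : β j₀ ≤ ‖ζ‖ := by
        have := norm_sub_norm_le (1 : ℂ) (1 - ζ)
        rw [norm_one, hn1, sub_sub_cancel (1 : ℂ) ζ] at this
        linarith
      have h2 := (hlev j₀ hj0mem).norm_mul_genFun_le hspec sr hn2 hn1.ge (hmS j₀ hj0mem)
      rw [hd1, div_right_comm]
      refine le_of_eq_of_le (congrArg norm ?_) h2
      refine sum_congr rfl fun k _ => ?_
      simp only [hp, sub_sub_cancel, hc]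

end ExitLaw

end Metastability

end

/-! ### Uniformity in N. -/

open Metastability in
theorem theorem6p1 {Γ : ℕ → Type*} [∀ N, Fintype (Γ N)] [∀ N, DecidableEq (Γ N)]
    [∀ N, MeasurableSpace (Γ N)] [∀ N, DiscreteMeasurableSpace (Γ N)]
    (X : ∀ N, ReversibleChain (Γ N)) (M : ∀ N, Finset (Γ N)) (a b ε₁ ε₂ : ℕ → ℝ)
    (hspec : ∀ N, spectrum ℝ (1 - (X N).P) ⊆ Set.Icc 0 1)
    (hmeta : ∀ N, IsMetastableSet (X N) (M N) (a N) (b N))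
    (hab : ∀ N, (a N)⁻¹ ≤ ε₁ N * b N) (hε₁ : Tendsto ε₁ atTop (𝓝 0))
    (hgen : ∀ N, IsGeneric (X N) (M N) (ε₂ N)) (hε₂ : Tendsto ε₂ atTop (𝓝 0))
    (h₁ : Tendsto (fun N => rMax (X N) (M N) * ε₁ N * Fintype.card (Γ N) * (M N).card)
      atTop (𝓝 0))
    (h₂ : Tendsto (fun N => rMax (X N) (M N) * cMax (X N) (M N) * ε₂ N) atTop (𝓝 0)) :
    ∃ c K : ℝ, 0 < c ∧ 0 < K ∧ ∀ᶠ N in atTop, ∀ (I : Finset (Γ N)) (m : ℕ → Γ N),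
      I ⊆ M N → I.Nonempty → (M N \ I).Nonempty → IsExitOrder (X N) (M N) I m →
      ∃ (L : ℂ → ℂ) (res : ℕ → ℂ),
        IsLaplaceContinuation (X N) I (m 1) L ∧
        (∀ j ∈ Finset.Icc 1 (M N \ I).card, HasResidueAt L (rate (X N) I j) (res j)) ∧
        IntervalIntegrable
          (fun v : ℝ => L (v * Complex.I + (c * b N * (Fintype.card (Γ N) : ℝ)⁻¹ : ℝ)))
          volume (-Real.pi) Real.pi ∧
        (∀ t : ℕ, ((X N).prob (m 1) {ω | (t : WithTop ℕ) < hit I ω} : ℂ) =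
          -∑ j ∈ Finset.Icc 1 (M N \ I).card, Complex.exp (-(t * rate (X N) I j)) * res j +
          Complex.exp (-(t * (c * b N * (Fintype.card (Γ N) : ℝ)⁻¹ : ℝ))) *
            remainder L (c * b N * (Fintype.card (Γ N) : ℝ)⁻¹) t) ∧
        ‖res 1 + 1‖ ≤ K * (R (X N) (M N) (m 1) * cMax (X N) (M N) *
          depth (X N) (M N) I m (b N) 2 / depth (X N) (M N) I m (b N) 1) ∧
        (∀ j ∈ Finset.Icc 2 (M N \ I).card,
          ‖res j‖ ≤ K * (R (X N) (M N) (m 1) * cMax (X N) (M N) *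
            depth (X N) (M N) I m (b N) j / depth (X N) (M N) I m (b N) 1)) ∧
        (∀ t : ℕ, ‖remainder L (c * b N * (Fintype.card (Γ N) : ℝ)⁻¹) t‖ ≤
          K * ((cMax (X N) (M N))⁻¹ * (b N)⁻¹ ^ 2 * (Fintype.card (Γ N) : ℝ) ^ 2 /
            depth (X N) (M N) I m (b N) 1)) := by
  -- The value 1/8 makes β_{j₀} ≤ b/(8|Γ|), which is at most 1/(8·trace) for the Green trace of M.
  -- The limits are used only through the two thresholds, which do not involve I or m; hence
  -- uniformity in both.
  refine ⟨1 / 8, 8000, by norm_num, by norm_num, ?_⟩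
  filter_upwards [h₁.eventually (eventually_le_nhds (by norm_num : (0 : ℝ) < 1 / 4096)),
    h₂.eventually (eventually_le_nhds (by norm_num : (0 : ℝ) < 1 / 12288))]
    with N hN₁ hN₂ I m hIM hI hMI he
  have h : IsWellSeparated (X N) (M N) (a N) (b N) (ε₁ N) (1 / 4096) :=
    ⟨hmeta N, hI.mono hIM, hab N, hN₁, by norm_num⟩
  exact h.exit_law le_rfl (hgen N) hN₂ (hspec N) hI hIM hMI he
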